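/- **Setting.** Let $k>0$. Let $\Omega_0\subset\mathbb R^2$ be a bounded open set and let $\Omega_1,\dots,\Omega_P$ be half-infinite rectangles, pairwise disjoint and disjoint from $\Omega_0$. After a translation and rotation, $\Omega_p=\{(x_p,y_p): x_p>0,\ |y_p|<d_p/2\}$, and $\gamma_p=\{x_p=0,\ |y_p|<d_p/2\}$ is the interface between $\Omega_p$ and $\Omega_0$. The straight channels continue into $\Omega_0$ for a length at least $L>0$: the rectangle $\{-L<x_p<0,\ |y_p|<d_p/2\}$ lies in $\Omega_0$ and its two sides $\{-L\le x_p\le 0,\ y_p=\pm d_p/2\}$ lie in $\partial\Omega_0$. Put $\Gamma=\partial\Omega_0\setminus\bigcup_p\gamma_p$. For $m\ge 1$ let, in the Dirichlet case, $\mu_m^p=m\pi/d_p$ and $b_m^p(y)=\sqrt{2/d_p}\,\sin(\mu_m^p(y+d_p/2))$, and, in the Neumann case, $\mu_m^p=(m-1)\pi/d_p$ and $b_m^p(y)=\sqrt{(2-\delta_{m1})/d_p}\,\cos(\mu_m^p(y+d_p/2))$. Let $\beta_m^p=\sqrt{k^2-(\mu_m^p)^2}$, with $\beta_m^p\ge 0$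 if $\mu_m^p\le k$ and $\beta_m^p\in i(0,\infty)$ otherwise, and let $M_p=\#\{m\ge1:\mu_m^p<k\}$ be the number of propagating modes. Put $$\mathcal P_m^p u=\int_{\gamma_p} b_m^p\,u,\qquad \mathcal P_m'^{\,p}u=\int_{\gamma_p} b_m^p\,\partial_{x_p}u .$$ Given incoming coefficients $c_{m,-}^p\in\mathbb C$ ($1\le m\le M_p$), let $u_p^{\rm in}=\sum_{m=1}^{M_p}c_{m,-}^p e^{-i\beta_m^px_p}b_m^p(y_p)$. We say that $u_0\in H^1(\Omega_0)$ and $u_p\in H^1_{\rm loc}(\overline{\Omega_p})$, $p=1,\dots,P$, solve the scattering system if, in the weak sense, * $\Delta u_0+k^2u_0=0$ in $\Omega_0$ and $\Delta u_p+k^2u_p=0$ in $\Omega_p$; * $u_0=0$ on $\Gamma$ and $u_p=0$ on $\partial\Omega_p\setminus\gamma_p$ (Dirichlet case), or $\partial_nu_0=0$ on $\Gamma$ and $\partial_nu_p=0$ on $\partial\Omega_p\setminus\gamma_p$ (Neumann case); * $u_0=u_p+u_p^{\rm in}$ and $\partial_{x_p}u_0=\partial_{x_p}u_p+\partial_{x_p}u_p^{\rm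 in}$ on $\gamma_p$, for every $p$; * $(\mathcal P_m'^{\,p}-i\beta_m^p\mathcal P_m^p)u_p=0$ for all $m\ge1$ and all $p$ (outgoing condition). (Boundary values are traces; normal derivatives on $\gamma_p$ are defined by Green's identity.) **Theorem 2.2.** Consider either the Dirichlet or the Neumann case. 1. If all incoming coefficients vanish and $u_0,\dots,u_P$ solve the scattering system, then $$(\mathcal P_m'^{\,p}+i\beta_m^p\mathcal P_m^p)u_p=0\qquad\text{for } m=1,\dots,M_p \text{ and all } p .$$ 2. Consequently the outgoing propagating coefficients are determined by the incoming ones: if $(u_0,\dots,u_P)$ and $(v_0,\dots,v_P)$ solve the scattering system with the same incoming coefficients, then $c_{m,+}^p(u)=c_{m,+}^p(v)$ for $m=1,\dots,M_p$ and all $p$, where $c_{m,+}^p(u)=\frac{1}{2i\beta_m^p}(\mathcal P_m'^{\,p}+i\beta_m^p\mathcal P_m^p)u_p$. -/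

import Mathlib

open MeasureTheory Set
open scoped ContDiff ENNReal

noncomputable section

namespace Guide

/-- The homogeneous condition imposed on the metallic walls. -/
inductive WallCondition where
  | dirichlet
  | neumann

/-! ### Sobolev functions, traces, boundary conditions -/

/-- A complex function on the plane recorded together with its two weak partial derivatives
(`IsH1On` below says that `dx`, `dy` are the weak derivatives of `val`). -/
structure Field where
  val : ℝ × ℝ → ℂ
  dx : ℝ × ℝ → ℂ
  dy : ℝ × ℝ → ℂ

/-- Smooth compactly supported functions on the plane. -/
def IsTest (φ : ℝ × ℝ → ℂ) : Prop := ContDiff ℝ ∞ φ ∧ HasCompactSupport φ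

/-- Classical partial derivatives (used for smooth test functions only). -/
def pdx (φ : ℝ × ℝ → ℂ) (z : ℝ × ℝ) : ℂ := fderiv ℝ φ z (1, 0)
def pdy (φ : ℝ × ℝ → ℂ) (z : ℝ × ℝ) : ℂ := fderiv ℝ φ z (0, 1)

/-- `F ∈ H¹(Ω)`: function and weak gradient are square integrable on the open set `Ω`. -/
def IsH1On (Ω : Set (ℝ × ℝ)) (F : Field) : Prop :=
  MemLp F.val 2 (volume.restrict Ω) ∧
  MemLp F.dx 2 (volume.restrict Ω) ∧
  MemLp F.dy 2 (volume.restrict Ω) ∧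
  ∀ φ : ℝ × ℝ → ℂ, IsTest φ → tsupport φ ⊆ Ω →
    (∫ z in Ω, F.val z * pdx φ z = -∫ z in Ω, F.dx z * φ z) ∧
    (∫ z in Ω, F.val z * pdy φ z = -∫ z in Ω, F.dy z * φ z)

/-- `F` vanishes on the part `Γ` of the boundary of `Ω`: it is a limit in `H¹(Ω)` of
smooth functions that vanish near `Γ`. -/
def VanishesOn (Ω Γ : Set (ℝ × ℝ)) (F : Field) : Prop :=
  ∀ ε : ℝ≥0∞, 0 < ε → ∃ φ : ℝ × ℝ → ℂ, IsTest φ ∧ Disjoint (tsupport φ) Γ ∧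
    eLpNorm (fun z => F.val z - φ z) 2 (volume.restrict Ω) ≤ ε ∧
    eLpNorm (fun z => F.dx z - pdx φ z) 2 (volume.restrict Ω) ≤ ε ∧
    eLpNorm (fun z => F.dy z - pdy φ z) 2 (volume.restrict Ω) ≤ ε

/-- The energy space on `Ω` for walls `Γ`: `{F ∈ H¹(Ω) : F = 0 on Γ}` in the Dirichlet case,
`H¹(Ω)` in the Neumann case (where the wall condition is the natural one, see
`SolvesInCore` and `SolvesInPort`). -/
def InEnergySpace (bc : WallCondition) (Ω Γ : Set (ℝ × ℝ)) (F : Field) : Prop :=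
  IsH1On Ω F ∧ (bc = WallCondition.dirichlet → VanishesOn Ω Γ F)

/-- The bilinear form `∫_Ω (∇F · ∇G - k² F G)` of the operator `-(Δ + k²)`. -/
def helmholtzForm (k : ℝ) (Ω : Set (ℝ × ℝ)) (F G : Field) : ℂ :=
  ∫ z in Ω, (F.dx z * G.dx z + F.dy z * G.dy z - (k : ℂ) ^ 2 * (F.val z * G.val z))

/-! ### The half-infinite channel of width `d`, in its local coordinates -/

/-- The open half-strip `x > 0`, `-d/2 < y < d/2`. -/
def channel (d : ℝ) : Set (ℝ × ℝ) := Ioi 0 ×ˢ Ioo (-d / 2) (d / 2)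

/-- The part of the half-strip with `x < R`. -/
def channelTrunc (d R : ℝ) : Set (ℝ × ℝ) := Ioo 0 R ×ˢ Ioo (-d / 2) (d / 2)

/-- The two side walls of the half-strip. -/
def channelWalls (d : ℝ) : Set (ℝ × ℝ) := {z | 0 ≤ z.1 ∧ (z.2 = -d / 2 ∨ z.2 = d / 2)}

/-- `F` is locally (up to the boundary, not at infinity) in the energy space. -/
def InLocalEnergySpace (bc : WallCondition) (d : ℝ) (F : Field) : Prop :=
  ∀ R : ℝ, 0 < R → InEnergySpace bc (channelTrunc d R) (channelWalls d) F

/-- Admissible weak test functions in the channel: elements of the energy space that vanish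
for large `x`. -/
def IsChannelTest (bc : WallCondition) (d : ℝ) (G : Field) : Prop :=
  InEnergySpace bc (channel d) (channelWalls d) G ∧
  ∃ R : ℝ, ∀ z : ℝ × ℝ, R ≤ z.1 → G.val z = 0 ∧ G.dx z = 0 ∧ G.dy z = 0

/-- `τ ∈ L²` is the trace of `F` on the end segment `x = 0` of the channel, characterized by
Green's formula with outward normal `-e_x`. -/
def IsChannelTrace (d : ℝ) (F : Field) (τ : ℝ → ℂ) : Prop :=
  MemLp τ 2 (volume.restrict (Ioo (-d / 2) (d / 2))) ∧
  ∀ φ : ℝ × ℝ → ℂ, IsTest φ → tsupport φ ⊆ univ ×ˢ Ioo (-d / 2) (d / 2) →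
    ∫ z in channel d, (F.val z * pdx φ z + F.dx z * φ z) =
      -∫ y in Ioo (-d / 2) (d / 2), τ y * φ (0, y)

open Classical in
/-- The trace of `F` on `x = 0` (unique up to a null set). -/
def channelTrace (d : ℝ) (F : Field) : ℝ → ℂ :=
  if h : ∃ τ, IsChannelTrace d F τ then h.choose else 0

/-- The pairing `∫_{x = 0} (∂ₓ F) G` of the weak normal derivative of a solution `F` with the
trace of `G`, given by Green's identity. For a solution `F` it depends on `G` only
through the trace of `G` on `x = 0`. -/
def channelFlux (k d : ℝ) (F G : Field) : ℂ := -helmholtzForm k (channel d) F G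

/-- Weak form of `Δ F + k² F = 0` in the channel with the wall condition on the side walls:
test functions have zero trace on `x = 0`. -/
def SolvesInPort (bc : WallCondition) (k d : ℝ) (F : Field) : Prop :=
  InLocalEnergySpace bc d F ∧
  ∀ G : Field, IsChannelTest bc d G → IsChannelTrace d G 0 →
    helmholtzForm k (channel d) F G = 0

/-! ### Modes; the index `m` runs over `1, 2, 3, …` -/

/-- The transverse frequency: `mπ/d` (Dirichlet) or `(m-1)π/d` (Neumann). -/
def transverse (bc : WallCondition) (d : ℝ) (m : ℕ) : ℝ :=
  match bc with
  | WallCondition.dirichlet => (m : ℝ) * Real.pi / d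
  | WallCondition.neumann => ((m : ℝ) - 1) * Real.pi / d

/-- The orthonormal transverse modes `b_m`. -/
def mode (bc : WallCondition) (d : ℝ) (m : ℕ) (y : ℝ) : ℝ :=
  match bc with
  | WallCondition.dirichlet =>
      Real.sqrt (2 / d) * Real.sin (transverse bc d m * (y + d / 2))
  | WallCondition.neumann =>
      Real.sqrt ((2 - (if m = 1 then 1 else 0)) / d) *
        Real.cos (transverse bc d m * (y + d / 2))

/-- `β_m = √(k² - (transverse frequency)²)`, with `Im β_m > 0` where it is not real. -/
def beta (bc : WallCondition) (k d : ℝ) (m : ℕ) : ℂ :=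
  if transverse bc d m ≤ k then (Real.sqrt (k ^ 2 - transverse bc d m ^ 2) : ℂ)
  else Complex.I * (Real.sqrt (transverse bc d m ^ 2 - k ^ 2) : ℂ)

/-- The number of propagating modes (those with `β_m > 0`). -/
def numModes (bc : WallCondition) (k d : ℝ) : ℕ :=
  {m : ℕ | 1 ≤ m ∧ transverse bc d m < k}.ncard

/-- An extension of `b_m` from `x = 0` into the channel: `max (1 - x) 0 * b_m y`. -/
def modeLift (bc : WallCondition) (d : ℝ) (m : ℕ) : Field where
  val := fun z => if z.1 < 1 then (((1 - z.1) * mode bc d m z.2 : ℝ) : ℂ) else 0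
  dx := fun z => if z.1 < 1 then ((-mode bc d m z.2 : ℝ) : ℂ) else 0
  dy := fun z => if z.1 < 1 then (((1 - z.1) * deriv (mode bc d m) z.2 : ℝ) : ℂ) else 0

/-- The projection `P_m u = ∫ b_m u` over `x = 0` (the `b_m` are real). -/
def proj (bc : WallCondition) (d : ℝ) (m : ℕ) (u : Field) : ℂ :=
  ∫ y in Ioo (-d / 2) (d / 2), (mode bc d m y : ℂ) * channelTrace d u y

/-- The projection `∫ b_m ∂ₓu` over `x = 0`, with the weak normal derivative of `u`. -/
def projDx (bc : WallCondition) (k d : ℝ) (m : ℕ) (u : Field) : ℂ :=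
  channelFlux k d u (modeLift bc d m)

/-- The outgoing condition: no mode `exp (-i β_m x) b_m` is present. -/
def IsOutgoing (bc : WallCondition) (k d : ℝ) (u : Field) : Prop :=
  ∀ m : ℕ, 1 ≤ m →
    projDx bc k d m u - Complex.I * beta bc k d m * proj bc d m u = 0

/-- The coefficient `c_{m,+}` of the outgoing mode `exp (i β_m x) b_m`. -/
def outCoeff (bc : WallCondition) (k d : ℝ) (m : ℕ) (u : Field) : ℂ :=
  1 / (2 * Complex.I * beta bc k d m) *
    (projDx bc k d m u + Complex.I * beta bc k d m * proj bc d m u)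

/-- The incoming field `∑_{m ≤ M} c_m exp (-i β_m x) b_m y`. -/
def incoming (bc : WallCondition) (k d : ℝ) (c : ℕ → ℂ) (x y : ℝ) : ℂ :=
  ∑ m ∈ Finset.Icc 1 (numModes bc k d),
    c m * Complex.exp (-Complex.I * beta bc k d m * (x : ℂ)) * (mode bc d m y : ℂ)

/-! ### The waveguide circuit -/

/-- The rigid motion taking local coordinates `(x, y)` to the plane. -/
def place (o : ℝ × ℝ) (θ : ℝ) (z : ℝ × ℝ) : ℝ × ℝ :=
  (o.1 + z.1 * Real.cos θ - z.2 * Real.sin θ, o.2 + z.1 * Real.sin θ + z.2 * Real.cos θ)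

/-- A circuit with a bounded core region `Ω₀` and `P` half-infinite rectangular channels.
Channel `p` has width `width p`, its end segment is centred at `origin p`, and its axis
has direction angle `angle p`. -/
structure Circuit (P : ℕ) where
  core : Set (ℝ × ℝ)
  isOpen_core : IsOpen core
  isBounded_core : Bornology.IsBounded core
  origin : Fin P → ℝ × ℝ
  angle : Fin P → ℝ
  width : Fin P → ℝ
  width_pos : ∀ p, 0 < width p
  /-- The channels continue straight into the core at least up to this distance. -/
  len : ℝ
  len_pos : 0 < len
  strip_subset : ∀ p, ∀ z ∈ Ioo (-len) 0 ×ˢ Ioo (-width p / 2) (width p / 2),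
    place (origin p) (angle p) z ∈ core
  wall_subset : ∀ p, ∀ x ∈ Icc (-len) 0,
    place (origin p) (angle p) (x, -width p / 2) ∈ frontier core ∧
    place (origin p) (angle p) (x, width p / 2) ∈ frontier core
  core_disjoint : ∀ p,
    Disjoint core (place (origin p) (angle p) '' channel (width p))
  ports_disjoint : ∀ p q, p ≠ q →
    Disjoint (place (origin p) (angle p) '' channel (width p))
      (place (origin q) (angle q) '' channel (width q))

namespace Circuit

variable {P : ℕ} (W : Circuit P)

/-- The segment `γ_p` between the core and channel `p`, without its end points. -/
def gamma (p : Fin P) : Set (ℝ × ℝ) :=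
  place (W.origin p) (W.angle p) '' ({0} ×ˢ Ioo (-W.width p / 2) (W.width p / 2))

/-- The walls of the core: its boundary without the segments `γ_p`. -/
def walls : Set (ℝ × ℝ) := frontier W.core \ ⋃ p, W.gamma p

/-- `τ` is the trace on `γ_p` of the function `F` on the core, written in the coordinate `y`
along `γ_p`; Green's formula in the straight piece of channel inside the core, where
the outward normal on `γ_p` is `+e_x` in local coordinates. -/
def IsCoreTrace (p : Fin P) (F : Field) (τ : ℝ → ℂ) : Prop :=
  MemLp τ 2 (volume.restrict (Ioo (-W.width p / 2) (W.width p / 2))) ∧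
  ∀ φ : ℝ × ℝ → ℂ, IsTest φ →
    tsupport φ ⊆ Ioi (-W.len) ×ˢ Ioo (-W.width p / 2) (W.width p / 2) →
    ∫ z in Ioo (-W.len) 0 ×ˢ Ioo (-W.width p / 2) (W.width p / 2),
      (F.val (place (W.origin p) (W.angle p) z) * pdx φ z +
        ((Real.cos (W.angle p) : ℂ) * F.dx (place (W.origin p) (W.angle p) z) +
          (Real.sin (W.angle p) : ℂ) * F.dy (place (W.origin p) (W.angle p) z)) * φ z) =
      ∫ y in Ioo (-W.width p / 2) (W.width p / 2), τ y * φ (0, y)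

/-- Weak form of `Δ F + k² F = 0` in the core with the wall condition on the core walls:
test functions have zero trace on every `γ_p`. -/
def SolvesInCore (bc : WallCondition) (k : ℝ) (F : Field) : Prop :=
  InEnergySpace bc W.core W.walls F ∧
  ∀ G : Field, InEnergySpace bc W.core W.walls G → (∀ p, W.IsCoreTrace p G 0) →
    helmholtzForm k W.core F G = 0

/-- `u₀, u₁, …, u_P` solve the piecewise Helmholtz system with incoming coefficients `c p m`.
The function `u p` is written in the local coordinates of channel `p`. -/
structure IsSolution (bc : WallCondition) (k : ℝ) (c : Fin P → ℕ → ℂ)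
    (u₀ : Field) (u : Fin P → Field) : Prop where
  /-- Helmholtz equation in the core and wall condition there. -/
  core : W.SolvesInCore bc k u₀
  /-- Helmholtz equation in the channels and wall condition there. -/
  port : ∀ p, SolvesInPort bc k (W.width p) (u p)
  /-- `u₀ = u_p + u_p^in` on `γ_p`. -/
  trace_eq : ∀ p, ∃ τ : ℝ → ℂ, IsChannelTrace (W.width p) (u p) τ ∧
    W.IsCoreTrace p u₀ (fun y => τ y + incoming bc k (W.width p) (c p) 0 y)
  /-- `∂ₙ u₀ = ∂ₙ u_p + ∂ₙ u_p^in` on `γ_p` for the weak normal derivatives. By Green's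
  identity the left side is `∑_p ∫_{γ_p} (∂ₙ u₀) τ_p`. -/
  flux_eq : ∀ (G₀ : Field) (G : Fin P → Field) (τ : Fin P → ℝ → ℂ),
    InEnergySpace bc W.core W.walls G₀ →
    (∀ p, IsChannelTest bc (W.width p) (G p)) →
    (∀ p, W.IsCoreTrace p G₀ (τ p)) →
    (∀ p, IsChannelTrace (W.width p) (G p) (τ p)) →
    helmholtzForm k W.core u₀ G₀ =
      ∑ p, (channelFlux k (W.width p) (u p) (G p) +
        ∫ y in Ioo (-W.width p / 2) (W.width p / 2),
          deriv (fun x : ℝ => incoming bc k (W.width p) (c p) x y) 0 * τ p y)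
  /-- Each `u_p` is outgoing. -/
  outgoing : ∀ p, IsOutgoing bc k (W.width p) (u p)

end Circuit

end Guide

end

/-!
The proof is an energy balance. Test the flux condition of a solution without incoming field with
the complex conjugate of the solution: in the core with `conj u₀`, in each channel with
`χ(x) conj u_p`, where `χ` is a smooth cutoff decreasing from `1` to `0` on `(0, 1)`. The form on
the core is then real, and the imaginary part of the flux through channel `p` equals
`-∫ χ'(x) J_p(x) dx` with `J_p(x) = Im ∫ ∂ₓu_p conj u_p dy` (`im_form_cutField_conj`). It suffices
that `J_p ≥ 0`, with equality only where all propagating mode coefficients vanish: the fluxes sum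
to zero, so each of them is zero.

To evaluate `J_p`, let `a_m(x) = ∫ b_m u_p dy` and `a'_m(x) = ∫ b_m ∂ₓu_p dy`. The trace formula
and the weak Helmholtz equation, tested with `g(x) b_m(y)`, give two weak first-order equations for
`(a_m, a'_m)` on `x > 0` with boundary terms at `x = 0` (`IsChannelTrace.integral_mode`,
`SolvesInPort.integral_mode`). In the combination `a'_m - iβ_m a_m` the boundary terms cancel by the
outgoing condition, and the choice `g = e^{iβ_m x} h` shows `a'_m = iβ_m a_m` almost everywhere
(`SolvesInPort.ae_mode_coeff`). Parseval's identity for the modes, obtained from Fourier series by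
odd or even reflection, then gives `J_p(x) = ∑ Re β_m |a_m(x)|²` up to normalization
(`im_integral_mul_conj_nonneg`), and `Re β_m` is positive exactly for propagating modes. If
`a_m` and `a'_m` vanish on `(0, 1)`, the weak equation tested with `χ b_m` gives vanishing flux
coefficient, and the outgoing condition then gives the claim.

The test fields involved are not smooth, so their membership in the energy space is shown by bounded
pointwise approximation with smooth functions (`BddConv`). The approximating cutoffs near a wall
have bounded derivatives when multiplied by a function vanishing to first order there, such as a
Dirichlet mode, the derivative of a Neumann mode, or the hat function at its kink
(`bddConv_deriv_mul_cut`).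

The second claim follows since the difference of two solutions with the same incoming coefficients
solves the homogeneous system (`Circuit.IsSolution.sub`).
-/

namespace Guide

open Filter Topology

/-! ### Smooth functions and integration by parts on the plane -/

lemma pdx_eq_deriv {φ : ℝ × ℝ → ℂ} {z : ℝ × ℝ} (h : DifferentiableAt ℝ φ z) :
    HasDerivAt (fun t => φ (t, z.2)) (pdx φ z) z.1 := by
  have h1 : HasDerivAt (fun t : ℝ => (t, z.2)) ((1, 0) : ℝ × ℝ) z.1 :=
    (hasDerivAt_id z.1).prodMk (hasDerivAt_const z.1 z.2)
  exact HasFDerivAt.comp_hasDerivAt z.1 (f := fun t : ℝ => (t, z.2)) h.hasFDerivAt h1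

lemma pdy_eq_deriv {φ : ℝ × ℝ → ℂ} {z : ℝ × ℝ} (h : DifferentiableAt ℝ φ z) :
    HasDerivAt (fun t => φ (z.1, t)) (pdy φ z) z.2 := by
  have h1 : HasDerivAt (fun t : ℝ => (z.1, t)) ((0, 1) : ℝ × ℝ) z.2 :=
    (hasDerivAt_const z.2 z.1).prodMk (hasDerivAt_id z.2)
  exact HasFDerivAt.comp_hasDerivAt z.2 (f := fun t : ℝ => (z.1, t)) h.hasFDerivAt h1

lemma IsTest.pdx {φ : ℝ × ℝ → ℂ} (h : IsTest φ) : IsTest (pdx φ) :=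
  ⟨(h.1.fderiv_right (m := ∞) (by simp)).clm_apply contDiff_const,
    h.2.fderiv_apply ℝ (1, 0)⟩

lemma IsTest.pdy {φ : ℝ × ℝ → ℂ} (h : IsTest φ) : IsTest (pdy φ) :=
  ⟨(h.1.fderiv_right (m := ∞) (by simp)).clm_apply contDiff_const,
    h.2.fderiv_apply ℝ (0, 1)⟩

lemma IsTest.continuous {φ : ℝ × ℝ → ℂ} (h : IsTest φ) : Continuous φ := h.1.continuous

lemma IsTest.differentiable {φ : ℝ × ℝ → ℂ} (h : IsTest φ) : Differentiable ℝ φ :=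
  h.1.differentiable (by simp)

lemma IsTest.memLp {φ : ℝ × ℝ → ℂ} (h : IsTest φ) (Ω : Set (ℝ × ℝ)) :
    MemLp φ 2 (volume.restrict Ω) :=
  (h.continuous.memLp_of_hasCompactSupport h.2).restrict Ω

lemma IsTest.integrable {φ : ℝ × ℝ → ℂ} (h : IsTest φ) : Integrable φ :=
  h.continuous.integrable_of_hasCompactSupport h.2

lemma IsTest.mul {φ ψ : ℝ × ℝ → ℂ} (h : IsTest φ) (hψ : ContDiff ℝ ∞ ψ) :
    IsTest (fun z => φ z * ψ z) := ⟨h.1.mul hψ, h.2.mul_right⟩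

lemma IsTest.conj {φ : ℝ × ℝ → ℂ} (h : IsTest φ) :
    IsTest (fun z => (starRingEnd ℂ) (φ z)) :=
  ⟨Complex.conjCLE.contDiff.comp h.1, h.2.comp_left (map_zero _)⟩

lemma pdx_conj {φ : ℝ × ℝ → ℂ} (h : IsTest φ) (z : ℝ × ℝ) :
    pdx (fun z => (starRingEnd ℂ) (φ z)) z = (starRingEnd ℂ) (pdx φ z) :=
  (pdx_eq_deriv (h.conj.differentiable z)).unique (pdx_eq_deriv (h.differentiable z)).star

lemma pdy_conj {φ : ℝ × ℝ → ℂ} (h : IsTest φ) (z : ℝ × ℝ) :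
    pdy (fun z => (starRingEnd ℂ) (φ z)) z = (starRingEnd ℂ) (pdy φ z) :=
  (pdy_eq_deriv (h.conj.differentiable z)).unique (pdy_eq_deriv (h.differentiable z)).star

lemma pdx_mul {φ ψ : ℝ × ℝ → ℂ} {z : ℝ × ℝ} (hφ : DifferentiableAt ℝ φ z)
    (hψ : DifferentiableAt ℝ ψ z) :
    pdx (fun z => φ z * ψ z) z = pdx φ z * ψ z + φ z * pdx ψ z :=
  (pdx_eq_deriv (hφ.mul hψ)).unique ((pdx_eq_deriv hφ).mul (pdx_eq_deriv hψ))

lemma pdy_mul {φ ψ : ℝ × ℝ → ℂ} {z : ℝ × ℝ} (hφ : DifferentiableAt ℝ φ z)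
    (hψ : DifferentiableAt ℝ ψ z) :
    pdy (fun z => φ z * ψ z) z = pdy φ z * ψ z + φ z * pdy ψ z :=
  (pdy_eq_deriv (hφ.mul hψ)).unique ((pdy_eq_deriv hφ).mul (pdy_eq_deriv hψ))

lemma contDiff_comp_fst {f : ℝ → ℂ} (hf : ContDiff ℝ ∞ f) :
    ContDiff ℝ ∞ (fun z : ℝ × ℝ => f z.1) := hf.comp contDiff_fst

lemma contDiff_comp_snd {f : ℝ → ℂ} (hf : ContDiff ℝ ∞ f) :
    ContDiff ℝ ∞ (fun z : ℝ × ℝ => f z.2) := hf.comp contDiff_snd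

lemma pdx_fst {f : ℝ → ℂ} (hf : ContDiff ℝ ∞ f) (z : ℝ × ℝ) :
    pdx (fun z => f z.1) z = deriv f z.1 :=
  (pdx_eq_deriv ((contDiff_comp_fst hf).differentiable (by simp) z)).unique
    (hf.differentiable (by simp) z.1).hasDerivAt

lemma pdy_fst {f : ℝ → ℂ} (hf : ContDiff ℝ ∞ f) (z : ℝ × ℝ) :
    pdy (fun z => f z.1) z = 0 :=
  (pdy_eq_deriv ((contDiff_comp_fst hf).differentiable (by simp) z)).unique
    (hasDerivAt_const z.2 (f z.1))

lemma pdx_snd {f : ℝ → ℂ} (hf : ContDiff ℝ ∞ f) (z : ℝ × ℝ) :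
    pdx (fun z => f z.2) z = 0 :=
  (pdx_eq_deriv ((contDiff_comp_snd hf).differentiable (by simp) z)).unique
    (hasDerivAt_const z.1 (f z.2))

lemma pdy_snd {f : ℝ → ℂ} (hf : ContDiff ℝ ∞ f) (z : ℝ × ℝ) :
    pdy (fun z => f z.2) z = deriv f z.2 :=
  (pdy_eq_deriv ((contDiff_comp_snd hf).differentiable (by simp) z)).unique
    (hf.differentiable (by simp) z.2).hasDerivAt

lemma pdx_sep {f b : ℝ → ℂ} (hf : ContDiff ℝ ∞ f) (hb : ContDiff ℝ ∞ b) (z : ℝ × ℝ) :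
    pdx (fun z => f z.1 * b z.2) z = deriv f z.1 * b z.2 := by
  rw [pdx_mul ((contDiff_comp_fst hf).differentiable (by simp) z)
    ((contDiff_comp_snd hb).differentiable (by simp) z), pdx_fst hf, pdx_snd hb]
  ring

lemma pdy_sep {f b : ℝ → ℂ} (hf : ContDiff ℝ ∞ f) (hb : ContDiff ℝ ∞ b) (z : ℝ × ℝ) :
    pdy (fun z => f z.1 * b z.2) z = f z.1 * deriv b z.2 := by
  rw [pdy_mul ((contDiff_comp_fst hf).differentiable (by simp) z)
    ((contDiff_comp_snd hb).differentiable (by simp) z), pdy_fst hf, pdy_snd hb]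
  ring

lemma IsTest.sep {f b : ℝ → ℂ} (hf : ContDiff ℝ ∞ f) (hf' : HasCompactSupport f)
    (hb : ContDiff ℝ ∞ b) (hb' : HasCompactSupport b) : IsTest (fun z => f z.1 * b z.2) := by
  refine ⟨(contDiff_comp_fst hf).mul (contDiff_comp_snd hb), ?_⟩
  refine HasCompactSupport.intro (hf'.isCompact.prod hb'.isCompact) fun z hz => ?_
  by_cases h : z.1 ∈ tsupport f
  · have : z.2 ∉ tsupport b := fun h' => hz ⟨h, h'⟩
    simp [image_eq_zero_of_notMem_tsupport this]
  · simp [image_eq_zero_of_notMem_tsupport h]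

lemma tsupport_sep_subset (f b : ℝ → ℂ) :
    tsupport (fun z : ℝ × ℝ => f z.1 * b z.2) ⊆ tsupport f ×ˢ tsupport b := by
  refine closure_minimal (fun z hz => ?_) ((isClosed_tsupport f).prod (isClosed_tsupport b))
  rw [Function.mem_support] at hz
  exact ⟨subset_tsupport _ (left_ne_zero_of_mul hz), subset_tsupport _ (right_ne_zero_of_mul hz)⟩

/-- Pairing with a fixed `L²` function is continuous in `L²`. -/
lemma tendsto_integral_mul_of_eLpNorm {α : Type*} [MeasurableSpace α] {μ : Measure α}
    {F w : α → ℂ} {φ : ℕ → α → ℂ} (hF : MemLp F 2 μ) (hφ : ∀ n, MemLp (φ n) 2 μ)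
    (hw : MemLp w 2 μ)
    (h : Tendsto (fun n => eLpNorm (fun z => F z - φ n z) 2 μ) atTop (𝓝 0)) :
    Tendsto (fun n => ∫ z, φ n z * w z ∂μ) atTop (𝓝 (∫ z, F z * w z ∂μ)) := by
  refine tendsto_integral_of_L1' _ (hF.integrable_mul hw).aestronglyMeasurable
    (Eventually.of_forall fun n => (hφ n).integrable_mul hw) ?_
  have h2 : Tendsto (fun n => eLpNorm (fun z => F z - φ n z) 2 μ * eLpNorm w 2 μ) atTop (𝓝 0) := by
    have := ENNReal.Tendsto.mul_const (b := eLpNorm w 2 μ) h (Or.inr hw.2.ne)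
    simpa using this
  refine tendsto_of_tendsto_of_tendsto_of_le_of_le tendsto_const_nhds h2 (fun _ => zero_le)
    fun n => ?_
  have h3 : eLpNorm ((fun z => F z - φ n z) • w) 1 μ ≤
      eLpNorm (fun z => F z - φ n z) 2 μ * eLpNorm w 2 μ :=
    eLpNorm_smul_le_mul_eLpNorm hw.1 (hF.1.sub (hφ n).1)
  refine le_trans (le_of_eq ?_) h3
  rw [← eLpNorm_neg]
  congr 1
  ext z
  simp only [Pi.neg_apply, Pi.sub_apply, Pi.mul_apply, Pi.smul_apply', smul_eq_mul]
  ring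

lemma IsTest.integral_mul_pdx {φ ψ : ℝ × ℝ → ℂ} (hφ : IsTest φ) (hψ : IsTest ψ)
    {Ω : Set (ℝ × ℝ)} (hs : tsupport ψ ⊆ Ω) :
    ∫ z in Ω, φ z * Guide.pdx ψ z = -∫ z in Ω, Guide.pdx φ z * ψ z := by
  rw [setIntegral_eq_integral_of_forall_compl_eq_zero, setIntegral_eq_integral_of_forall_compl_eq_zero]
  · exact integral_mul_fderiv_eq_neg_fderiv_mul_of_integrable
      (hφ.pdx.mul hψ.1).integrable (hφ.mul hψ.pdx.1).integrable (hφ.mul hψ.1).integrable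
      (fun z _ => hφ.differentiable z) (fun z _ => hψ.differentiable z)
  · intro z hz
    rw [image_eq_zero_of_notMem_tsupport fun h => hz (hs h), mul_zero]
  · intro z hz
    have : z ∉ tsupport (Guide.pdx ψ) := fun h => hz (hs (tsupport_fderiv_apply_subset ℝ (1, 0) h))
    rw [image_eq_zero_of_notMem_tsupport this, mul_zero]

lemma IsTest.integral_mul_pdy {φ ψ : ℝ × ℝ → ℂ} (hφ : IsTest φ) (hψ : IsTest ψ)
    {Ω : Set (ℝ × ℝ)} (hs : tsupport ψ ⊆ Ω) :
    ∫ z in Ω, φ z * Guide.pdy ψ z = -∫ z in Ω, Guide.pdy φ z * ψ z := by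
  rw [setIntegral_eq_integral_of_forall_compl_eq_zero, setIntegral_eq_integral_of_forall_compl_eq_zero]
  · exact integral_mul_fderiv_eq_neg_fderiv_mul_of_integrable
      (hφ.pdy.mul hψ.1).integrable (hφ.mul hψ.pdy.1).integrable (hφ.mul hψ.1).integrable
      (fun z _ => hφ.differentiable z) (fun z _ => hψ.differentiable z)
  · intro z hz
    rw [image_eq_zero_of_notMem_tsupport fun h => hz (hs h), mul_zero]
  · intro z hz
    have : z ∉ tsupport (Guide.pdy ψ) := fun h => hz (hs (tsupport_fderiv_apply_subset ℝ (0, 1) h))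
    rw [image_eq_zero_of_notMem_tsupport this, mul_zero]

/-- A sequence of test functions realizing `VanishesOn`. -/
lemma VanishesOn.exists_seq {Ω Γ : Set (ℝ × ℝ)} {F : Field} (h : VanishesOn Ω Γ F) :
    ∃ φ : ℕ → ℝ × ℝ → ℂ, (∀ n, IsTest (φ n)) ∧ (∀ n, Disjoint (tsupport (φ n)) Γ) ∧
      Tendsto (fun n => eLpNorm (fun z => F.val z - φ n z) 2 (volume.restrict Ω)) atTop (𝓝 0) ∧
      Tendsto (fun n => eLpNorm (fun z => F.dx z - pdx (φ n) z) 2 (volume.restrict Ω))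
        atTop (𝓝 0) ∧
      Tendsto (fun n => eLpNorm (fun z => F.dy z - pdy (φ n) z) 2 (volume.restrict Ω))
        atTop (𝓝 0) := by
  have hpos : ∀ n : ℕ, (0 : ℝ≥0∞) < ((n : ℝ≥0∞) + 1)⁻¹ := fun n => by simp
  choose φ h1 h2 h3 h4 h5 using fun n => h _ (hpos n)
  have hlim : Tendsto (fun n : ℕ => ((n : ℝ≥0∞) + 1)⁻¹) atTop (𝓝 0) := by
    have := (tendsto_add_atTop_iff_nat 1).2 ENNReal.tendsto_inv_nat_nhds_zero
    simpa using this
  exact ⟨φ, h1, h2,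
    tendsto_of_tendsto_of_tendsto_of_le_of_le tendsto_const_nhds hlim (fun _ => zero_le) h3,
    tendsto_of_tendsto_of_tendsto_of_le_of_le tendsto_const_nhds hlim (fun _ => zero_le) h4,
    tendsto_of_tendsto_of_tendsto_of_le_of_le tendsto_const_nhds hlim (fun _ => zero_le) h5⟩

lemma VanishesOn.of_seq {Ω Γ : Set (ℝ × ℝ)} {F : Field} (φ : ℕ → ℝ × ℝ → ℂ)
    (h1 : ∀ n, IsTest (φ n)) (h2 : ∀ n, Disjoint (tsupport (φ n)) Γ)
    (h3 : Tendsto (fun n => eLpNorm (fun z => F.val z - φ n z) 2 (volume.restrict Ω)) atTop (𝓝 0))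
    (h4 : Tendsto (fun n => eLpNorm (fun z => F.dx z - pdx (φ n) z) 2 (volume.restrict Ω))
        atTop (𝓝 0))
    (h5 : Tendsto (fun n => eLpNorm (fun z => F.dy z - pdy (φ n) z) 2 (volume.restrict Ω))
        atTop (𝓝 0)) : VanishesOn Ω Γ F := by
  intro ε hε
  obtain ⟨n, h3, h4, h5⟩ := ((h3.eventually_le_const hε).and
    ((h4.eventually_le_const hε).and (h5.eventually_le_const hε))).exists
  exact ⟨φ n, h1 n, h2 n, h3, h4, h5⟩

/-- A limit in `H¹(Ω)` of test functions has weak derivatives. -/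
lemma VanishesOn.isH1On {Ω Γ : Set (ℝ × ℝ)} {F : Field} (h : VanishesOn Ω Γ F)
    (h0 : MemLp F.val 2 (volume.restrict Ω)) (hx : MemLp F.dx 2 (volume.restrict Ω))
    (hy : MemLp F.dy 2 (volume.restrict Ω)) : IsH1On Ω F := by
  obtain ⟨φ, h1, -, h3, h4, h5⟩ := h.exists_seq
  refine ⟨h0, hx, hy, fun ψ hψ hs => ⟨?_, ?_⟩⟩
  · have l1 := tendsto_integral_mul_of_eLpNorm h0 (fun n => (h1 n).memLp Ω) (hψ.pdx.memLp Ω) h3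
    have l2 := tendsto_integral_mul_of_eLpNorm hx (fun n => (h1 n).pdx.memLp Ω) (hψ.memLp Ω) h4
    refine tendsto_nhds_unique l1 ?_
    simp_rw [fun n => (h1 n).integral_mul_pdx hψ hs]
    exact l2.neg
  · have l1 := tendsto_integral_mul_of_eLpNorm h0 (fun n => (h1 n).memLp Ω) (hψ.pdy.memLp Ω) h3
    have l2 := tendsto_integral_mul_of_eLpNorm hy (fun n => (h1 n).pdy.memLp Ω) (hψ.memLp Ω) h5
    refine tendsto_nhds_unique l1 ?_
    simp_rw [fun n => (h1 n).integral_mul_pdy hψ hs]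
    exact l2.neg

/-! ### Integrals over the channel of functions that vanish for large `x` -/

lemma measurableSet_channelTrunc (d R : ℝ) : MeasurableSet (channelTrunc d R) :=
  measurableSet_Ioo.prod measurableSet_Ioo

lemma measurableSet_channel (d : ℝ) : MeasurableSet (channel d) :=
  measurableSet_Ioi.prod measurableSet_Ioo

lemma channelTrunc_subset_channel (d R : ℝ) : channelTrunc d R ⊆ channel d :=
  fun _ hz => ⟨hz.1.1, hz.2⟩

lemma channelTrunc_mono (d : ℝ) {R R' : ℝ} (h : R ≤ R') : channelTrunc d R ⊆ channelTrunc d R' :=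
  fun _ hz => ⟨⟨hz.1.1, hz.1.2.trans_le h⟩, hz.2⟩

lemma restrict_channel_restrict (d R : ℝ) :
    ((volume.restrict (channel d)).restrict {z : ℝ × ℝ | z.1 < R} : Measure (ℝ × ℝ)) =
      volume.restrict (channelTrunc d R) := by
  rw [Measure.restrict_restrict (measurableSet_lt measurable_fst measurable_const)]
  congr 1
  ext z
  simp only [channel, channelTrunc, mem_inter_iff, mem_ofPred_eq, mem_prod, mem_Ioi, mem_Ioo]
  tauto

instance (d R : ℝ) : IsFiniteMeasure (volume.restrict (channelTrunc d R)) := by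
  refine ⟨?_⟩
  rw [Measure.restrict_apply_univ, channelTrunc, Measure.volume_eq_prod, Measure.prod_prod]
  exact ENNReal.mul_lt_top measure_Ioo_lt_top measure_Ioo_lt_top

lemma support_subset_of_zero {R : ℝ} {w : ℝ × ℝ → ℂ} (h0 : ∀ z, R ≤ z.1 → w z = 0) :
    Function.support w ⊆ {z : ℝ × ℝ | z.1 < R} := fun z hz => by
  by_contra h
  exact hz (h0 z (not_lt.1 h))

lemma eLpNorm_channel_eq {d R : ℝ} {w : ℝ × ℝ → ℂ} (h0 : ∀ z, R ≤ z.1 → w z = 0) :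
    eLpNorm w 2 (volume.restrict (channel d)) = eLpNorm w 2 (volume.restrict (channelTrunc d R)) := by
  rw [← restrict_channel_restrict, eLpNorm_restrict_eq_of_support_subset (support_subset_of_zero h0)]

lemma memLp_channel_iff {d R : ℝ} {w : ℝ × ℝ → ℂ} (h0 : ∀ z, R ≤ z.1 → w z = 0) :
    MemLp w 2 (volume.restrict (channel d)) ↔ MemLp w 2 (volume.restrict (channelTrunc d R)) := by
  refine ⟨fun h => h.mono_measure (Measure.restrict_mono_set _ (channelTrunc_subset_channel d R)),
    fun h => ?_⟩
  have hm : MeasurableSet {z : ℝ × ℝ | z.1 < R} := measurableSet_lt measurable_fst measurable_const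
  rw [← restrict_channel_restrict, ← memLp_indicator_iff_restrict hm,
    indicator_eq_self.2 (support_subset_of_zero h0)] at h
  exact h

lemma integral_channel_eq {d R : ℝ} {w : ℝ × ℝ → ℂ} (h0 : ∀ z, R ≤ z.1 → w z = 0) :
    ∫ z in channel d, w z = ∫ z in channelTrunc d R, w z := by
  rw [← restrict_channel_restrict]
  refine (setIntegral_eq_integral_of_forall_compl_eq_zero ?_).symm
  exact fun z hz => h0 z (not_lt.1 hz)

lemma integrableOn_channel_iff {d R : ℝ} {w : ℝ × ℝ → ℂ} (h0 : ∀ z, R ≤ z.1 → w z = 0) :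
    IntegrableOn w (channel d) ↔ IntegrableOn w (channelTrunc d R) := by
  rw [IntegrableOn, IntegrableOn, ← restrict_channel_restrict]
  exact (integrableOn_iff_integrable_of_support_subset (support_subset_of_zero h0)).symm

/-- Square integrable on the channel, locally up to its boundary. -/
def LocL2 (d : ℝ) (f : ℝ × ℝ → ℂ) : Prop :=
  ∀ R : ℝ, 0 < R → MemLp f 2 (volume.restrict (channelTrunc d R))

lemma LocL2.memLp {d : ℝ} {f : ℝ × ℝ → ℂ} (hf : LocL2 d f) (R : ℝ) :
    MemLp f 2 (volume.restrict (channelTrunc d R)) :=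
  (hf (max R 1) (by positivity)).mono_measure
    (Measure.restrict_mono_set _ (channelTrunc_mono d (le_max_left _ _)))

lemma LocL2.of_memLp {d : ℝ} {f : ℝ × ℝ → ℂ} (hf : MemLp f 2 (volume.restrict (channel d))) :
    LocL2 d f := fun R _ =>
  hf.mono_measure (Measure.restrict_mono_set _ (channelTrunc_subset_channel d R))

lemma LocL2.conj {d : ℝ} {f : ℝ × ℝ → ℂ} (hf : LocL2 d f) :
    LocL2 d (fun z => (starRingEnd ℂ) (f z)) := fun R hR => (hf R hR).star

lemma LocL2.integrableOn_mul {d R : ℝ} {f w : ℝ × ℝ → ℂ} (hf : LocL2 d f) (hw : LocL2 d w)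
    (h0 : ∀ z, R ≤ z.1 → w z = 0) : IntegrableOn (fun z => f z * w z) (channel d) := by
  rw [integrableOn_channel_iff (R := R) fun z hz => by rw [h0 z hz, mul_zero]]
  exact (hf.memLp R).integrable_mul (hw.memLp R)

lemma LocL2.of_bound {d C : ℝ} {w : ℝ × ℝ → ℂ}
    (hw : AEStronglyMeasurable w (volume.restrict (channel d)))
    (hC : ∀ z ∈ channel d, ‖w z‖ ≤ C) : LocL2 d w := fun R _ => by
  refine MemLp.of_bound
    (hw.mono_measure (Measure.restrict_mono_set _ (channelTrunc_subset_channel d R))) C ?_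
  filter_upwards [ae_restrict_mem (measurableSet_channelTrunc d R)] with z hz
  exact hC z (channelTrunc_subset_channel d R hz)

lemma LocL2.mul_bound {d C : ℝ} {f w : ℝ × ℝ → ℂ} (hf : LocL2 d f)
    (hw : AEStronglyMeasurable w (volume.restrict (channel d)))
    (hC : ∀ z ∈ channel d, ‖w z‖ ≤ C) : LocL2 d (fun z => f z * w z) := fun R hR => by
  refine MemLp.of_le_mul (c := C) (hf R hR) ((hf R hR).1.mul
    (hw.mono_measure (Measure.restrict_mono_set _ (channelTrunc_subset_channel d R)))) ?_
  filter_upwards [ae_restrict_mem (measurableSet_channelTrunc d R)] with z hz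
  rw [norm_mul, mul_comm]
  exact mul_le_mul_of_nonneg_right (hC z (channelTrunc_subset_channel d R hz)) (norm_nonneg _)

lemma LocL2.add {d : ℝ} {f w : ℝ × ℝ → ℂ} (hf : LocL2 d f) (hw : LocL2 d w) :
    LocL2 d (fun z => f z + w z) := fun R hR => (hf R hR).add (hw R hR)

lemma LocL2.sub {d : ℝ} {f w : ℝ × ℝ → ℂ} (hf : LocL2 d f) (hw : LocL2 d w) :
    LocL2 d (fun z => f z - w z) := fun R hR => (hf R hR).sub (hw R hR)

/-- Continuous functions `w n` that converge boundedly and pointwise to `w'` on `s`. -/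
structure BddConv {α : Type*} [TopologicalSpace α] (s : Set α) (w : ℕ → α → ℂ) (w' : α → ℂ) :
    Prop where
  cont : ∀ n, Continuous (w n)
  bdd : ∃ C, ∀ n, ∀ x ∈ s, ‖w n x‖ ≤ C
  lim : ∀ x ∈ s, Tendsto (fun n => w n x) atTop (𝓝 (w' x))

namespace BddConv

variable {α β : Type*} [TopologicalSpace α] [TopologicalSpace β]

lemma const {s : Set α} {w : α → ℂ} (hw : Continuous w) (hb : ∃ C, ∀ x ∈ s, ‖w x‖ ≤ C) :
    BddConv s (fun _ => w) w :=
  ⟨fun _ => hw, ⟨hb.choose, fun _ => hb.choose_spec⟩, fun _ _ => tendsto_const_nhds⟩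

lemma mul {s : Set α} {w v : ℕ → α → ℂ} {w' v' : α → ℂ} (hw : BddConv s w w')
    (hv : BddConv s v v') : BddConv s (fun n x => w n x * v n x) (fun x => w' x * v' x) := by
  obtain ⟨C, hC⟩ := hw.bdd
  obtain ⟨D, hD⟩ := hv.bdd
  refine ⟨fun n => (hw.cont n).mul (hv.cont n), ⟨C * D, fun n x hx => ?_⟩,
    fun x hx => (hw.lim x hx).mul (hv.lim x hx)⟩
  rw [norm_mul]
  exact mul_le_mul (hC n x hx) (hD n x hx) (norm_nonneg _) ((norm_nonneg _).trans (hC n x hx))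

lemma sub {s : Set α} {w v : ℕ → α → ℂ} {w' v' : α → ℂ} (hw : BddConv s w w')
    (hv : BddConv s v v') : BddConv s (fun n x => w n x - v n x) (fun x => w' x - v' x) := by
  obtain ⟨C, hC⟩ := hw.bdd
  obtain ⟨D, hD⟩ := hv.bdd
  exact ⟨fun n => (hw.cont n).sub (hv.cont n), ⟨C + D, fun n x hx =>
    (norm_sub_le _ _).trans (add_le_add (hC n x hx) (hD n x hx))⟩,
    fun x hx => (hw.lim x hx).sub (hv.lim x hx)⟩

lemma fst {s : Set α} {w : ℕ → α → ℂ} {w' : α → ℂ} (hw : BddConv s w w') (t : Set β) :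
    BddConv (s ×ˢ t) (fun n z => w n z.1) (fun z => w' z.1) :=
  ⟨fun n => (hw.cont n).comp continuous_fst, ⟨hw.bdd.choose, fun n x hx =>
    hw.bdd.choose_spec n x.1 hx.1⟩, fun x hx => hw.lim x.1 hx.1⟩

lemma snd {s : Set α} {w : ℕ → α → ℂ} {w' : α → ℂ} (hw : BddConv s w w') (t : Set β) :
    BddConv (t ×ˢ s) (fun n z => w n z.2) (fun z => w' z.2) :=
  ⟨fun n => (hw.cont n).comp continuous_snd, ⟨hw.bdd.choose, fun n x hx =>
    hw.bdd.choose_spec n x.2 hx.2⟩, fun x hx => hw.lim x.2 hx.2⟩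

lemma sep {s : Set α} {t : Set β} {f : ℕ → α → ℂ} {b : ℕ → β → ℂ} {f' : α → ℂ} {b' : β → ℂ}
    (hf : BddConv s f f') (hb : BddConv t b b') :
    BddConv (s ×ˢ t) (fun n z => f n z.1 * b n z.2) (fun z => f' z.1 * b' z.2) :=
  (hf.fst t).mul (hb.snd s)

lemma congr {s : Set α} {w : ℕ → α → ℂ} {w' v' : α → ℂ} (hw : BddConv s w w')
    (h : ∀ x ∈ s, w' x = v' x) : BddConv s w v' :=
  ⟨hw.cont, hw.bdd, fun x hx => h x hx ▸ hw.lim x hx⟩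

lemma mono {s t : Set α} {w : ℕ → α → ℂ} {w' : α → ℂ} (hw : BddConv s w w')
    (h : t ⊆ s) : BddConv t w w' :=
  ⟨hw.cont, ⟨hw.bdd.choose, fun n x hx => hw.bdd.choose_spec n x (h hx)⟩,
    fun x hx => hw.lim x (h hx)⟩

lemma norm_le {s : Set α} {w : ℕ → α → ℂ} {w' : α → ℂ} (hw : BddConv s w w') :
    ∃ C, ∀ x ∈ s, ‖w' x‖ ≤ C :=
  ⟨hw.bdd.choose, fun x hx =>
    le_of_tendsto (hw.lim x hx).norm (Eventually.of_forall fun n => hw.bdd.choose_spec n x hx)⟩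

lemma aestronglyMeasurable [MeasurableSpace α] [OpensMeasurableSpace α] {s : Set α}
    [SecondCountableTopologyEither α ℂ]
    {w : ℕ → α → ℂ} {w' : α → ℂ} (hw : BddConv s w w') {μ : Measure α} (hs : MeasurableSet s) :
    AEStronglyMeasurable w' (μ.restrict s) :=
  aestronglyMeasurable_of_tendsto_ae atTop (fun n => (hw.cont n).aestronglyMeasurable)
    ((ae_restrict_mem hs).mono fun x hx => hw.lim x hx)

/-- Dominated convergence against an integrable function. -/
lemma tendsto_integral_mul [MeasurableSpace α] [OpensMeasurableSpace α] {s : Set α}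
    [SecondCountableTopologyEither α ℂ]
    {w : ℕ → α → ℂ} {w' : α → ℂ} (hw : BddConv s w w') {μ : Measure α} (hs : MeasurableSet s)
    {f : α → ℂ} (hf : IntegrableOn f s μ) :
    Tendsto (fun n => ∫ x in s, f x * w n x ∂μ) atTop (𝓝 (∫ x in s, f x * w' x ∂μ)) := by
  obtain ⟨C, hC⟩ := hw.bdd
  refine tendsto_integral_of_dominated_convergence (fun x => C * ‖f x‖)
    (fun n => hf.1.mul (hw.cont n).aestronglyMeasurable) (hf.norm.const_mul C) (fun n => ?_) ?_
  · filter_upwards [ae_restrict_mem hs] with x hx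
    rw [norm_mul, mul_comm]
    exact mul_le_mul_of_nonneg_right (hC n x hx) (norm_nonneg _)
  · filter_upwards [ae_restrict_mem hs] with x hx
    exact tendsto_const_nhds.mul (hw.lim x hx)

/-- Bounded pointwise convergence implies convergence in `L²` on sets of finite measure. -/
lemma tendsto_eLpNorm [MeasurableSpace α] [OpensMeasurableSpace α] {s : Set α}
    [SecondCountableTopologyEither α ℂ]
    {w : ℕ → α → ℂ} {w' : α → ℂ} (hw : BddConv s w w') {μ : Measure α} (hs : MeasurableSet s)
    [IsFiniteMeasure (μ.restrict s)] :
    Tendsto (fun n => eLpNorm (fun x => w' x - w n x) 2 (μ.restrict s)) atTop (𝓝 0) := by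
  obtain ⟨C, hC⟩ := hw.bdd
  obtain ⟨D, hD⟩ := hw.norm_le
  have hm := hw.aestronglyMeasurable (μ := μ) hs
  have key : Tendsto (fun n => ∫⁻ x in s, ‖w' x - w n x‖ₑ ^ (2 : ℝ) ∂μ) atTop
      (𝓝 (∫⁻ _ in s, 0 ∂μ)) := by
    refine tendsto_lintegral_of_dominated_convergence' (fun _ => ENNReal.ofReal (D + C) ^ (2 : ℝ))
      (fun n => (hm.sub (hw.cont n).aestronglyMeasurable).enorm.pow_const _) (fun n => ?_) ?_ ?_
    · filter_upwards [ae_restrict_mem hs] with x hx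
      gcongr
      rw [← ofReal_norm]
      exact ENNReal.ofReal_le_ofReal
        ((norm_sub_le _ _).trans (add_le_add (hD x hx) (hC n x hx)))
    · rw [lintegral_const]
      exact ENNReal.mul_ne_top (by simp) (measure_ne_top _ _)
    · filter_upwards [ae_restrict_mem hs] with x hx
      have h1 : Tendsto (fun n => w' x - w n x) atTop (𝓝 0) := by
        simpa using (tendsto_const_nhds (x := w' x)).sub (hw.lim x hx)
      have h2 := (ENNReal.continuous_rpow_const (y := 2)).continuousAt.tendsto.comp h1.enorm
      simpa [Function.comp_def] using h2
  rw [lintegral_zero] at key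
  have h3 := (ENNReal.continuous_rpow_const (y := 1 / 2)).continuousAt.tendsto.comp key
  simp only [eLpNorm_eq_lintegral_rpow_enorm_toReal (p := 2) (by simp) (by simp)]
  simpa [Function.comp_def] using h3

end BddConv

/-- Dominated convergence on the channel. -/
lemma LocL2.tendsto_integral_mul {d R : ℝ} {f : ℝ × ℝ → ℂ} (hf : LocL2 d f)
    {w : ℕ → ℝ × ℝ → ℂ} {w' : ℝ × ℝ → ℂ} (hw : BddConv (channel d) w w')
    (h0 : ∀ n z, R ≤ z.1 → w n z = 0) (h0' : ∀ z, R ≤ z.1 → w' z = 0) :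
    Tendsto (fun n => ∫ z in channel d, f z * w n z) atTop
      (𝓝 (∫ z in channel d, f z * w' z)) := by
  rw [integral_channel_eq (R := R) fun z hz => by rw [h0' z hz, mul_zero]]
  simp_rw [fun n => integral_channel_eq (d := d) (R := R) (w := fun z => f z * w n z)
    fun z hz => by rw [h0 n z hz, mul_zero]]
  exact (hw.mono (channelTrunc_subset_channel d R)).tendsto_integral_mul
    (measurableSet_channelTrunc d R) ((hf.memLp R).integrable (by simp))

lemma BddConv.tendsto_eLpNorm_channel {d R : ℝ}
    {w : ℕ → ℝ × ℝ → ℂ} {w' : ℝ × ℝ → ℂ} (hw : BddConv (channel d) w w')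
    (h0 : ∀ n z, R ≤ z.1 → w n z = 0) (h0' : ∀ z, R ≤ z.1 → w' z = 0) :
    Tendsto (fun n => eLpNorm (fun z => w' z - w n z) 2 (volume.restrict (channel d)))
      atTop (𝓝 0) := by
  simp_rw [fun n => eLpNorm_channel_eq (d := d) (R := R) (w := fun z => w' z - w n z)
    fun z hz => by rw [h0 n z hz, h0' z hz, sub_zero]]
  exact (hw.mono (channelTrunc_subset_channel d R)).tendsto_eLpNorm
    (measurableSet_channelTrunc d R)

lemma BddConv.locL2 {d : ℝ} {w : ℕ → ℝ × ℝ → ℂ} {w' : ℝ × ℝ → ℂ}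
    (hw : BddConv (channel d) w w') : LocL2 d w' :=
  LocL2.of_bound (hw.aestronglyMeasurable (measurableSet_channel d)) hw.norm_le.choose_spec

/-- Green's formula for a test function on the channel. -/
lemma IsTest.integral_channel_pdx {Ψ : ℝ × ℝ → ℂ} (h : IsTest Ψ) (d : ℝ) :
    ∫ z in channel d, Guide.pdx Ψ z = -∫ y in Ioo (-d / 2) (d / 2), Ψ (0, y) := by
  have hi := h.pdx.integrable.integrableOn (s := channel d)
  rw [channel, Measure.volume_eq_prod] at *
  rw [IntegrableOn, ← Measure.prod_restrict] at hi
  rw [← Measure.prod_restrict, integral_prod_symm _ hi, ← integral_neg]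
  congr 1
  ext y
  have hd : ∀ x, HasDerivAt (fun x => Ψ (x, y)) (Guide.pdx Ψ (x, y)) x := fun x =>
    pdx_eq_deriv (z := (x, y)) (h.differentiable _)
  have hc : ContDiff ℝ 1 (fun x => Ψ (x, y)) :=
    (h.1.comp (contDiff_prodMk_left y)).of_le (by simp)
  have hs : HasCompactSupport (fun x => Ψ (x, y)) := by
    refine HasCompactSupport.intro (h.2.isCompact.image continuous_fst) fun x hx => ?_
    exact image_eq_zero_of_notMem_tsupport fun h' => hx ⟨_, h', rfl⟩
  rw [← hs.integral_Ioi_deriv_eq hc 0]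
  simp_rw [fun x => (hd x).deriv]

/-! ### Smooth cutoffs -/

/-- A smooth cutoff of `{q > 0}`: it vanishes where `q ≤ 1 / (n + 2)` and is `1` where
`q ≥ 2 / (n + 2)`. -/
noncomputable def cut (q : ℝ → ℝ) (n : ℕ) (y : ℝ) : ℂ :=
  (Real.smoothTransition (((n : ℝ) + 2) * q y - 1) : ℝ)

lemma contDiff_cut {q : ℝ → ℝ} (hq : ContDiff ℝ ∞ q) (n : ℕ) : ContDiff ℝ ∞ (cut q n) :=
  Complex.ofRealCLM.contDiff.comp
    (Real.smoothTransition.contDiff.comp ((contDiff_const.mul hq).sub contDiff_const))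

lemma norm_cut_le (q : ℝ → ℝ) (n : ℕ) (y : ℝ) : ‖cut q n y‖ ≤ 1 := by
  rw [cut, Complex.norm_real, Real.norm_of_nonneg (Real.smoothTransition.nonneg _)]
  exact Real.smoothTransition.le_one _

lemma cut_eq_zero {q : ℝ → ℝ} {n : ℕ} {y : ℝ} (h : ((n : ℝ) + 2) * q y ≤ 1) : cut q n y = 0 := by
  rw [cut, Real.smoothTransition.zero_of_nonpos (by linarith), Complex.ofReal_zero]

lemma cut_eq_one {q : ℝ → ℝ} {n : ℕ} {y : ℝ} (h : 2 ≤ ((n : ℝ) + 2) * q y) : cut q n y = 1 := by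
  rw [cut, Real.smoothTransition.one_of_one_le (by linarith), Complex.ofReal_one]

lemma cut_eq_zero_of_nonpos {q : ℝ → ℝ} {n : ℕ} {y : ℝ} (h : q y ≤ 0) : cut q n y = 0 :=
  cut_eq_zero ((mul_nonpos_of_nonneg_of_nonpos (by positivity) h).trans zero_le_one)

lemma tsupport_cut_subset {q : ℝ → ℝ} (hq : Continuous q) (n : ℕ) :
    tsupport (cut q n) ⊆ {y | 0 < q y} := by
  have : tsupport (cut q n) ⊆ {y | 1 ≤ ((n : ℝ) + 2) * q y} := by
    refine closure_minimal (fun y hy => ?_)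
      (isClosed_le continuous_const (continuous_const.mul hq))
    by_contra h
    exact hy (cut_eq_zero (not_le.1 h).le)
  intro y hy
  have h1 : 1 ≤ ((n : ℝ) + 2) * q y := this hy
  by_contra h
  have h2 : q y ≤ 0 := not_lt.1 h
  nlinarith [mul_nonpos_of_nonneg_of_nonpos (by positivity : (0 : ℝ) ≤ (n : ℝ) + 2) h2]

lemma eventually_two_le_mul {a : ℝ} (ha : 0 < a) : ∀ᶠ n : ℕ in atTop, 2 ≤ ((n : ℝ) + 2) * a := by
  have : Tendsto (fun n : ℕ => ((n : ℝ) + 2) * a) atTop atTop :=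
    (tendsto_atTop_add_const_right _ _ tendsto_natCast_atTop_atTop).atTop_mul_const ha
  exact this.eventually_ge_atTop 2

lemma bddConv_mul_cut {s : Set ℝ} {q : ℝ → ℝ} {w : ℝ → ℂ} {C : ℝ} (hq : ContDiff ℝ ∞ q)
    (hw : Continuous w) (hC : ∀ y ∈ s, 0 < q y → ‖w y‖ ≤ C) :
    BddConv s (fun n y => w y * cut q n y) (fun y => if 0 < q y then w y else 0) := by
  refine ⟨fun n => hw.mul (contDiff_cut hq n).continuous, ⟨max C 0, fun n y hy => ?_⟩,
    fun y _ => ?_⟩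
  · by_cases h : 0 < q y
    · rw [norm_mul]
      exact (mul_le_of_le_one_right (norm_nonneg _) (norm_cut_le q n y)).trans
        ((hC y hy h).trans (le_max_left _ _))
    · rw [cut_eq_zero_of_nonpos (not_lt.1 h), mul_zero, norm_zero]
      exact le_max_right _ _
  · by_cases h : 0 < q y
    · rw [if_pos h]
      refine tendsto_const_nhds.congr' ?_
      filter_upwards [eventually_two_le_mul h] with n hn
      rw [cut_eq_one hn, mul_one]
    · rw [if_neg h]
      refine tendsto_const_nhds.congr fun n => ?_
      rw [cut_eq_zero_of_nonpos (not_lt.1 h), mul_zero]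

lemma exists_bound_deriv_smoothTransition :
    ∃ B : ℝ, 0 ≤ B ∧ ∀ t, |deriv Real.smoothTransition t| ≤ B := by
  have hc : Continuous (deriv Real.smoothTransition) :=
    (Real.smoothTransition.contDiff (n := 1)).continuous_deriv le_rfl
  obtain ⟨B, hB⟩ := (isCompact_Icc (a := (0 : ℝ)) (b := 1)).exists_bound_of_continuousOn
    hc.continuousOn
  refine ⟨max B 0, le_max_right _ _, fun t => ?_⟩
  by_cases ht : t ∈ Icc (0 : ℝ) 1
  · exact (hB t ht).trans (le_max_left _ _)
  · have : deriv Real.smoothTransition t = 0 := by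
      rcases lt_or_ge t 0 with h | h
      · have : Real.smoothTransition =ᶠ[𝓝 t] fun _ => 0 := by
          filter_upwards [Iio_mem_nhds h] with x hx
          exact Real.smoothTransition.zero_of_nonpos (le_of_lt hx)
        rw [this.deriv_eq, deriv_const]
      · have h1 : 1 < t := by
          by_contra h'
          exact ht ⟨h, not_lt.1 h'⟩
        have : Real.smoothTransition =ᶠ[𝓝 t] fun _ => 1 := by
          filter_upwards [Ioi_mem_nhds h1] with x hx
          exact Real.smoothTransition.one_of_one_le (le_of_lt hx)
        rw [this.deriv_eq, deriv_const]
    rw [this, abs_zero]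
    exact le_max_right _ _

lemma hasDerivAt_cut {q : ℝ → ℝ} (hq : ContDiff ℝ ∞ q) (n : ℕ) (y : ℝ) :
    HasDerivAt (cut q n) ((deriv Real.smoothTransition (((n : ℝ) + 2) * q y - 1) *
      (((n : ℝ) + 2) * deriv q y) : ℝ) : ℂ) y := by
  have h1 : HasDerivAt (fun y => ((n : ℝ) + 2) * q y - 1) (((n : ℝ) + 2) * deriv q y) y :=
    ((hq.differentiable (by simp) y).hasDerivAt.const_mul _).sub_const 1
  have h2 : HasDerivAt Real.smoothTransition _ (((n : ℝ) + 2) * q y - 1) :=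
    ((Real.smoothTransition.contDiff (n := 1)).differentiable one_ne_zero _).hasDerivAt
  exact (h2.comp y h1).ofReal_comp

/-- If `w` vanishes to first order where `q` does, then the derivatives of `w * cut q n`
stay bounded: on the transition layer `n * q` is bounded. -/
lemma bddConv_deriv_mul_cut {s : Set ℝ} {q : ℝ → ℝ} {w : ℝ → ℂ} {C : ℝ} (hq : ContDiff ℝ ∞ q)
    (hw : ContDiff ℝ ∞ w)
    (hC : ∀ y ∈ s, 0 < q y → ‖w y‖ ≤ C * q y ∧ ‖deriv w y‖ ≤ C ∧ |deriv q y| ≤ C) :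
    BddConv s (fun n => deriv (fun y => w y * cut q n y))
      (fun y => if 0 < q y then deriv w y else 0) := by
  obtain ⟨B, hB0, hB⟩ := exists_bound_deriv_smoothTransition
  have hd : ∀ n y, deriv (fun y => w y * cut q n y) y = deriv w y * cut q n y +
      w y * ((deriv Real.smoothTransition (((n : ℝ) + 2) * q y - 1) *
        (((n : ℝ) + 2) * deriv q y) : ℝ) : ℂ) := fun n y =>
    ((hw.differentiable (by simp) y).hasDerivAt.mul (hasDerivAt_cut hq n y)).deriv
  have hz : ∀ n y, q y ≤ 0 → deriv (fun y => w y * cut q n y) y = 0 := fun n y hy => by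
    have : (fun y => w y * cut q n y) =ᶠ[𝓝 y] fun _ => 0 := by
      have hc : ContinuousAt (fun y => ((n : ℝ) + 2) * q y) y :=
        (continuous_const.mul hq.continuous).continuousAt
      have h1 : ((n : ℝ) + 2) * q y < 1 :=
        (mul_nonpos_of_nonneg_of_nonpos (by positivity) hy).trans_lt zero_lt_one
      filter_upwards [hc.eventually_lt_const h1] with x hx
      rw [cut_eq_zero hx.le, mul_zero]
    rw [this.deriv_eq, deriv_const]
  refine ⟨fun n => (hw.mul (contDiff_cut hq n)).continuous_deriv (by simp),
    ⟨max (C + C * (B * (2 * C))) 0, fun n y hy => ?_⟩, fun y hy => ?_⟩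
  · by_cases h : 0 < q y
    · obtain ⟨h1, h2, h3⟩ := hC y hy h
      have hC0 : 0 ≤ C := (norm_nonneg _).trans h2
      refine le_trans ?_ (le_max_left _ _)
      rw [hd]
      refine (norm_add_le _ _).trans (add_le_add ?_ ?_)
      · rw [norm_mul]
        exact (mul_le_of_le_one_right (norm_nonneg _) (norm_cut_le q n y)).trans h2
      · rw [norm_mul, Complex.norm_real, Real.norm_eq_abs, abs_mul, abs_mul,
          abs_of_nonneg (by positivity : (0 : ℝ) ≤ (n : ℝ) + 2)]
        by_cases hl : ((n : ℝ) + 2) * q y ≤ 2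
        · calc ‖w y‖ * (|deriv Real.smoothTransition (((n : ℝ) + 2) * q y - 1)| *
                (((n : ℝ) + 2) * |deriv q y|))
              ≤ (C * q y) * (B * (((n : ℝ) + 2) * C)) := by
                gcongr
                exact hB _
            _ = C * (B * ((((n : ℝ) + 2) * q y) * C)) := by ring
            _ ≤ C * (B * (2 * C)) := by gcongr
        -- Beyond the transition layer the cutoff is locally constant.
        · have : Real.smoothTransition =ᶠ[𝓝 (((n : ℝ) + 2) * q y - 1)] fun _ => 1 := by
            filter_upwards [Ioi_mem_nhds (by linarith : 1 < ((n : ℝ) + 2) * q y - 1)] with x hx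
            exact Real.smoothTransition.one_of_one_le (le_of_lt hx)
          rw [this.deriv_eq, deriv_const, abs_zero, zero_mul, mul_zero]
          positivity
    · rw [hz n y (not_lt.1 h), norm_zero]
      exact le_max_right _ _
  · by_cases h : 0 < q y
    · rw [if_pos h]
      refine tendsto_const_nhds.congr' ?_
      filter_upwards [eventually_two_le_mul (half_pos h)] with n hn
      have hn' : 1 < ((n : ℝ) + 2) * q y - 1 := by nlinarith
      have : Real.smoothTransition =ᶠ[𝓝 (((n : ℝ) + 2) * q y - 1)] fun _ => 1 := by
        filter_upwards [Ioi_mem_nhds hn'] with x hx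
        exact Real.smoothTransition.one_of_one_le (le_of_lt hx)
      rw [hd, cut_eq_one (by linarith), this.deriv_eq, deriv_const]
      simp
    · rw [if_neg h]
      exact tendsto_const_nhds.congr fun n => (hz n y (not_lt.1 h)).symm

/-- A smooth compactly supported function that is `1` on `[-R, R]`. -/
lemma exists_plateau (R : ℝ) : ∃ κ : ℝ → ℂ, ContDiff ℝ ∞ κ ∧ HasCompactSupport κ ∧
    ∀ x, |x| ≤ R → κ x = 1 := by
  let f : ContDiffBump (0 : ℝ) := ⟨|R| + 1, |R| + 2, by positivity, by linarith⟩
  refine ⟨fun x => (f x : ℂ), Complex.ofRealCLM.contDiff.comp f.contDiff,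
    f.hasCompactSupport.comp_left Complex.ofReal_zero, fun x hx => ?_⟩
  change ((f x : ℝ) : ℂ) = 1
  rw [f.one_of_mem_closedBall, Complex.ofReal_one]
  rw [mem_closedBall_zero_iff, Real.norm_eq_abs]
  exact hx.trans ((le_abs_self R).trans (by simp [f]))

/-! ### The transverse modes -/

/-- The modes as complex functions. -/
noncomputable def cmode (bc : WallCondition) (d : ℝ) (m : ℕ) (y : ℝ) : ℂ := (mode bc d m y : ℂ)

/-- A function that is positive exactly on the cross-section. -/
noncomputable def wallDist (d : ℝ) (y : ℝ) : ℝ := (d / 2) ^ 2 - y ^ 2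

lemma contDiff_wallDist (d : ℝ) : ContDiff ℝ ∞ (wallDist d) :=
  contDiff_const.sub (contDiff_id.pow 2)

lemma wallDist_pos_iff {d : ℝ} (hd : 0 < d) {y : ℝ} :
    0 < wallDist d y ↔ y ∈ Ioo (-d / 2) (d / 2) := by
  rw [wallDist, mem_Ioo]
  constructor
  · intro h
    have := abs_lt_of_sq_lt_sq' (by linarith : y ^ 2 < (d / 2) ^ 2) (by positivity)
    exact ⟨by linarith [this.1], this.2⟩
  · rintro ⟨h1, h2⟩
    nlinarith

lemma transverse_nonneg (bc : WallCondition) {d : ℝ} (hd : 0 < d) {m : ℕ} (hm : 1 ≤ m) :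
    0 ≤ transverse bc d m := by
  have h1 : (1 : ℝ) ≤ m := by exact_mod_cast hm
  have := Real.pi_pos
  cases bc
  · simp only [transverse]; positivity
  · simp only [transverse]
    have : 0 ≤ (m : ℝ) - 1 := by linarith
    positivity

lemma transverse_mono (bc : WallCondition) {d : ℝ} (hd : 0 < d) {m n : ℕ} (h : m ≤ n) :
    transverse bc d m ≤ transverse bc d n := by
  have h1 : (m : ℝ) ≤ n := by exact_mod_cast h
  have := Real.pi_pos
  cases bc <;> simp only [transverse] <;> gcongr

/-- The modes with index at most `numModes` are propagating. -/
lemma transverse_lt_of_le_numModes {bc : WallCondition} {k d : ℝ} (hd : 0 < d) {m : ℕ}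
    (hm : 1 ≤ m) (h : m ≤ numModes bc k d) : transverse bc d m < k := by
  by_contra hk
  have hs : {n : ℕ | 1 ≤ n ∧ transverse bc d n < k} ⊆ (Finset.Ico 1 m : Set ℕ) := by
    rintro n ⟨h1, h2⟩
    rw [Finset.coe_Ico]
    refine ⟨h1, ?_⟩
    by_contra h3
    exact hk ((transverse_mono bc hd (not_lt.1 h3)).trans_lt h2)
  have := Set.ncard_le_ncard hs (Finset.finite_toSet _)
  rw [Set.ncard_coe_finset, Nat.card_Ico] at this
  rw [numModes] at h
  omega

lemma beta_sq {bc : WallCondition} {k d : ℝ} (hk : 0 < k) (hd : 0 < d) {m : ℕ} (hm : 1 ≤ m) :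
    beta bc k d m ^ 2 = (k : ℂ) ^ 2 - (transverse bc d m : ℂ) ^ 2 := by
  have h0 := transverse_nonneg bc hd hm
  rw [beta]
  split_ifs with h
  · rw [← Complex.ofReal_pow, Real.sq_sqrt (by nlinarith)]
    push_cast
    ring
  · rw [mul_pow, Complex.I_sq, ← Complex.ofReal_pow, Real.sq_sqrt (by nlinarith)]
    push_cast
    ring

/-- Evanescent modes have `Re β = 0`: they carry no energy. -/
lemma beta_re_nonneg (bc : WallCondition) (k d : ℝ) (m : ℕ) : 0 ≤ (beta bc k d m).re := by
  rw [beta]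
  split_ifs
  · rw [Complex.ofReal_re]; positivity
  · simp

lemma beta_re_pos {bc : WallCondition} {k d : ℝ} (hd : 0 < d) {m : ℕ} (hm : 1 ≤ m)
    (h : transverse bc d m < k) : 0 < (beta bc k d m).re := by
  have h0 := transverse_nonneg bc hd hm
  rw [beta, if_pos h.le, Complex.ofReal_re, Real.sqrt_pos]
  nlinarith

lemma contDiff_mode (bc : WallCondition) (d : ℝ) (m : ℕ) : ContDiff ℝ ∞ (mode bc d m) := by
  cases bc
  · exact contDiff_const.mul (Real.contDiff_sin.comp
      (contDiff_const.mul (contDiff_id.add contDiff_const)))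
  · exact contDiff_const.mul (Real.contDiff_cos.comp
      (contDiff_const.mul (contDiff_id.add contDiff_const)))

lemma contDiff_cmode (bc : WallCondition) (d : ℝ) (m : ℕ) : ContDiff ℝ ∞ (cmode bc d m) :=
  Complex.ofRealCLM.contDiff.comp (contDiff_mode bc d m)

lemma deriv_cmode (bc : WallCondition) (d : ℝ) (m : ℕ) (y : ℝ) :
    deriv (cmode bc d m) y = ((deriv (mode bc d m) y : ℝ) : ℂ) :=
  (((contDiff_mode bc d m).differentiable (by simp) y).hasDerivAt.ofReal_comp).deriv

lemma contDiff_deriv_cmode (bc : WallCondition) (d : ℝ) (m : ℕ) :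
    ContDiff ℝ ∞ (deriv (cmode bc d m)) :=
  (contDiff_infty_iff_deriv.1 (contDiff_cmode bc d m)).2

lemma hasDerivAt_phase (μ d y : ℝ) : HasDerivAt (fun y => μ * (y + d / 2)) μ y := by
  simpa using ((hasDerivAt_id y).add_const (d / 2)).const_mul μ

lemma deriv_mode_dirichlet (d : ℝ) (m : ℕ) (y : ℝ) : deriv (mode .dirichlet d m) y =
    Real.sqrt (2 / d) * (Real.cos (transverse .dirichlet d m * (y + d / 2)) *
      transverse .dirichlet d m) :=
  ((hasDerivAt_phase (transverse .dirichlet d m) d y).sin.const_mul _).deriv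

lemma deriv_mode_neumann (d : ℝ) (m : ℕ) (y : ℝ) : deriv (mode .neumann d m) y =
    Real.sqrt ((2 - (if m = 1 then 1 else 0)) / d) *
      (-Real.sin (transverse .neumann d m * (y + d / 2)) * transverse .neumann d m) :=
  ((hasDerivAt_phase (transverse .neumann d m) d y).cos.const_mul _).deriv

lemma deriv_deriv_mode (bc : WallCondition) (d : ℝ) (m : ℕ) (y : ℝ) :
    deriv (deriv (mode bc d m)) y = -transverse bc d m ^ 2 * mode bc d m y := by
  cases bc
  · rw [funext (deriv_mode_dirichlet d m),
      (((hasDerivAt_phase (transverse .dirichlet d m) d y).cos.mul_const _).const_mul _).deriv, mode]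
    ring
  · rw [funext (deriv_mode_neumann d m),
      (((hasDerivAt_phase (transverse .neumann d m) d y).sin.fun_neg.mul_const _).const_mul _).deriv,
      mode]
    ring

lemma deriv_deriv_cmode (bc : WallCondition) (d : ℝ) (m : ℕ) (y : ℝ) :
    deriv (deriv (cmode bc d m)) y = -(transverse bc d m : ℂ) ^ 2 * cmode bc d m y := by
  have h1 : Differentiable ℝ (deriv (mode bc d m)) :=
    (contDiff_infty_iff_deriv.1 (contDiff_mode bc d m)).2.differentiable (by simp)
  rw [funext (deriv_cmode bc d m), ((h1 y).hasDerivAt.ofReal_comp).deriv, deriv_deriv_mode, cmode]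
  push_cast
  ring

/-- `sin` of the phase vanishes linearly at both ends of the cross-section. -/
lemma abs_sin_le_wallDist {d μ : ℝ} (hd : 0 < d) (hμ : 0 ≤ μ) {j : ℕ} (hj : μ * d = j * Real.pi)
    {y : ℝ} (hy : y ∈ Ioo (-d / 2) (d / 2)) :
    |Real.sin (μ * (y + d / 2))| ≤ 2 * μ / d * wallDist d y := by
  have h1 : |Real.sin (μ * (y + d / 2))| ≤ μ * (y + d / 2) := by
    have h := Real.abs_sin_le_abs (x := μ * (y + d / 2))
    rwa [abs_of_nonneg (mul_nonneg hμ (by linarith [hy.1]))] at h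
  have h2 : |Real.sin (μ * (y + d / 2))| ≤ μ * (d / 2 - y) := by
    have h := Real.abs_sin_le_abs (x := μ * (d / 2 - y))
    rw [abs_of_nonneg (mul_nonneg hμ (by linarith [hy.2]))] at h
    have e : μ * (y + d / 2) = j * Real.pi - μ * (d / 2 - y) := by rw [← hj]; ring
    rwa [e, Real.sin_sub, Real.sin_nat_mul_pi, zero_mul, zero_sub, abs_neg, abs_mul,
      Real.cos_nat_mul_pi, abs_pow, abs_neg,
      abs_one, one_pow, one_mul]
  have h3 : 2 * μ / d * wallDist d y = 2 * μ * ((d / 2 - y) * (y + d / 2)) / d := by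
    rw [wallDist]; ring
  rw [h3, le_div_iff₀ hd]
  have a1 : 0 < d / 2 - y := by linarith [hy.2]
  have a2 : 0 < y + d / 2 := by linarith [hy.1]
  rcases le_total y 0 with h | h
  · calc |Real.sin (μ * (y + d / 2))| * d ≤ μ * (y + d / 2) * (2 * (d / 2 - y)) := by
          gcongr; linarith
      _ = _ := by ring
  · calc |Real.sin (μ * (y + d / 2))| * d ≤ μ * (d / 2 - y) * (2 * (y + d / 2)) := by
          gcongr; linarith
      _ = _ := by ring

/-- Dirichlet modes vanish linearly at the walls. -/
lemma exists_norm_cmode_le {d : ℝ} (hd : 0 < d) {m : ℕ} (hm : 1 ≤ m) :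
    ∃ C, ∀ y ∈ Ioo (-d / 2) (d / 2), ‖cmode .dirichlet d m y‖ ≤ C * wallDist d y := by
  refine ⟨Real.sqrt (2 / d) * (2 * transverse .dirichlet d m / d), fun y hy => ?_⟩
  rw [cmode, Complex.norm_real, mode, norm_mul, Real.norm_of_nonneg (Real.sqrt_nonneg _), mul_assoc]
  refine mul_le_mul_of_nonneg_left ?_ (Real.sqrt_nonneg _)
  refine abs_sin_le_wallDist hd (transverse_nonneg _ hd hm) (j := m) ?_ hy
  simp only [transverse]
  field_simp

/-- Derivatives of Neumann modes vanish linearly at the walls. -/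
lemma exists_norm_deriv_cmode_le {d : ℝ} (hd : 0 < d) {m : ℕ} (hm : 1 ≤ m) :
    ∃ C, ∀ y ∈ Ioo (-d / 2) (d / 2), ‖deriv (cmode .neumann d m) y‖ ≤ C * wallDist d y := by
  set A := Real.sqrt ((2 - (if m = 1 then 1 else 0)) / d)
  have h0 := transverse_nonneg .neumann hd hm
  refine ⟨A * (2 * transverse .neumann d m / d * transverse .neumann d m), fun y hy => ?_⟩
  rw [deriv_cmode, Complex.norm_real, deriv_mode_neumann, norm_mul,
    Real.norm_of_nonneg (Real.sqrt_nonneg _), mul_assoc]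
  refine mul_le_mul_of_nonneg_left ?_ (Real.sqrt_nonneg _)
  rw [norm_mul, norm_neg, Real.norm_of_nonneg h0, mul_right_comm]
  refine mul_le_mul_of_nonneg_right ?_ h0
  refine abs_sin_le_wallDist hd h0 (j := m - 1) ?_ hy
  simp only [transverse]
  push_cast [hm]
  field_simp

lemma exists_bound_Ioo {f : ℝ → ℂ} (hf : Continuous f) (d : ℝ) :
    ∃ C, ∀ y ∈ Ioo (-d / 2) (d / 2), ‖f y‖ ≤ C := by
  obtain ⟨C, hC⟩ := (isCompact_Icc (a := -d / 2) (b := d / 2)).exists_bound_of_continuousOn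
    hf.continuousOn
  exact ⟨C, fun y hy => hC y (Ioo_subset_Icc_self hy)⟩

/-! ### Weak equations for the mode coefficients of a field in the channel -/

lemma InLocalEnergySpace.locL2 {bc : WallCondition} {d : ℝ} {u : Field}
    (hu : InLocalEnergySpace bc d u) : LocL2 d u.val ∧ LocL2 d u.dx ∧ LocL2 d u.dy :=
  ⟨fun R hR => (hu R hR).1.1, fun R hR => (hu R hR).1.2.1, fun R hR => (hu R hR).1.2.2.1⟩

lemma exists_zero_of_hasCompactSupport {f : ℝ → ℂ} (hf : HasCompactSupport f) :
    ∃ R, 0 < R ∧ ∀ x, R ≤ x → f x = 0 ∧ deriv f x = 0 := by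
  obtain ⟨R, hR⟩ := hf.isCompact.isBounded.subset_closedBall (0 : ℝ)
  refine ⟨max R 0 + 1, by positivity, fun x hx => ?_⟩
  have h : x ∉ tsupport f := fun h => by
    have h1 := hR h
    rw [mem_closedBall_zero_iff, Real.norm_eq_abs] at h1
    linarith [le_abs_self x, le_max_left R 0]
  exact ⟨image_eq_zero_of_notMem_tsupport h,
    image_eq_zero_of_notMem_tsupport fun h' => h (tsupport_deriv_subset h')⟩

lemma exists_bound_of_hasCompactSupport {f : ℝ → ℂ} (hc : Continuous f)
    (hf : HasCompactSupport f) (s : Set ℝ) : ∃ C, ∀ x ∈ s, ‖f x‖ ≤ C :=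
  let ⟨C, hC⟩ := hc.bounded_above_of_compact_support hf
  ⟨C, fun x _ => hC x⟩

lemma IsTest.exists_zero {φ : ℝ × ℝ → ℂ} (h : IsTest φ) :
    ∃ R, 0 < R ∧ ∀ z : ℝ × ℝ, z ∈ tsupport φ → z.1 < R := by
  obtain ⟨R, hR⟩ := h.2.isCompact.isBounded.subset_closedBall (0 : ℝ × ℝ)
  refine ⟨max R 0 + 1, by positivity, fun z hz => ?_⟩
  have h1 := hR hz
  rw [mem_closedBall_zero_iff] at h1
  have h2 := (norm_fst_le z).trans h1
  rw [Real.norm_eq_abs] at h2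
  linarith [le_abs_self z.1, le_max_left R 0]

lemma IsTest.locL2 {φ : ℝ × ℝ → ℂ} (h : IsTest φ) (d : ℝ) : LocL2 d φ :=
  LocL2.of_memLp (h.memLp _)

lemma tsupport_pdx_subset (φ : ℝ × ℝ → ℂ) : tsupport (pdx φ) ⊆ tsupport φ :=
  tsupport_fderiv_apply_subset ℝ (1, 0)

lemma tsupport_pdy_subset (φ : ℝ × ℝ → ℂ) : tsupport (pdy φ) ⊆ tsupport φ :=
  tsupport_fderiv_apply_subset ℝ (0, 1)

/-- The defining property of the weak derivatives, with integrals over the whole channel. -/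
lemma InLocalEnergySpace.weak_deriv {bc : WallCondition} {d : ℝ} {u : Field}
    (hu : InLocalEnergySpace bc d u) {φ : ℝ × ℝ → ℂ} (hφ : IsTest φ)
    (hs : tsupport φ ⊆ channel d) :
    (∫ z in channel d, u.val z * pdx φ z = -∫ z in channel d, u.dx z * φ z) ∧
    (∫ z in channel d, u.val z * pdy φ z = -∫ z in channel d, u.dy z * φ z) := by
  obtain ⟨R, hR, hz⟩ := hφ.exists_zero
  have h0 : ∀ {ψ : ℝ × ℝ → ℂ} (v : ℝ × ℝ → ℂ), tsupport ψ ⊆ tsupport φ →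
      ∫ z in channel d, v z * ψ z = ∫ z in channelTrunc d R, v z * ψ z := fun v h =>
    integral_channel_eq fun z hzR => by
      rw [image_eq_zero_of_notMem_tsupport fun h' => (hz z (h h')).not_ge hzR, mul_zero]
  rw [h0 _ (tsupport_pdx_subset φ), h0 _ (tsupport_pdy_subset φ), h0 _ subset_rfl,
    h0 _ subset_rfl]
  exact (hu R hR).1.2.2.2 φ hφ fun z h => ⟨⟨(hs h).1, hz z h⟩, (hs h).2⟩

lemma tsupport_cut_wallDist_subset {d : ℝ} (hd : 0 < d) (n : ℕ) :
    tsupport (cut (wallDist d) n) ⊆ Ioo (-d / 2) (d / 2) := fun _ hy =>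
  (wallDist_pos_iff hd).1 (tsupport_cut_subset (contDiff_wallDist d).continuous n hy)

lemma hasCompactSupport_cut_wallDist {d : ℝ} (hd : 0 < d) (n : ℕ) :
    HasCompactSupport (cut (wallDist d) n) :=
  (isCompact_Icc (a := -d / 2) (b := d / 2)).of_isClosed_subset (isClosed_tsupport _)
    ((tsupport_cut_wallDist_subset hd n).trans Ioo_subset_Icc_self)

lemma bddConv_mul_cut_wallDist {d : ℝ} (hd : 0 < d) {w : ℝ → ℂ} (hw : Continuous w) :
    BddConv (Ioo (-d / 2) (d / 2)) (fun n y => w y * cut (wallDist d) n y) w := by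
  obtain ⟨C, hC⟩ := exists_bound_Ioo hw d
  refine (bddConv_mul_cut (contDiff_wallDist d) hw fun y hy _ => hC y hy).congr fun y hy => ?_
  rw [if_pos ((wallDist_pos_iff hd).2 hy)]

lemma bddConv_deriv_mul_cut_wallDist {d C : ℝ} (hd : 0 < d) {w : ℝ → ℂ} (hw : ContDiff ℝ ∞ w)
    (hC : ∀ y ∈ Ioo (-d / 2) (d / 2), ‖w y‖ ≤ C * wallDist d y) :
    BddConv (Ioo (-d / 2) (d / 2)) (fun n => deriv (fun y => w y * cut (wallDist d) n y))
      (deriv w) := by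
  obtain ⟨D, hD⟩ := exists_bound_Ioo (hw.continuous_deriv (by simp)) d
  have hq : ContDiff ℝ ∞ (fun y => (wallDist d y : ℂ)) :=
    Complex.ofRealCLM.contDiff.comp (contDiff_wallDist d)
  obtain ⟨E, hE⟩ := exists_bound_Ioo (hq.continuous_deriv (by simp)) d
  refine (bddConv_deriv_mul_cut (C := max C (max D E)) (contDiff_wallDist d) hw
    fun y hy hp => ⟨(hC y hy).trans ?_, (hD y hy).trans ?_, ?_⟩).congr fun y hy => ?_
  · exact mul_le_mul_of_nonneg_right (le_max_left _ _) hp.le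
  · exact (le_max_left _ _).trans (le_max_right _ _)
  · have h := hE y hy
    have e : deriv (fun y => (wallDist d y : ℂ)) y = ((deriv (wallDist d) y : ℝ) : ℂ) :=
      (((contDiff_wallDist d).differentiable (by simp) y).hasDerivAt.ofReal_comp).deriv
    rw [e, Complex.norm_real, Real.norm_eq_abs] at h
    exact h.trans ((le_max_right _ _).trans (le_max_right _ _))
  · rw [if_pos ((wallDist_pos_iff hd).2 hy)]

/-- A test function vanishing on the walls has `∫ ∂_y Ψ = 0` on the channel. -/
lemma IsTest.integral_channel_pdy {Ψ : ℝ × ℝ → ℂ} (h : IsTest Ψ) {d : ℝ} (hd : 0 < d)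
    (h0 : ∀ z ∈ channelWalls d, Ψ z = 0) : ∫ z in channel d, Guide.pdy Ψ z = 0 := by
  have hi := h.pdy.integrable.integrableOn (s := channel d)
  rw [channel, Measure.volume_eq_prod] at *
  rw [setIntegral_prod _ hi]
  refine setIntegral_eq_zero_of_forall_eq_zero fun x hx => ?_
  rw [← integral_Ioc_eq_integral_Ioo, ← intervalIntegral.integral_of_le (by linarith),
    intervalIntegral.integral_eq_sub_of_hasDerivAt (f := fun y => Ψ (x, y)),
    h0 (x, d / 2) ⟨le_of_lt hx, Or.inr rfl⟩, h0 (x, -d / 2) ⟨le_of_lt hx, Or.inl rfl⟩, sub_zero]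
  · exact fun y _ => pdy_eq_deriv (z := (x, y)) (h.differentiable _)
  · exact (h.pdy.continuous.comp (continuous_const.prodMk continuous_id)).intervalIntegrable _ _

lemma locL2_sep {d : ℝ} {g b : ℝ → ℂ} (hg : Continuous g) (hgs : HasCompactSupport g)
    (hb : Continuous b) : LocL2 d (fun z => g z.1 * b z.2) :=
  ((BddConv.const hg (exists_bound_of_hasCompactSupport hg hgs (Ioi 0))).sep
    (BddConv.const hb (exists_bound_Ioo hb d))).locL2

/-- Integration by parts in `y` for a field that vanishes on the walls. -/
lemma InLocalEnergySpace.integral_dy_of_dirichlet {d : ℝ} (hd : 0 < d) {u : Field}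
    (hu : InLocalEnergySpace .dirichlet d u) {g w : ℝ → ℂ} (hg : ContDiff ℝ ∞ g)
    (hgs : HasCompactSupport g) (hw : ContDiff ℝ ∞ w) :
    ∫ z in channel d, u.dy z * (g z.1 * w z.2) =
      -∫ z in channel d, u.val z * (g z.1 * deriv w z.2) := by
  obtain ⟨R, hR, hgR⟩ := exists_zero_of_hasCompactSupport hgs
  have hw' : ContDiff ℝ ∞ (deriv w) := (contDiff_infty_iff_deriv.1 hw).2
  obtain ⟨hu0, -, huy⟩ := hu.locL2
  obtain ⟨φ, h1, h2, h3, -, h5⟩ := ((hu R hR).2 rfl).exists_seq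
  have m1 := (locL2_sep (d := d) hg.continuous hgs hw.continuous).memLp R
  have m2 := (locL2_sep (d := d) hg.continuous hgs hw'.continuous).memLp R
  have l1 := tendsto_integral_mul_of_eLpNorm (hu0.memLp R) (fun n => (h1 n).memLp _) m2 h3
  have l2 := tendsto_integral_mul_of_eLpNorm (huy.memLp R) (fun n => (h1 n).pdy.memLp _) m1 h5
  rw [integral_channel_eq (R := R) fun z hz => by rw [(hgR _ hz).1, zero_mul, mul_zero],
    integral_channel_eq (R := R) fun z hz => by rw [(hgR _ hz).1, zero_mul, mul_zero]]
  refine tendsto_nhds_unique l2 (l1.neg.congr fun n => ?_)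
  have hgb : ContDiff ℝ ∞ (fun z : ℝ × ℝ => g z.1 * w z.2) :=
    (contDiff_comp_fst hg).mul (contDiff_comp_snd hw)
  have key := ((h1 n).mul hgb).integral_channel_pdy hd fun z hz => by
    rw [image_eq_zero_of_notMem_tsupport (disjoint_right.1 (h2 n) hz), zero_mul]
  have e : pdy (fun z => φ n z * (g z.1 * w z.2)) =
      fun z => pdy (φ n) z * (g z.1 * w z.2) + φ n z * (g z.1 * deriv w z.2) := by
    ext z
    rw [pdy_mul ((h1 n).differentiable z) (hgb.differentiable (by simp) z), pdy_sep hg hw]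
  rw [e, integral_channel_eq (R := R) fun z hz => by rw [(hgR _ hz).1]; simp,
    integral_add] at key
  · exact (eq_neg_of_add_eq_zero_left key).symm
  · exact ((h1 n).pdy.memLp _).integrable_mul m1
  · exact ((h1 n).memLp _).integrable_mul m2

/-- Integration by parts in `y` against a function that vanishes at the walls. -/
lemma InLocalEnergySpace.integral_dy_of_le_wallDist {bc : WallCondition} {d C : ℝ} (hd : 0 < d)
    {u : Field} (hu : InLocalEnergySpace bc d u) {g w : ℝ → ℂ} (hg : ContDiff ℝ ∞ g)
    (hgs : HasCompactSupport g) (hw : ContDiff ℝ ∞ w)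
    (hC : ∀ y ∈ Ioo (-d / 2) (d / 2), ‖w y‖ ≤ C * wallDist d y) :
    ∫ z in channel d, u.dy z * (g z.1 * w z.2) =
      -∫ z in channel d, u.val z * (g z.1 * deriv w z.2) := by
  obtain ⟨R, hR, hgR⟩ := exists_zero_of_hasCompactSupport hgs
  obtain ⟨hu0, -, huy⟩ := hu.locL2
  obtain ⟨D, hD⟩ := hg.continuous.bounded_above_of_compact_support hgs
  have hid : ContDiff ℝ ∞ (id : ℝ → ℝ) := contDiff_id
  have hG : BddConv (Ioi 0) (fun n x => g x * cut id n x) g :=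
    (bddConv_mul_cut hid hg.continuous fun x _ _ => hD x).congr fun x hx => if_pos hx
  have l1 := huy.tendsto_integral_mul (R := R)
    (hG.sep (bddConv_mul_cut_wallDist hd hw.continuous))
    (fun n z hz => by rw [(hgR _ hz).1, zero_mul, zero_mul])
    (fun z hz => by rw [(hgR _ hz).1, zero_mul])
  have l2 := hu0.tendsto_integral_mul (R := R)
    (hG.sep (bddConv_deriv_mul_cut_wallDist hd hw hC))
    (fun n z hz => by rw [(hgR _ hz).1, zero_mul, zero_mul])
    (fun z hz => by rw [(hgR _ hz).1, zero_mul])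
  refine tendsto_nhds_unique l1 (l2.neg.congr fun n => ?_)
  have e1 : ContDiff ℝ ∞ (fun x => g x * cut id n x) := hg.mul (contDiff_cut hid n)
  have e2 : ContDiff ℝ ∞ (fun y => w y * cut (wallDist d) n y) :=
    hw.mul (contDiff_cut (contDiff_wallDist d) n)
  have ht := IsTest.sep e1 hgs.mul_right e2 (hasCompactSupport_cut_wallDist hd n).mul_left
  have hsub := (tsupport_sep_subset (fun x => g x * cut id n x)
      (fun y => w y * cut (wallDist d) n y)).trans (prod_mono
    (tsupport_mul_subset_right.trans (tsupport_cut_subset continuous_id n))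
    (tsupport_mul_subset_right.trans (tsupport_cut_wallDist_subset hd n)))
  have key := (hu.weak_deriv ht hsub).2
  simp_rw [pdy_sep e1 e2] at key
  rw [key, neg_neg]

/-- Integration by parts in `y` against a mode. In the Dirichlet case the boundary terms vanish
because `u` does, in the Neumann case because the derivative of the mode does. -/
lemma InLocalEnergySpace.integral_dy_mode {bc : WallCondition} {d : ℝ} (hd : 0 < d) {u : Field}
    (hu : InLocalEnergySpace bc d u) {m : ℕ} (hm : 1 ≤ m) {g : ℝ → ℂ} (hg : ContDiff ℝ ∞ g)
    (hgs : HasCompactSupport g) :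
    ∫ z in channel d, u.dy z * (g z.1 * deriv (cmode bc d m) z.2) =
      (transverse bc d m : ℂ) ^ 2 * ∫ z in channel d, u.val z * (g z.1 * cmode bc d m z.2) := by
  have hb' := contDiff_deriv_cmode bc d m
  have h : ∫ z in channel d, u.dy z * (g z.1 * deriv (cmode bc d m) z.2) =
      -∫ z in channel d, u.val z * (g z.1 * deriv (deriv (cmode bc d m)) z.2) := by
    cases bc
    · exact hu.integral_dy_of_dirichlet hd hg hgs hb'
    · obtain ⟨C, hC⟩ := exists_norm_deriv_cmode_le hd hm
      exact hu.integral_dy_of_le_wallDist hd hg hgs hb' hC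
  rw [h, ← integral_neg, ← integral_const_mul]
  congr 1
  ext z
  rw [deriv_deriv_cmode]
  ring

/-- The trace formula tested with a product. -/
lemma IsChannelTrace.integral_sep {bc : WallCondition} {d : ℝ} {u : Field}
    (hu : InLocalEnergySpace bc d u) {τ : ℝ → ℂ} (hτ : IsChannelTrace d u τ)
    {g w : ℝ → ℂ} (hg : ContDiff ℝ ∞ g) (hgs : HasCompactSupport g)
    (hw : ContDiff ℝ ∞ w) (hws : HasCompactSupport w)
    (hs : tsupport w ⊆ Ioo (-d / 2) (d / 2)) :
    (∫ z in channel d, u.val z * (deriv g z.1 * w z.2)) +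
      (∫ z in channel d, u.dx z * (g z.1 * w z.2)) =
      -(g 0 * ∫ y in Ioo (-d / 2) (d / 2), τ y * w y) := by
  obtain ⟨R, hR, hgR⟩ := exists_zero_of_hasCompactSupport hgs
  have hg' : ContDiff ℝ ∞ (deriv g) := (contDiff_infty_iff_deriv.1 hg).2
  obtain ⟨hu0, hux, -⟩ := hu.locL2
  have key := hτ.2 _ (IsTest.sep hg hgs hw hws)
    ((tsupport_sep_subset _ _).trans (prod_mono (subset_univ _) hs))
  simp_rw [pdx_sep hg hw] at key
  have i1 := hu0.integrableOn_mul (R := R) (locL2_sep hg'.continuous hgs.deriv hw.continuous)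
    fun z hz => by rw [(hgR _ hz).2, zero_mul]
  have i2 := hux.integrableOn_mul (R := R) (locL2_sep hg.continuous hgs hw.continuous)
    fun z hz => by rw [(hgR _ hz).1, zero_mul]
  rw [integral_add i1 i2] at key
  rw [key, ← integral_const_mul]
  congr 2
  ext y
  ring

/-- The trace formula tested with a mode. -/
lemma IsChannelTrace.integral_mode {bc : WallCondition} {d : ℝ} (hd : 0 < d) {u : Field}
    (hu : InLocalEnergySpace bc d u) {τ : ℝ → ℂ} (hτ : IsChannelTrace d u τ) (m : ℕ)
    {g : ℝ → ℂ} (hg : ContDiff ℝ ∞ g) (hgs : HasCompactSupport g) :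
    (∫ z in channel d, u.val z * (deriv g z.1 * cmode bc d m z.2)) +
      (∫ z in channel d, u.dx z * (g z.1 * cmode bc d m z.2)) =
      -(g 0 * ∫ y in Ioo (-d / 2) (d / 2), cmode bc d m y * τ y) := by
  obtain ⟨R, hR, hgR⟩ := exists_zero_of_hasCompactSupport hgs
  have hb := contDiff_cmode bc d m
  have hg' : Continuous (deriv g) := hg.continuous_deriv (by simp)
  obtain ⟨hu0, hux, -⟩ := hu.locL2
  have cb := bddConv_mul_cut_wallDist hd hb.continuous
  have c1 := (BddConv.const hg.continuous
    (exists_bound_of_hasCompactSupport hg.continuous hgs (Ioi 0))).sep cb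
  have c2 := (BddConv.const hg'
    (exists_bound_of_hasCompactSupport hg' hgs.deriv (Ioi 0))).sep cb
  have l1 := hux.tendsto_integral_mul (R := R) c1
    (fun n z hz => by rw [(hgR _ hz).1, zero_mul]) (fun z hz => by rw [(hgR _ hz).1, zero_mul])
  have l2 := hu0.tendsto_integral_mul (R := R) c2
    (fun n z hz => by rw [(hgR _ hz).2, zero_mul]) (fun z hz => by rw [(hgR _ hz).2, zero_mul])
  have hi : IntegrableOn τ (Ioo (-d / 2) (d / 2)) := hτ.1.integrable one_le_two
  have l3 := (cb.tendsto_integral_mul measurableSet_Ioo hi).const_mul (g 0)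
  have e : ∫ y in Ioo (-d / 2) (d / 2), cmode bc d m y * τ y =
      ∫ y in Ioo (-d / 2) (d / 2), τ y * cmode bc d m y := by simp_rw [mul_comm]
  rw [e]
  refine tendsto_nhds_unique (l2.add l1) (l3.neg.congr fun n => Eq.symm ?_)
  exact hτ.integral_sep hu hg hgs (hb.mul (contDiff_cut (contDiff_wallDist d) n))
    (hasCompactSupport_cut_wallDist hd n).mul_left
    (tsupport_mul_subset_right.trans (tsupport_cut_wallDist_subset hd n))

/-! ### Products of a longitudinal function with a mode as test functions -/

/-- The field `f(x) b(y)` with gradient `(f'(x) b(y), f(x) b'(y))`. -/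
def sepField (f f' b b' : ℝ → ℂ) : Field where
  val := fun z => f z.1 * b z.2
  dx := fun z => f' z.1 * b z.2
  dy := fun z => f z.1 * b' z.2

/-- Smooth compactly supported approximations of a mode, compatible with the wall condition. -/
lemma exists_mode_approx {bc : WallCondition} {d : ℝ} (hd : 0 < d) {m : ℕ} (hm : 1 ≤ m) :
    ∃ b : ℕ → ℝ → ℂ, (∀ n, ContDiff ℝ ∞ (b n)) ∧ (∀ n, HasCompactSupport (b n)) ∧
      BddConv (Ioo (-d / 2) (d / 2)) b (cmode bc d m) ∧
      BddConv (Ioo (-d / 2) (d / 2)) (fun n => deriv (b n)) (deriv (cmode bc d m)) ∧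
      (bc = .dirichlet → ∀ n, tsupport (b n) ⊆ Ioo (-d / 2) (d / 2)) := by
  have hb := contDiff_cmode bc d m
  cases bc
  · obtain ⟨C, hC⟩ := exists_norm_cmode_le hd hm
    exact ⟨fun n y => cmode .dirichlet d m y * cut (wallDist d) n y,
      fun n => hb.mul (contDiff_cut (contDiff_wallDist d) n),
      fun n => (hasCompactSupport_cut_wallDist hd n).mul_left,
      bddConv_mul_cut_wallDist hd hb.continuous, bddConv_deriv_mul_cut_wallDist hd hb hC,
      fun _ n => tsupport_mul_subset_right.trans (tsupport_cut_wallDist_subset hd n)⟩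
  · obtain ⟨κ, hκ, hκs, hκ1⟩ := exists_plateau d
    have hw : ContDiff ℝ ∞ (fun y => cmode .neumann d m y * κ y) := hb.mul hκ
    have he : ∀ y ∈ Ioo (-d) d, cmode .neumann d m y * κ y = cmode .neumann d m y :=
      fun y hy => by rw [hκ1 y (abs_le.2 ⟨hy.1.le, hy.2.le⟩), mul_one]
    have hsub : Ioo (-d / 2) (d / 2) ⊆ Ioo (-d) d := Ioo_subset_Ioo (by linarith) (by linarith)
    refine ⟨fun _ y => cmode .neumann d m y * κ y, fun _ => hw, fun _ => hκs.mul_left,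
      (BddConv.const hw.continuous (exists_bound_Ioo hw.continuous d)).congr
        fun y hy => he y (hsub hy),
      (BddConv.const (hw.continuous_deriv (by simp))
        (exists_bound_Ioo (hw.continuous_deriv (by simp)) d)).congr fun y hy => ?_, by simp⟩
    refine Filter.EventuallyEq.deriv_eq ?_
    filter_upwards [isOpen_Ioo.mem_nhds (hsub hy)] with x hx using he x hx

/-- If `F n → f` boundedly with its derivatives, then `f(x) b_m(y)` is in the energy space. The `F n`
are smooth, `f` may have kinks. -/
lemma sepField_inEnergySpace {bc : WallCondition} {d R : ℝ} (hd : 0 < d) {m : ℕ} (hm : 1 ≤ m)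
    {f f' : ℝ → ℂ} {F : ℕ → ℝ → ℂ} (hF : ∀ n, ContDiff ℝ ∞ (F n))
    (hFs : ∀ n, HasCompactSupport (F n)) (hf : BddConv (Ioi 0) F f)
    (hf' : BddConv (Ioi 0) (fun n => deriv (F n)) f')
    (hR : ∀ x, R ≤ x → f x = 0 ∧ f' x = 0 ∧ ∀ n, F n x = 0 ∧ deriv (F n) x = 0) :
    InEnergySpace bc (channel d) (channelWalls d)
      (sepField f f' (cmode bc d m) (deriv (cmode bc d m))) := by
  obtain ⟨b, hb, hbs, cb, cb', hbd⟩ := exists_mode_approx (bc := bc) hd hm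
  have c0 := hf.sep cb
  have cx := hf'.sep cb
  have cy := hf.sep cb'
  have hv : ∀ Γ, (∀ n, Disjoint (univ ×ˢ tsupport (b n)) Γ) → VanishesOn (channel d) Γ
      (sepField f f' (cmode bc d m) (deriv (cmode bc d m))) := by
    intro Γ hΓ
    refine VanishesOn.of_seq (fun n z => F n z.1 * b n z.2)
      (fun n => IsTest.sep (hF n) (hFs n) (hb n) (hbs n))
      (fun n => (hΓ n).mono_left ((tsupport_sep_subset _ _).trans
        (prod_mono (subset_univ _) subset_rfl))) ?_ ?_ ?_
    · exact c0.tendsto_eLpNorm_channel (R := R)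
        (fun n z hz => by rw [((hR _ hz).2.2 n).1, zero_mul])
        (fun z hz => by rw [(hR _ hz).1, zero_mul])
    · simp_rw [fun n z => pdx_sep (hF n) (hb n) z]
      exact cx.tendsto_eLpNorm_channel (R := R)
        (fun n z hz => by rw [((hR _ hz).2.2 n).2, zero_mul])
        (fun z hz => by rw [(hR _ hz).2.1, zero_mul])
    · simp_rw [fun n z => pdy_sep (hF n) (hb n) z]
      exact cy.tendsto_eLpNorm_channel (R := R)
        (fun n z hz => by rw [((hR _ hz).2.2 n).1, zero_mul])
        (fun z hz => by rw [(hR _ hz).1, zero_mul])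
  refine ⟨(hv ∅ fun n => disjoint_empty _).isH1On ?_ ?_ ?_, fun h => hv _ fun n => ?_⟩
  · exact (memLp_channel_iff (R := R) fun z hz => by
      simp only [sepField]; rw [(hR _ hz).1, zero_mul]).2 (c0.locL2.memLp R)
  · exact (memLp_channel_iff (R := R) fun z hz => by
      simp only [sepField]; rw [(hR _ hz).2.1, zero_mul]).2 (cx.locL2.memLp R)
  · exact (memLp_channel_iff (R := R) fun z hz => by
      simp only [sepField]; rw [(hR _ hz).1, zero_mul]).2 (cy.locL2.memLp R)
  · rw [disjoint_left]
    rintro z ⟨-, hz⟩ ⟨-, hw⟩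
    have := hbd h n hz
    rcases hw with hw | hw
    · exact this.1.ne' hw
    · exact this.2.ne hw

/-- If moreover `F n` vanishes at `x = 0`, then `f(x) b_m(y)` has zero trace there. -/
lemma sepField_trace {bc : WallCondition} {d R : ℝ} (hd : 0 < d) {m : ℕ} (hm : 1 ≤ m)
    {f f' : ℝ → ℂ} {F : ℕ → ℝ → ℂ} (hF : ∀ n, ContDiff ℝ ∞ (F n))
    (hf : BddConv (Ioi 0) F f) (hf' : BddConv (Ioi 0) (fun n => deriv (F n)) f')
    (hR : ∀ x, R ≤ x → f x = 0 ∧ f' x = 0 ∧ ∀ n, F n x = 0 ∧ deriv (F n) x = 0)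
    (h0 : ∀ n, F n 0 = 0) :
    IsChannelTrace d (sepField f f' (cmode bc d m) (deriv (cmode bc d m))) 0 := by
  obtain ⟨b, hb, hbs, cb, -, -⟩ := exists_mode_approx (bc := bc) hd hm
  refine ⟨MemLp.zero, fun φ hφ _ => ?_⟩
  simp only [Pi.zero_apply, zero_mul, integral_zero, neg_zero]
  have l1 := (hφ.pdx.locL2 d).tendsto_integral_mul (R := R) (hf.sep cb)
    (fun n z hz => by rw [((hR _ hz).2.2 n).1, zero_mul])
    (fun z hz => by rw [(hR _ hz).1, zero_mul])
  have l2 := (hφ.locL2 d).tendsto_integral_mul (R := R) (hf'.sep cb)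
    (fun n z hz => by rw [((hR _ hz).2.2 n).2, zero_mul])
    (fun z hz => by rw [(hR _ hz).2.1, zero_mul])
  have i1 := (hφ.pdx.locL2 d).integrableOn_mul (R := R) (hf.sep cb).locL2
    (fun z hz => by rw [(hR _ hz).1, zero_mul])
  have i2 := (hφ.locL2 d).integrableOn_mul (R := R) (hf'.sep cb).locL2
    (fun z hz => by rw [(hR _ hz).2.1, zero_mul])
  have e : ∫ z in channel d, (sepField f f' (cmode bc d m) (deriv (cmode bc d m))).val z * pdx φ z +
      (sepField f f' (cmode bc d m) (deriv (cmode bc d m))).dx z * φ z =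
      (∫ z in channel d, pdx φ z * (f z.1 * cmode bc d m z.2)) +
        ∫ z in channel d, φ z * (f' z.1 * cmode bc d m z.2) := by
    rw [← integral_add i1 i2]
    simp only [sepField]
    congr 1
    ext z
    ring
  rw [e]
  refine tendsto_nhds_unique (l1.add l2) (tendsto_const_nhds.congr fun n => Eq.symm ?_)
  have hG : ContDiff ℝ ∞ (fun z : ℝ × ℝ => F n z.1 * b n z.2) :=
    (contDiff_comp_fst (hF n)).mul (contDiff_comp_snd (hb n))
  have key := (hφ.mul hG).integral_channel_pdx d
  have e2 : pdx (fun z => φ z * (F n z.1 * b n z.2)) = fun z =>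
      pdx φ z * (F n z.1 * b n z.2) + φ z * (deriv (F n) z.1 * b n z.2) := by
    ext z
    rw [pdx_mul (hφ.differentiable z) (hG.differentiable (by simp) z), pdx_sep (hF n) (hb n)]
  rw [e2] at key
  simp only [h0, zero_mul, mul_zero, integral_zero, neg_zero] at key
  rw [← key, integral_add]
  · exact (hφ.pdx.mul hG).integrable.integrableOn
  · have hG' : ContDiff ℝ ∞ (fun z : ℝ × ℝ => deriv (F n) z.1 * b n z.2) :=
      (contDiff_comp_fst (contDiff_infty_iff_deriv.1 (hF n)).2).mul (contDiff_comp_snd (hb n))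
    exact (hφ.mul hG').integrable.integrableOn

/-- Smooth approximations of the hat function `max (1 - x) 0` on `x > 0`. -/
lemma exists_hat_approx : ∃ r : ℕ → ℝ → ℂ, (∀ n, ContDiff ℝ ∞ (r n)) ∧
    (∀ n, HasCompactSupport (r n)) ∧ (∀ n, r n 0 = 1) ∧
    (∀ n x, 1 ≤ x → r n x = 0) ∧
    BddConv (Ioi 0) r (fun x => if x < 1 then ((1 - x : ℝ) : ℂ) else 0) ∧
    BddConv (Ioi 0) (fun n => deriv (r n)) (fun x => if x < 1 then -1 else 0) := by
  obtain ⟨κ, hκ, hκs, hκ1⟩ := exists_plateau 2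
  have hq : ContDiff ℝ ∞ (fun x : ℝ => 1 - x) := contDiff_const.sub contDiff_id
  have hw : ContDiff ℝ ∞ (fun x : ℝ => κ x * ((1 - x : ℝ) : ℂ)) :=
    hκ.mul (Complex.ofRealCLM.contDiff.comp hq)
  have he : ∀ x ∈ Ioo (-2 : ℝ) 2, κ x * ((1 - x : ℝ) : ℂ) = ((1 - x : ℝ) : ℂ) := fun x hx => by
    rw [hκ1 x (abs_le.2 ⟨hx.1.le, hx.2.le⟩), one_mul]
  have hd : ∀ x, HasDerivAt (fun x : ℝ => 1 - x) (-1) x := fun x => by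
    simpa using (hasDerivAt_id x).const_sub 1
  have he' : ∀ x ∈ Ioo (-2 : ℝ) 2, deriv (fun x : ℝ => κ x * ((1 - x : ℝ) : ℂ)) x = -1 := by
    intro x hx
    have : (fun x : ℝ => κ x * ((1 - x : ℝ) : ℂ)) =ᶠ[𝓝 x] fun x => ((1 - x : ℝ) : ℂ) := by
      filter_upwards [isOpen_Ioo.mem_nhds hx] with y hy using he y hy
    rw [this.deriv_eq, (hd x).ofReal_comp.deriv]
    simp
  have hmem : ∀ x ∈ Ioi (0 : ℝ), 0 < 1 - x → x ∈ Ioo (-2 : ℝ) 2 := fun x hx h =>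
    ⟨by linarith [mem_Ioi.1 hx], by linarith⟩
  have hn : ∀ x : ℝ, 0 < 1 - x → ‖((1 - x : ℝ) : ℂ)‖ = 1 - x := fun x h => by
    rw [Complex.norm_real, Real.norm_of_nonneg h.le]
  refine ⟨fun n x => κ x * ((1 - x : ℝ) : ℂ) * cut (fun x => 1 - x) n x,
    fun n => hw.mul (contDiff_cut hq n), fun n => hκs.mul_right.mul_right, fun n => ?_,
    fun n x hx => ?_, ?_, ?_⟩
  · change κ 0 * ((1 - 0 : ℝ) : ℂ) * cut (fun x => 1 - x) n 0 = 1
    rw [cut_eq_one (by simp), hκ1 0 (by simp)]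
    simp
  · change κ x * ((1 - x : ℝ) : ℂ) * cut (fun x => 1 - x) n x = 0
    rw [cut_eq_zero_of_nonpos (by linarith), mul_zero]
  · refine (bddConv_mul_cut (C := 1) hq hw.continuous fun x hx h => ?_).congr fun x hx => ?_
    · rw [he x (hmem x hx h), hn x h]
      linarith [mem_Ioi.1 hx]
    · simp only [sub_pos]
      split_ifs with h
      · exact he x (hmem x hx (by linarith))
      · rfl
  · refine (bddConv_deriv_mul_cut (C := 1) hq hw fun x hx h => ⟨?_, ?_, ?_⟩).congr fun x hx => ?_
    · rw [he x (hmem x hx h), hn x h, one_mul]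
    · rw [he' x (hmem x hx h)]; simp
    · rw [(hd x).deriv]; simp
    · simp only [sub_pos]
      split_ifs with h
      · exact he' x (hmem x hx (by linarith))
      · rfl

/-! ### The weak normal derivative of a solution, tested with modes -/

lemma integrableOn_form {k d R : ℝ} {F G : Field} (h0 : LocL2 d F.val) (hx : LocL2 d F.dx)
    (hy : LocL2 d F.dy) (g0 : LocL2 d G.val) (gx : LocL2 d G.dx) (gy : LocL2 d G.dy)
    (hR : ∀ z : ℝ × ℝ, R ≤ z.1 → G.val z = 0 ∧ G.dx z = 0 ∧ G.dy z = 0) :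
    IntegrableOn (fun z => F.dx z * G.dx z + F.dy z * G.dy z - (k : ℂ) ^ 2 * (F.val z * G.val z))
      (channel d) :=
  ((hx.integrableOn_mul gx fun z hz => (hR z hz).2.1).add
    (hy.integrableOn_mul gy fun z hz => (hR z hz).2.2)).sub
    ((h0.integrableOn_mul g0 fun z hz => (hR z hz).1).const_mul _)

lemma modeLift_eq (bc : WallCondition) (d : ℝ) (m : ℕ) : modeLift bc d m =
    sepField (fun x => if x < 1 then ((1 - x : ℝ) : ℂ) else 0) (fun x => if x < 1 then -1 else 0)
      (cmode bc d m) (deriv (cmode bc d m)) := by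
  simp only [modeLift, sepField, Field.mk.injEq]
  refine ⟨?_, ?_, ?_⟩ <;> ext z <;> split_ifs <;> simp [cmode, deriv_cmode]

lemma locL2_modeLift (bc : WallCondition) (d : ℝ) (m : ℕ) : LocL2 d (modeLift bc d m).val ∧
    LocL2 d (modeLift bc d m).dx ∧ LocL2 d (modeLift bc d m).dy := by
  obtain ⟨r, -, -, -, -, hr, hr'⟩ := exists_hat_approx
  have hb := (contDiff_cmode bc d m).continuous
  have hb' := (contDiff_deriv_cmode bc d m).continuous
  have c := BddConv.const hb (exists_bound_Ioo hb d)
  have c' := BddConv.const hb' (exists_bound_Ioo hb' d)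
  rw [modeLift_eq]
  exact ⟨(hr.sep c).locL2, (hr'.sep c).locL2, (hr.sep c').locL2⟩

lemma modeLift_zero (bc : WallCondition) (d : ℝ) (m : ℕ) {z : ℝ × ℝ} (hz : 1 ≤ z.1) :
    (modeLift bc d m).val z = 0 ∧ (modeLift bc d m).dx z = 0 ∧ (modeLift bc d m).dy z = 0 := by
  simp [modeLift, not_lt.2 hz]

/-- The flux through `x = 0` depends only on the trace of the test field: `modeLift` may be
replaced by any smooth lift of the mode. -/
lemma SolvesInPort.form_sep {bc : WallCondition} {k d : ℝ} (hd : 0 < d) {u : Field}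
    (hu : SolvesInPort bc k d u) {m : ℕ} (hm : 1 ≤ m) {g : ℝ → ℂ} (hg : ContDiff ℝ ∞ g)
    (hgs : HasCompactSupport g) :
    helmholtzForm k (channel d) u (sepField g (deriv g) (cmode bc d m) (deriv (cmode bc d m))) =
      -(g 0 * projDx bc k d m u) := by
  obtain ⟨r, hr, hrs, hr0, hr1, cr, cr'⟩ := exists_hat_approx
  obtain ⟨R, hR0, hR⟩ := exists_zero_of_hasCompactSupport hgs
  have hg' : Continuous (deriv g) := hg.continuous_deriv (by simp)
  have hb := (contDiff_cmode bc d m).continuous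
  have hb' := (contDiff_deriv_cmode bc d m).continuous
  obtain ⟨hu0, hux, huy⟩ := hu.1.locL2
  obtain ⟨l0, lx, ly⟩ := locL2_modeLift bc d m
  have c0 : BddConv (Ioi (0 : ℝ)) (fun _ _ => g 0) (fun _ => g 0) :=
    BddConv.const continuous_const ⟨‖g 0‖, fun _ _ => le_rfl⟩
  have hF : ∀ n, ContDiff ℝ ∞ (fun x => g x - g 0 * r n x) := fun n =>
    hg.sub (contDiff_const.mul (hr n))
  have hFd : ∀ n x, deriv (fun x => g x - g 0 * r n x) x = deriv g x - g 0 * deriv (r n) x :=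
    fun n x => ((hg.differentiable (by simp) x).hasDerivAt.sub
      (((hr n).differentiable (by simp) x).hasDerivAt.const_mul (g 0))).deriv
  have cF := (BddConv.const hg.continuous
    (exists_bound_of_hasCompactSupport hg.continuous hgs (Ioi 0))).sub (c0.mul cr)
  have cF' : BddConv (Ioi 0) (fun n => deriv (fun x => g x - g 0 * r n x))
      (fun x => deriv g x - g 0 * (if x < 1 then -1 else 0)) := by
    simp_rw [fun n => funext (hFd n)]
    exact (BddConv.const hg' (exists_bound_of_hasCompactSupport hg' hgs.deriv (Ioi 0))).sub
      (c0.mul cr')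
  have hr1' : ∀ n x, 2 ≤ x → deriv (r n) x = 0 := fun n x hx => by
    have : r n =ᶠ[𝓝 x] fun _ => 0 := by
      filter_upwards [Ioi_mem_nhds (by linarith : (1 : ℝ) < x)] with y hy
      exact hr1 n y (le_of_lt hy)
    rw [this.deriv_eq, deriv_const]
  have hzero : ∀ x, max R 2 ≤ x → g x - g 0 * (if x < 1 then ((1 - x : ℝ) : ℂ) else 0) = 0 ∧
      deriv g x - g 0 * (if x < 1 then -1 else 0) = 0 ∧
      ∀ n, g x - g 0 * r n x = 0 ∧ deriv (fun x => g x - g 0 * r n x) x = 0 := by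
    intro x hx
    obtain ⟨h1, h2⟩ := hR x ((le_max_left _ _).trans hx)
    have h3 : 2 ≤ x := (le_max_right _ _).trans hx
    have h4 : ¬ x < 1 := by linarith
    refine ⟨by simp [h1, h4], by simp [h2, h4], fun n => ⟨?_, ?_⟩⟩
    · rw [h1, hr1 n x (by linarith)]; ring
    · rw [hFd, h2, hr1' n x h3]; ring
  -- The difference of the two lifts has zero trace, hence is admissible in the weak equation.
  have hE := sepField_inEnergySpace (bc := bc) (m := m) hd hm hF
    (fun n => hgs.sub (hrs n).mul_left) cF cF' hzero
  have hT := sepField_trace (bc := bc) (m := m) hd hm hF cF cF' hzero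
    (fun n => by rw [hr0, mul_one, sub_self])
  have hz := hu.2 _ ⟨hE, max R 2, fun z hz => ⟨by
    simp only [sepField]; rw [(hzero _ hz).1, zero_mul], by
    simp only [sepField]; rw [(hzero _ hz).2.1, zero_mul], by
    simp only [sepField]; rw [(hzero _ hz).1, zero_mul]⟩⟩ hT
  have i1 := integrableOn_form (k := k) (R := R) hu0 hux huy
    (G := sepField g (deriv g) (cmode bc d m) (deriv (cmode bc d m)))
    (locL2_sep hg.continuous hgs hb) (locL2_sep hg' hgs.deriv hb) (locL2_sep hg.continuous hgs hb')
    (fun z hz => by simp [sepField, hR _ hz])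
  have i2 := integrableOn_form (k := k) (R := 1) hu0 hux huy l0 lx ly
    (fun z hz => modeLift_zero bc d m hz)
  rw [projDx, channelFlux, mul_neg, neg_neg, ← sub_eq_zero, ← hz]
  unfold helmholtzForm
  rw [← integral_const_mul, ← integral_sub i1 (i2.const_mul _), modeLift_eq]
  congr 1
  ext z
  simp only [sepField]
  ring

/-- The weak Helmholtz equation tested with a smooth multiple of a mode. -/
lemma SolvesInPort.integral_mode {bc : WallCondition} {k d : ℝ} (hk : 0 < k) (hd : 0 < d)
    {u : Field} (hu : SolvesInPort bc k d u) {m : ℕ} (hm : 1 ≤ m) {g : ℝ → ℂ}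
    (hg : ContDiff ℝ ∞ g) (hgs : HasCompactSupport g) :
    (∫ z in channel d, u.dx z * (deriv g z.1 * cmode bc d m z.2)) -
      beta bc k d m ^ 2 * (∫ z in channel d, u.val z * (g z.1 * cmode bc d m z.2)) =
      -(g 0 * projDx bc k d m u) := by
  obtain ⟨R, hR0, hR⟩ := exists_zero_of_hasCompactSupport hgs
  have hg' : Continuous (deriv g) := hg.continuous_deriv (by simp)
  have hb := (contDiff_cmode bc d m).continuous
  have hb' := (contDiff_deriv_cmode bc d m).continuous
  obtain ⟨hu0, hux, huy⟩ := hu.1.locL2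
  have i0 := hu0.integrableOn_mul (R := R) (locL2_sep hg.continuous hgs hb)
    fun z hz => by rw [(hR _ hz).1, zero_mul]
  have ix := hux.integrableOn_mul (R := R) (locL2_sep hg' hgs.deriv hb)
    fun z hz => by rw [(hR _ hz).2, zero_mul]
  have iy := huy.integrableOn_mul (R := R) (locL2_sep hg.continuous hgs hb')
    fun z hz => by rw [(hR _ hz).1, zero_mul]
  rw [← hu.form_sep hd hm hg hgs, beta_sq hk hd hm, sub_mul,
    ← hu.1.integral_dy_mode hd hm hg hgs]
  simp only [helmholtzForm, sepField]
  have e := integral_sub (ix.add iy) (i0.const_mul ((k : ℂ) ^ 2))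
  simp only [Pi.add_apply] at e
  rw [integral_add ix iy, integral_const_mul] at e
  rw [e]
  ring

/-! ### Outgoing mode coefficients -/

/-- A smooth compactly supported primitive on the half-line `x > 0`. -/
lemma exists_primitive {ψ : ℝ → ℝ} (hψ : ContDiff ℝ ∞ ψ) (hs : HasCompactSupport ψ) :
    ∃ h : ℝ → ℝ, ContDiff ℝ ∞ h ∧ HasCompactSupport h ∧ ∀ x, 0 < x → deriv h x = ψ x := by
  obtain ⟨R, hR⟩ := hs.isCompact.isBounded.subset_closedBall (0 : ℝ)
  have hz : ∀ x, |R| < x → ψ x = 0 := fun x hx => by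
    refine image_eq_zero_of_notMem_tsupport fun h => ?_
    have h1 := hR h
    rw [mem_closedBall_zero_iff, Real.norm_eq_abs] at h1
    linarith [le_abs_self x, le_abs_self R]
  let f : ContDiffBump (0 : ℝ) := ⟨|R| + 2, |R| + 3, by positivity, by linarith⟩
  let H : ℝ → ℝ := fun x => ∫ t in (|R| + 1)..x, ψ t
  have hH : ∀ x, HasDerivAt H (ψ x) x := fun x =>
    intervalIntegral.integral_hasDerivAt_right (hψ.continuous.intervalIntegrable _ _)
      (hψ.continuous.stronglyMeasurableAtFilter _ _) hψ.continuous.continuousAt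
  have hHs : ContDiff ℝ ∞ H := by
    rw [contDiff_infty_iff_deriv, funext fun x => (hH x).deriv]
    exact ⟨fun x => (hH x).differentiableAt, hψ⟩
  have hH0 : ∀ x, |R| + 1 ≤ x → H x = 0 := fun x hx =>
    intervalIntegral.integral_zero_ae (Eventually.of_forall fun t ht => hz t (by
      rw [uIoc_of_le hx] at ht
      linarith [ht.1]))
  refine ⟨fun x => f x * H x, f.contDiff.mul hHs, f.hasCompactSupport.mul_right, fun x hx => ?_⟩
  rcases lt_or_ge x (|R| + 2) with h | h
  · have : (fun x => f x * H x) =ᶠ[𝓝 x] H := by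
      filter_upwards [Ioo_mem_nhds hx h] with y hy
      rw [f.one_of_mem_closedBall, one_mul]
      rw [mem_closedBall_zero_iff, Real.norm_of_nonneg hy.1.le]
      exact hy.2.le
    rw [this.deriv_eq, (hH x).deriv]
  · have : (fun x => f x * H x) =ᶠ[𝓝 x] fun _ => 0 := by
      filter_upwards [Ioi_mem_nhds (by linarith : |R| + 1 < x)] with y hy
      rw [hH0 y (le_of_lt hy), mul_zero]
    rw [this.deriv_eq, deriv_const, hz x (by linarith)]

/-- A smooth decreasing longitudinal cutoff. -/
lemma exists_decreasing_cutoff : ∃ χ : ℝ → ℝ, ContDiff ℝ ∞ χ ∧ HasCompactSupport χ ∧ χ 0 = 1 ∧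
    (∀ x, 1 ≤ x → χ x = 0 ∧ deriv χ x = 0) ∧ ∀ x ∈ Ioo (0 : ℝ) 1, deriv χ x < 0 := by
  let f : ContDiffBump (1 / 2 : ℝ) := ⟨1 / 4, 1 / 2, by norm_num, by norm_num⟩
  set ρ := f.normed volume
  have hsupp : Function.support ρ = Ioo 0 1 := by
    rw [f.support_normed_eq, Real.ball_eq_Ioo]
    norm_num [f]
  obtain ⟨h, h1, h2, h3⟩ := exists_primitive (ψ := fun x => -ρ x) f.contDiff_normed.neg
    (f.hasCompactSupport_normed.comp_left (g := fun t => -t) neg_zero)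
  have hz : ∀ x, x ∉ Ioo (0 : ℝ) 1 → ρ x = 0 := fun x hx => by
    rw [← hsupp] at hx
    exact Function.notMem_support.1 hx
  have hint : ∀ a, 0 ≤ a → h a = ∫ x in Ioi a, ρ x := fun a ha => by
    rw [← neg_neg (h a), ← h2.integral_Ioi_deriv_eq (h1.of_le (by simp)) a, ← integral_neg]
    refine setIntegral_congr_fun measurableSet_Ioi fun x hx => ?_
    rw [h3 x (ha.trans_lt hx), neg_neg]
  refine ⟨h, h1, h2, ?_, fun x hx => ⟨?_, ?_⟩, fun x hx => ?_⟩
  · rw [hint 0 le_rfl, setIntegral_eq_integral_of_forall_compl_eq_zero, f.integral_normed]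
    exact fun x hx => hz x fun h' => hx h'.1
  · rw [hint x (by linarith)]
    exact setIntegral_eq_zero_of_forall_eq_zero fun y hy => hz y fun h' => by
      linarith [mem_Ioi.1 hy, h'.2]
  · rw [h3 x (by linarith), hz x fun h' => by linarith [h'.2], neg_zero]
  · rw [h3 x hx.1, neg_neg_iff_pos]
    refine lt_of_le_of_ne (f.nonneg_normed x) fun h' => ?_
    rw [← hsupp] at hx
    exact hx h'.symm

/-- Fubini for a locally square integrable function against a separated one. -/
lemma LocL2.integral_sep {d R : ℝ} {f : ℝ × ℝ → ℂ} (hf : LocL2 d f) {g b : ℝ → ℂ}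
    (hg : LocL2 d fun z => g z.1 * b z.2) (h0 : ∀ x, R ≤ x → g x = 0) :
    ∫ z in channel d, f z * (g z.1 * b z.2) =
      ∫ x in Ioi 0, g x * ∫ y in Ioo (-d / 2) (d / 2), b y * f (x, y) := by
  have hi := hf.integrableOn_mul (R := R) hg fun z hz => by rw [h0 _ hz, zero_mul]
  rw [channel, Measure.volume_eq_prod] at hi ⊢
  rw [setIntegral_prod _ hi]
  congr 1
  ext x
  rw [← integral_const_mul]
  congr 1
  ext y
  ring

lemma LocL2.integrableOn_slice {d : ℝ} {f : ℝ × ℝ → ℂ} (hf : LocL2 d f) {b : ℝ → ℂ}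
    (hb : Continuous b) (R : ℝ) :
    IntegrableOn (fun x => ∫ y in Ioo (-d / 2) (d / 2), b y * f (x, y)) (Ioo 0 R) := by
  have c := BddConv.const hb (exists_bound_Ioo hb d)
  have hl : LocL2 d (fun z => b z.2) := (c.snd (Ioi (0 : ℝ))).locL2
  have hi : Integrable (fun z => b z.2 * f z) (volume.restrict (channelTrunc d R)) :=
    (hl.memLp R).integrable_mul (hf.memLp R)
  rw [channelTrunc, Measure.volume_eq_prod, ← Measure.prod_restrict] at hi
  exact hi.integral_prod_left

/-- For an outgoing solution the `m`-th coefficient `a` satisfies `a' = i β a` almost everywhere: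
testing the trace formula and the equation with `e^{iβx} h(x) b_m(y)` gives
`∫ (a' - i β a) e^{iβx} h' = 0` for every `h`, without boundary term at `x = 0`. -/
lemma SolvesInPort.ae_mode_coeff {bc : WallCondition} {k d : ℝ} (hk : 0 < k) (hd : 0 < d)
    {u : Field} (hu : SolvesInPort bc k d u) {m : ℕ} (hm : 1 ≤ m) {τ : ℝ → ℂ}
    (hτ : IsChannelTrace d u τ)
    (hout : projDx bc k d m u = Complex.I * beta bc k d m *
      ∫ y in Ioo (-d / 2) (d / 2), cmode bc d m y * τ y) :
    ∀ᵐ x, x ∈ Ioi (0 : ℝ) → ∫ y in Ioo (-d / 2) (d / 2), cmode bc d m y *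
      (u.dx (x, y) - Complex.I * beta bc k d m * u.val (x, y)) = 0 := by
  set l := Complex.I * beta bc k d m with hl
  have hl2 : beta bc k d m ^ 2 = -l ^ 2 := by rw [hl, mul_pow, Complex.I_sq]; ring
  obtain ⟨hu0, hux, -⟩ := hu.1.locL2
  have hb := (contDiff_cmode bc d m).continuous
  have hw : LocL2 d (fun z => u.dx z - l * u.val z) :=
    hux.sub fun R hR => (hu0 R hR).const_mul l
  have hexp : ContDiff ℝ ∞ (fun x : ℝ => Complex.exp (l * x)) :=
    (contDiff_const.mul Complex.ofRealCLM.contDiff).cexp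
  have hexpd : ∀ x : ℝ, HasDerivAt (fun x : ℝ => Complex.exp (l * x)) (Complex.exp (l * x) * l) x :=
    fun x => by simpa using (((hasDerivAt_id x).ofReal_comp).const_mul l).cexp
  have key := isOpen_Ioi.ae_eq_zero_of_integral_contDiff_smul_eq_zero (μ := volume)
    (U := Ioi (0 : ℝ)) (f := fun x : ℝ => Complex.exp (l * x) *
      ∫ y in Ioo (-d / 2) (d / 2), cmode bc d m y * (u.dx (x, y) - l * u.val (x, y))) ?_ ?_
  · filter_upwards [key] with x hx hx0
    exact (mul_eq_zero.1 (hx hx0)).resolve_left (Complex.exp_ne_zero _)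
  · have h1 : LocallyIntegrableOn (fun x : ℝ =>
        ∫ y in Ioo (-d / 2) (d / 2), cmode bc d m y * (u.dx (x, y) - l * u.val (x, y)))
        (Ioi 0) := fun x hx => ⟨Ioo 0 (x + 1),
      mem_nhdsWithin_of_mem_nhds (Ioo_mem_nhds hx (lt_add_one x)), hw.integrableOn_slice hb _⟩
    exact h1.continuousOn_mul hexp.continuous.continuousOn isOpen_Ioi.isLocallyClosed
  · intro ψ hψ hψs hsub
    obtain ⟨h, h1, h2, h3⟩ := exists_primitive hψ hψs
    -- The weight `e^{iβx}` is chosen so that `g' - iβ g = e^{iβx} h'`.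
    set g : ℝ → ℂ := fun x => (h x : ℂ) * Complex.exp (l * x) with hg_def
    have h1' : ContDiff ℝ ∞ (fun x => (h x : ℂ)) := Complex.ofRealCLM.contDiff.comp h1
    have hg : ContDiff ℝ ∞ g := h1'.mul hexp
    have hgs : HasCompactSupport g :=
      HasCompactSupport.mul_right (h2.comp_left (g := ((↑) : ℝ → ℂ)) Complex.ofReal_zero)
    have hg' : Continuous (deriv g) := hg.continuous_deriv (by simp)
    obtain ⟨R, hR0, hR⟩ := exists_zero_of_hasCompactSupport hgs
    have hgd : ∀ x, 0 < x → deriv g x - l * g x = ψ x * Complex.exp (l * x) := fun x hx => by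
      have := (((h1.differentiable (by simp) x).hasDerivAt.ofReal_comp).mul (hexpd x)).deriv
      rw [h3 x hx] at this
      change deriv g x = _ at this
      rw [this, hg_def]
      ring
    have hG : Continuous (fun x => deriv g x - l * g x) :=
      hg'.sub (continuous_const.mul hg.continuous)
    have hGs : HasCompactSupport (fun x => deriv g x - l * g x) := hgs.deriv.sub hgs.mul_left
    have e1 : ∫ x, ψ x • (Complex.exp (l * x) * ∫ y in Ioo (-d / 2) (d / 2),
        cmode bc d m y * (u.dx (x, y) - l * u.val (x, y))) =
        ∫ z in channel d, (u.dx z - l * u.val z) *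
          ((deriv g z.1 - l * g z.1) * cmode bc d m z.2) := by
      rw [hw.integral_sep (R := R) (locL2_sep (b := cmode bc d m) hG hGs hb)
        (fun x hx => by rw [(hR x hx).1, (hR x hx).2]; ring)]
      rw [← setIntegral_eq_integral_of_forall_compl_eq_zero (s := Ioi (0 : ℝ))]
      · refine setIntegral_congr_fun measurableSet_Ioi fun x hx => ?_
        rw [hgd x hx, Complex.real_smul]
        ring
      · intro x hx
        rw [image_eq_zero_of_notMem_tsupport fun h => hx (hsub h), zero_smul]
    rw [e1]
    have zR : ∀ z : ℝ × ℝ, R ≤ z.1 → g z.1 * cmode bc d m z.2 = 0 := fun z hz => by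
      rw [(hR _ hz).1, zero_mul]
    have zR' : ∀ z : ℝ × ℝ, R ≤ z.1 → deriv g z.1 * cmode bc d m z.2 = 0 := fun z hz => by
      rw [(hR _ hz).2, zero_mul]
    have L := locL2_sep (d := d) hg.continuous hgs hb
    have L' := locL2_sep (d := d) hg' hgs.deriv hb
    have i1 := hux.integrableOn_mul L' zR'
    have i2 := hu0.integrableOn_mul L zR
    have i3 := hu0.integrableOn_mul L' zR'
    have i4 := hux.integrableOn_mul L zR
    have e2 : ∫ z in channel d, (u.dx z - l * u.val z) *
          ((deriv g z.1 - l * g z.1) * cmode bc d m z.2) =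
        ((∫ z in channel d, u.dx z * (deriv g z.1 * cmode bc d m z.2)) +
          l ^ 2 * ∫ z in channel d, u.val z * (g z.1 * cmode bc d m z.2)) -
        l * ((∫ z in channel d, u.val z * (deriv g z.1 * cmode bc d m z.2)) +
          ∫ z in channel d, u.dx z * (g z.1 * cmode bc d m z.2)) := by
      rw [← integral_add i3 i4, ← integral_const_mul, ← integral_const_mul,
        ← integral_add i1 (i2.const_mul _)]
      have := integral_sub (i1.add (i2.const_mul (l ^ 2))) ((i3.add i4).const_mul l)
      simp only [Pi.add_apply] at this
      rw [← this]
      congr 1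
      ext z
      ring
    -- The outgoing condition makes the boundary terms `g(0) ∫ b τ` of both formulas cancel.
    rw [e2, hτ.integral_mode hd hu.1 m hg hgs]
    have F := hu.integral_mode hk hd hm hg hgs
    rw [hl2, hout] at F
    linear_combination F

/-! ### Parseval's identity for the transverse modes -/

/-- The sign under reflection in a wall: odd extension for Dirichlet, even for Neumann. -/
def wallSign (bc : WallCondition) : ℂ :=
  match bc with
  | .dirichlet => -1
  | .neumann => 1

/-- The extension of a function on the cross-section to `(-d, d)`, odd or even with respect to
the wall `y = -d / 2`, which is moved to `t = 0`. -/
noncomputable def reflectExt (bc : WallCondition) (d : ℝ) (f : ℝ → ℂ) (t : ℝ) : ℂ :=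
  (Ioi 0).piecewise (fun t => f (t - d / 2)) (fun t => wallSign bc * f (-d / 2 - t)) t

/-- The combination of exponentials that arises from the Fourier kernel by reflection. -/
noncomputable def reflectKernel (bc : WallCondition) (d : ℝ) (n : ℤ) (y : ℝ) : ℂ :=
  Complex.exp (-(Real.pi * n / d * (y + d / 2) : ℝ) * Complex.I) +
    wallSign bc * Complex.exp ((Real.pi * n / d * (y + d / 2) : ℝ) * Complex.I)

lemma reflectKernel_dirichlet (d : ℝ) (n : ℤ) (y : ℝ) : reflectKernel .dirichlet d n y =
    -2 * Complex.I * (Real.sin (Real.pi * n / d * (y + d / 2)) : ℝ) := by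
  rw [reflectKernel, Complex.ofReal_sin, Complex.sin, wallSign]
  linear_combination (Complex.exp (-(Real.pi * n / d * (y + d / 2) : ℝ) * Complex.I) -
    Complex.exp ((Real.pi * n / d * (y + d / 2) : ℝ) * Complex.I)) * Complex.I_sq

lemma reflectKernel_neumann (d : ℝ) (n : ℤ) (y : ℝ) : reflectKernel .neumann d n y =
    2 * (Real.cos (Real.pi * n / d * (y + d / 2)) : ℝ) := by
  rw [reflectKernel, Complex.ofReal_cos, Complex.cos, wallSign]
  ring

/-- The index of the mode with transverse frequency `j π / d`; for Dirichlet walls `j = 0` gives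
the zero function. -/
def modeIndex (bc : WallCondition) (j : ℕ) : ℕ :=
  match bc with
  | .dirichlet => j
  | .neumann => j + 1

lemma reflectKernel_natCast {bc : WallCondition} {d : ℝ} (hd : 0 < d) (j : ℕ) :
    ∃ K : ℂ, K ≠ 0 ∧ ∀ y, reflectKernel bc d j y = K * cmode bc d (modeIndex bc j) y := by
  have cancel : ∀ {A : ℂ} (x c : ℂ), A ≠ 0 → x / A * (A * c) = x * c := fun x c hA => by
    field_simp
  cases bc
  · have hA : (Real.sqrt (2 / d) : ℂ) ≠ 0 := by
      rw [Complex.ofReal_ne_zero]; positivity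
    refine ⟨-2 * Complex.I / Real.sqrt (2 / d),
      div_ne_zero (mul_ne_zero (by norm_num) Complex.I_ne_zero) hA, fun y => ?_⟩
    have e : transverse .dirichlet d j * (y + d / 2) =
        Real.pi * ((j : ℤ) : ℝ) / d * (y + d / 2) := by
      simp only [transverse, Int.cast_natCast]; ring
    rw [reflectKernel_dirichlet, cmode, modeIndex, mode, e, Complex.ofReal_mul, cancel _ _ hA]
  · have h2 : (0 : ℝ) < 2 - (if j + 1 = 1 then 1 else 0) := by split_ifs <;> norm_num
    have hA : (Real.sqrt ((2 - (if j + 1 = 1 then 1 else 0)) / d) : ℂ) ≠ 0 := by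
      rw [Complex.ofReal_ne_zero]; positivity
    refine ⟨2 / Real.sqrt ((2 - (if j + 1 = 1 then 1 else 0)) / d), div_ne_zero two_ne_zero hA,
      fun y => ?_⟩
    have e : transverse .neumann d (j + 1) * (y + d / 2) =
        Real.pi * ((j : ℤ) : ℝ) / d * (y + d / 2) := by
      simp only [transverse, Int.cast_natCast]; push_cast; ring
    rw [reflectKernel_neumann, cmode, modeIndex, mode, e, Complex.ofReal_mul, cancel _ _ hA]

lemma reflectKernel_neg (bc : WallCondition) (d : ℝ) (n : ℤ) (y : ℝ) :
    reflectKernel bc d (-n) y = wallSign bc * reflectKernel bc d n y := by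
  cases bc
  · rw [reflectKernel_dirichlet, reflectKernel_dirichlet, wallSign]
    push_cast
    rw [show (Real.pi * -n / d * (y + d / 2) : ℂ) = -(Real.pi * n / d * (y + d / 2)) by ring,
      Complex.sin_neg]
    ring
  · rw [reflectKernel_neumann, reflectKernel_neumann, wallSign]
    push_cast
    rw [show (Real.pi * -n / d * (y + d / 2) : ℂ) = -(Real.pi * n / d * (y + d / 2)) by ring,
      Complex.cos_neg]
    ring

lemma exists_reflectKernel_natCast {bc : WallCondition} {d : ℝ} (hd : 0 < d) {m : ℕ}
    (hm : 1 ≤ m) :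
    ∃ (n : ℕ) (K : ℂ), K ≠ 0 ∧ ∀ y, reflectKernel bc d n y = K * cmode bc d m y := by
  cases bc
  · exact ⟨m, reflectKernel_natCast hd m⟩
  · obtain ⟨j, rfl⟩ := Nat.exists_eq_add_of_le' hm
    exact ⟨j, reflectKernel_natCast hd j⟩

lemma reflectKernel_eq_mode {bc : WallCondition} {d : ℝ} (hd : 0 < d) (n : ℤ) :
    ∃ (m : ℕ) (K : ℂ), 1 ≤ m ∧ ∀ y, reflectKernel bc d n y = K * cmode bc d m y := by
  have hnat : ∀ j : ℕ, ∃ (m : ℕ) (K : ℂ), 1 ≤ m ∧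
      ∀ y, reflectKernel bc d j y = K * cmode bc d m y := by
    intro j
    obtain ⟨K, -, hK⟩ := reflectKernel_natCast (bc := bc) hd j
    cases bc
    · rcases Nat.eq_zero_or_pos j with rfl | hj
      · exact ⟨1, 0, le_rfl, fun y => by rw [reflectKernel_dirichlet]; simp⟩
      · exact ⟨j, K, hj, hK⟩
    · exact ⟨j + 1, K, by simp, hK⟩
  obtain ⟨j, rfl | rfl⟩ := n.eq_nat_or_neg
  · exact hnat j
  · obtain ⟨m, K, hm, h⟩ := hnat j
    exact ⟨m, wallSign bc * K, hm, fun y => by rw [reflectKernel_neg, h, mul_assoc]⟩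

lemma memLp_reflectExt {bc : WallCondition} {d : ℝ} (hd : 0 < d) {f : ℝ → ℂ}
    (hf : MemLp f 2 (volume.restrict (Ioo (-d / 2) (d / 2)))) :
    MemLp (reflectExt bc d f) 2 (volume.restrict (Ioc (-d) d)) := by
  have h1 := hf.comp_measurePreserving ((measurePreserving_sub_right volume (d / 2)).restrict_preimage
    (measurableSet_Ioo (a := -d / 2) (b := d / 2)))
  have h2 := hf.comp_measurePreserving ((Measure.measurePreserving_sub_left volume (-d / 2)).restrict_preimage
    (measurableSet_Ioo (a := -d / 2) (b := d / 2)))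
  rw [show (fun x => x - d / 2) ⁻¹' Ioo (-d / 2) (d / 2) = Ioo 0 d by
    ext x; simp only [mem_preimage, mem_Ioo]
    constructor <;> rintro ⟨h1, h2⟩ <;> constructor <;> linarith] at h1
  rw [show (fun x => -d / 2 - x) ⁻¹' Ioo (-d / 2) (d / 2) = Ioo (-d) 0 by
    ext x; simp only [mem_preimage, mem_Ioo]
    constructor <;> rintro ⟨h1, h2⟩ <;> constructor <;> linarith] at h2
  refine MemLp.piecewise measurableSet_Ioi ?_ ?_
  · rw [Measure.restrict_restrict measurableSet_Ioi,
      show Ioi (0 : ℝ) ∩ Ioc (-d) d = Ioc 0 d by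
        ext x; simp only [mem_inter_iff, mem_Ioi, mem_Ioc]
        constructor
        · rintro ⟨h1, h2⟩; exact ⟨h1, h2.2⟩
        · rintro ⟨h1, h2⟩; exact ⟨h1, by linarith, h2⟩,
      ← restrict_Ioo_eq_restrict_Ioc]
    exact h1
  · rw [Measure.restrict_restrict measurableSet_Ioi.compl,
      show (Ioi (0 : ℝ))ᶜ ∩ Ioc (-d) d = Ioc (-d) 0 by
        ext x; simp only [mem_inter_iff, mem_compl_iff, mem_Ioi, mem_Ioc, not_lt]
        constructor
        · rintro ⟨h1, h2⟩; exact ⟨h2.1, h1⟩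
        · rintro ⟨h1, h2⟩; exact ⟨h2, h1, by linarith⟩,
      ← restrict_Ioo_eq_restrict_Ioc]
    exact h2.const_mul _

/-- Folding an integral over `(-d, d)` onto the cross-section. -/
lemma integral_reflect {E : Type*} [NormedAddCommGroup E] [NormedSpace ℝ E] {d : ℝ} (hd : 0 < d)
    {Φ : ℝ → E} (hΦ : IntegrableOn Φ (Ioc (-d) d)) :
    ∫ t in (-d)..d, Φ t = (∫ y in Ioo (-d / 2) (d / 2), Φ (y + d / 2)) +
      ∫ y in Ioo (-d / 2) (d / 2), Φ (-d / 2 - y) := by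
  have h1 : IntervalIntegrable Φ volume (-d) 0 :=
    (intervalIntegrable_iff_integrableOn_Ioc_of_le (by linarith)).2
      (hΦ.mono_set (Ioc_subset_Ioc_right hd.le))
  have h2 : IntervalIntegrable Φ volume 0 d :=
    (intervalIntegrable_iff_integrableOn_Ioc_of_le hd.le).2
      (hΦ.mono_set (Ioc_subset_Ioc_left (by linarith)))
  rw [← intervalIntegral.integral_add_adjacent_intervals h1 h2, add_comm,
    ← integral_Ioc_eq_integral_Ioo, ← integral_Ioc_eq_integral_Ioo,
    ← intervalIntegral.integral_of_le (by linarith), ← intervalIntegral.integral_of_le (by linarith),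
    intervalIntegral.integral_comp_add_right, intervalIntegral.integral_comp_sub_left]
  congr 2 <;> ring

lemma reflectExt_right (bc : WallCondition) {d : ℝ} (f : ℝ → ℂ) {y : ℝ}
    (hy : y ∈ Ioo (-d / 2) (d / 2)) : reflectExt bc d f (y + d / 2) = f y := by
  rw [reflectExt, piecewise_eq_of_mem _ _ _ (mem_Ioi.2 (by linarith [hy.1])), add_sub_cancel_right]

lemma reflectExt_left (bc : WallCondition) {d : ℝ} (f : ℝ → ℂ) {y : ℝ}
    (hy : y ∈ Ioo (-d / 2) (d / 2)) :
    reflectExt bc d f (-d / 2 - y) = wallSign bc * f y := by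
  rw [reflectExt, piecewise_eq_of_notMem _ _ _ (by rw [mem_Ioi]; linarith [hy.1]), sub_sub_cancel]

/-- Folding `(-d, d)` onto the cross-section turns Fourier coefficients of the extension into
mode coefficients. -/
lemma fourierCoeffOn_reflectExt {bc : WallCondition} {d : ℝ} (hd : 0 < d) (hdd : -d < d)
    {f : ℝ → ℂ} (hf : MemLp f 2 (volume.restrict (Ioo (-d / 2) (d / 2)))) (n : ℤ) :
    fourierCoeffOn hdd (reflectExt bc d f) n =
      1 / (2 * d) * ∫ y in Ioo (-d / 2) (d / 2), reflectKernel bc d n y * f y := by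
  have hE := memLp_reflectExt (bc := bc) hd hf
  have hfi : IntegrableOn f (Ioo (-d / 2) (d / 2)) := hf.integrable one_le_two
  have hEi : IntegrableOn (reflectExt bc d f) (Ioc (-d) d) := hE.integrable one_le_two
  have hexp : ∀ t : ℝ, fourier (-n) (t : AddCircle (d - -d)) =
      Complex.exp (-(Real.pi * n / d * t : ℝ) * Complex.I) := fun t => by
    rw [fourier_coe_apply]
    congr 1
    push_cast
    have : (d : ℂ) ≠ 0 := by exact_mod_cast hd.ne'
    rw [sub_neg_eq_add, ← two_mul]
    field_simp
  have hnorm : ∀ t : ℝ, ‖Complex.exp (-(Real.pi * n / d * t : ℝ) * Complex.I)‖ = 1 := fun t => by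
    rw [← Complex.ofReal_neg, Complex.norm_exp_ofReal_mul_I]
  have hcont : Continuous (fun t : ℝ => Complex.exp (-(Real.pi * n / d * t : ℝ) * Complex.I)) := by
    fun_prop
  have hi : IntegrableOn (fun t : ℝ => Complex.exp (-(Real.pi * n / d * t : ℝ) * Complex.I) *
      reflectExt bc d f t) (Ioc (-d) d) :=
    hEi.bdd_mul (c := 1) hcont.aestronglyMeasurable (Eventually.of_forall fun t => (hnorm t).le)
  rw [fourierCoeffOn_eq_integral]
  simp_rw [hexp, smul_eq_mul]
  rw [integral_reflect hd hi, ← integral_add, Complex.real_smul]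
  · congr 1
    · push_cast; ring
    · refine setIntegral_congr_fun measurableSet_Ioo fun y hy => ?_
      rw [reflectExt_right bc f hy, reflectExt_left bc f hy, reflectKernel,
        show (-(Real.pi * n / d * (-d / 2 - y) : ℝ) : ℂ) = (Real.pi * n / d * (y + d / 2) : ℝ) by
          push_cast; ring]
      ring
  · refine Integrable.congr (f := fun y => Complex.exp (-(Real.pi * n / d * (y + d / 2) : ℝ) *
      Complex.I) * f y) ?_ ?_
    · exact hfi.bdd_mul (c := 1) (by fun_prop) (Eventually.of_forall fun t => (hnorm _).le)
    · filter_upwards [ae_restrict_mem measurableSet_Ioo] with y hy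
      rw [reflectExt_right bc f hy]
  · refine Integrable.congr (f := fun y => Complex.exp (-(Real.pi * n / d * (-d / 2 - y) : ℝ) *
      Complex.I) * (wallSign bc * f y)) ?_ ?_
    · exact (hfi.const_mul _).bdd_mul (c := 1) (by fun_prop)
        (Eventually.of_forall fun t => (hnorm _).le)
    · filter_upwards [ae_restrict_mem measurableSet_Ioo] with y hy
      rw [reflectExt_left bc f hy]

/-- Parseval's identity, over the integer frequencies of the reflected functions. -/
lemma hasSum_sq_reflectKernel {bc : WallCondition} {d : ℝ} (hd : 0 < d) {f : ℝ → ℂ}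
    (hf : MemLp f 2 (volume.restrict (Ioo (-d / 2) (d / 2)))) :
    HasSum (fun n : ℤ => ‖1 / (2 * d) * ∫ y in Ioo (-d / 2) (d / 2), reflectKernel bc d n y * f y‖ ^ 2)
      (d⁻¹ * ∫ y in Ioo (-d / 2) (d / 2), ‖f y‖ ^ 2) := by
  have hdd : -d < d := by linarith
  have hE := memLp_reflectExt (bc := bc) hd hf
  have h := hasSum_sq_fourierCoeffOn hdd hE
  simp_rw [fourierCoeffOn_reflectExt hd hdd hf] at h
  have hi : IntegrableOn (fun t => ‖reflectExt bc d f t‖ ^ 2) (Ioc (-d) d) :=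
    (memLp_two_iff_integrable_sq_norm hE.1).1 hE
  have e1 : ∫ y in Ioo (-d / 2) (d / 2), ‖reflectExt bc d f (y + d / 2)‖ ^ 2 =
      ∫ y in Ioo (-d / 2) (d / 2), ‖f y‖ ^ 2 :=
    setIntegral_congr_fun measurableSet_Ioo fun y hy => by
      simp only [reflectExt_right bc f hy]
  have e2 : ∫ y in Ioo (-d / 2) (d / 2), ‖reflectExt bc d f (-d / 2 - y)‖ ^ 2 =
      ∫ y in Ioo (-d / 2) (d / 2), ‖f y‖ ^ 2 :=
    setIntegral_congr_fun measurableSet_Ioo fun y hy => by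
      simp only [reflectExt_left bc f hy]
      cases bc <;> simp [wallSign]
  rw [integral_reflect hd hi, e1, e2, smul_eq_mul] at h
  convert h using 1
  field_simp
  ring

/-- Polarization: it deduces the imaginary part of an inner product from squared norms. -/
lemma normSq_polarization (a b : ℂ) :
    ‖a + Complex.I * b‖ ^ 2 - ‖a‖ ^ 2 - ‖b‖ ^ 2 = 2 * (a * (starRingEnd ℂ) b).im := by
  rw [← Complex.normSq_eq_norm_sq, ← Complex.normSq_eq_norm_sq, ← Complex.normSq_eq_norm_sq,
    Complex.normSq_apply, Complex.normSq_apply, Complex.normSq_apply]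
  simp
  ring

/-- If every mode contributes a nonnegative amount to `Im ∫ f conj(g)`, then this quantity is
nonnegative, and it vanishes only if every contribution does. -/
lemma im_integral_mul_conj_nonneg {bc : WallCondition} {d : ℝ} (hd : 0 < d) {f g : ℝ → ℂ}
    (hf : MemLp f 2 (volume.restrict (Ioo (-d / 2) (d / 2))))
    (hg : MemLp g 2 (volume.restrict (Ioo (-d / 2) (d / 2))))
    (h : ∀ m, 1 ≤ m → 0 ≤ ((∫ y in Ioo (-d / 2) (d / 2), cmode bc d m y * f y) *
      (starRingEnd ℂ) (∫ y in Ioo (-d / 2) (d / 2), cmode bc d m y * g y)).im) :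
    0 ≤ (∫ y in Ioo (-d / 2) (d / 2), f y * (starRingEnd ℂ) (g y)).im ∧
    ((∫ y in Ioo (-d / 2) (d / 2), f y * (starRingEnd ℂ) (g y)).im = 0 →
      ∀ m, 1 ≤ m → ((∫ y in Ioo (-d / 2) (d / 2), cmode bc d m y * f y) *
        (starRingEnd ℂ) (∫ y in Ioo (-d / 2) (d / 2), cmode bc d m y * g y)).im = 0) := by
  have hfg : MemLp (fun y => f y + Complex.I * g y) 2 (volume.restrict (Ioo (-d / 2) (d / 2))) :=
    hf.add (hg.const_mul _)
  -- Fourier coefficients of the extensions of `f` and `g`.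
  set a : ℤ → ℂ := fun n => 1 / (2 * d) * ∫ y in Ioo (-d / 2) (d / 2), reflectKernel bc d n y * f y
  set b : ℤ → ℂ := fun n => 1 / (2 * d) * ∫ y in Ioo (-d / 2) (d / 2), reflectKernel bc d n y * g y
  have hK : ∀ n, ∀ {f : ℝ → ℂ}, MemLp f 2 (volume.restrict (Ioo (-d / 2) (d / 2))) →
      IntegrableOn (fun y => reflectKernel bc d n y * f y) (Ioo (-d / 2) (d / 2)) := by
    intro n f hf
    obtain ⟨m, K, -, hKm⟩ := reflectKernel_eq_mode (bc := bc) hd n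
    obtain ⟨C, hC⟩ := exists_bound_Ioo (contDiff_cmode bc d m).continuous d
    simp_rw [hKm, mul_assoc]
    refine Integrable.const_mul (Integrable.bdd_mul (hf.integrable one_le_two) (c := C)
      (contDiff_cmode bc d m).continuous.aestronglyMeasurable ?_) K
    filter_upwards [ae_restrict_mem measurableSet_Ioo] with y hy using hC y hy
  have hab : ∀ n, 1 / (2 * d) * ∫ y in Ioo (-d / 2) (d / 2),
      reflectKernel bc d n y * (f y + Complex.I * g y) = a n + Complex.I * b n := by
    intro n
    have e : ∫ y in Ioo (-d / 2) (d / 2), reflectKernel bc d n y * (f y + Complex.I * g y) =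
        (∫ y in Ioo (-d / 2) (d / 2), reflectKernel bc d n y * f y) +
          Complex.I * ∫ y in Ioo (-d / 2) (d / 2), reflectKernel bc d n y * g y := by
      rw [← integral_const_mul, ← integral_add (hK n hf) ((hK n hg).const_mul _)]
      congr 1
      ext y
      ring
    rw [e]
    simp only [a, b]
    ring
  have hs := ((hasSum_sq_reflectKernel (bc := bc) hd hfg).sub (hasSum_sq_reflectKernel (bc := bc) hd hf)).sub
    (hasSum_sq_reflectKernel (bc := bc) hd hg)
  simp_rw [hab] at hs
  change HasSum (fun n => ‖a n + Complex.I * b n‖ ^ 2 - ‖a n‖ ^ 2 - ‖b n‖ ^ 2) _ at hs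
  simp_rw [normSq_polarization] at hs
  have hsq : ∀ {f : ℝ → ℂ}, MemLp f 2 (volume.restrict (Ioo (-d / 2) (d / 2))) →
      IntegrableOn (fun y => ‖f y‖ ^ 2) (Ioo (-d / 2) (d / 2)) :=
    fun hf => (memLp_two_iff_integrable_sq_norm hf.1).1 hf
  have hgc : MemLp (fun y => (starRingEnd ℂ) (g y)) 2 (volume.restrict (Ioo (-d / 2) (d / 2))) :=
    hg.star
  have hint : Integrable (fun y => f y * (starRingEnd ℂ) (g y))
      (volume.restrict (Ioo (-d / 2) (d / 2))) := hf.integrable_mul hgc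
  have eI : d⁻¹ * (∫ y in Ioo (-d / 2) (d / 2), ‖f y + Complex.I * g y‖ ^ 2) -
      d⁻¹ * (∫ y in Ioo (-d / 2) (d / 2), ‖f y‖ ^ 2) -
      d⁻¹ * (∫ y in Ioo (-d / 2) (d / 2), ‖g y‖ ^ 2) =
      d⁻¹ * (2 * (∫ y in Ioo (-d / 2) (d / 2), f y * (starRingEnd ℂ) (g y)).im) := by
    have e1 : (∫ y in Ioo (-d / 2) (d / 2), f y * (starRingEnd ℂ) (g y)).im =
        ∫ y in Ioo (-d / 2) (d / 2), (f y * (starRingEnd ℂ) (g y)).im :=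
      (Complex.imCLM.integral_comp_comm hint).symm
    rw [e1, ← integral_const_mul (2 : ℝ)]
    simp_rw [← normSq_polarization]
    have e2 := integral_sub ((hsq hfg).sub (hsq hf)) (hsq hg)
    have e3 := integral_sub (hsq hfg) (hsq hf)
    change ∫ y in Ioo (-d / 2) (d / 2), ‖f y + Complex.I * g y‖ ^ 2 - ‖f y‖ ^ 2 - ‖g y‖ ^ 2 =
      (∫ y in Ioo (-d / 2) (d / 2), ‖f y + Complex.I * g y‖ ^ 2 - ‖f y‖ ^ 2) - _ at e2
    rw [e2, e3]
    ring
  rw [eI] at hs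
  have hnn : ∀ n, 0 ≤ 2 * (a n * (starRingEnd ℂ) (b n)).im := by
    intro n
    obtain ⟨m, K, hm, hKm⟩ := reflectKernel_eq_mode (bc := bc) hd n
    have : a n * (starRingEnd ℂ) (b n) = ((Complex.normSq (1 / (2 * d) * K) : ℝ) : ℂ) *
        ((∫ y in Ioo (-d / 2) (d / 2), cmode bc d m y * f y) *
        (starRingEnd ℂ) (∫ y in Ioo (-d / 2) (d / 2), cmode bc d m y * g y)) := by
      simp only [a, b, hKm, mul_assoc, integral_const_mul]
      rw [← Complex.mul_conj]
      simp only [map_mul]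
      ring
    rw [this, Complex.im_ofReal_mul]
    exact mul_nonneg zero_le_two (mul_nonneg (Complex.normSq_nonneg _) (h m hm))
  have hd' : 0 < d⁻¹ := inv_pos.2 hd
  refine ⟨?_, fun h0 m hm => ?_⟩
  · have := hs.nonneg hnn
    have h2 := (mul_nonneg_iff_of_pos_left hd').1 this
    linarith
  · rw [h0, mul_zero, mul_zero] at hs
    obtain ⟨n, K, hK0, hKm⟩ := exists_reflectKernel_natCast (bc := bc) hd hm
    have hz := congrFun ((hasSum_zero_iff_of_nonneg hnn).1 hs) n
    have : a n * (starRingEnd ℂ) (b n) = ((Complex.normSq (1 / (2 * d) * K) : ℝ) : ℂ) *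
        ((∫ y in Ioo (-d / 2) (d / 2), cmode bc d m y * f y) *
        (starRingEnd ℂ) (∫ y in Ioo (-d / 2) (d / 2), cmode bc d m y * g y)) := by
      simp only [a, b, hKm, mul_assoc, integral_const_mul]
      rw [← Complex.mul_conj]
      simp only [map_mul]
      ring
    simp only [this, Complex.im_ofReal_mul, Pi.zero_apply] at hz
    have hne : Complex.normSq (1 / (2 * d) * K) ≠ 0 := by
      rw [Ne, Complex.normSq_eq_zero]
      have : (d : ℂ) ≠ 0 := by exact_mod_cast hd.ne'
      simp [hK0, this]
    have h3 := (mul_eq_zero.1 hz).resolve_left two_ne_zero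
    exact (mul_eq_zero.1 h3).resolve_left hne

/-! ### Complex conjugates and longitudinal cutoffs of fields -/

/-- The complex conjugate of a field. -/
noncomputable def conjField (F : Field) : Field where
  val := fun z => (starRingEnd ℂ) (F.val z)
  dx := fun z => (starRingEnd ℂ) (F.dx z)
  dy := fun z => (starRingEnd ℂ) (F.dy z)

/-- The product of a field with a function of `x`. -/
noncomputable def cutField (χ : ℝ → ℂ) (F : Field) : Field where
  val := fun z => χ z.1 * F.val z
  dx := fun z => deriv χ z.1 * F.val z + χ z.1 * F.dx z
  dy := fun z => χ z.1 * F.dy z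

lemma tsupport_conj_subset (φ : ℝ × ℝ → ℂ) :
    tsupport (fun z => (starRingEnd ℂ) (φ z)) ⊆ tsupport φ :=
  closure_mono (Function.support_comp_subset (map_zero (starRingEnd ℂ)) φ)

lemma eLpNorm_conj_sub {μ : Measure (ℝ × ℝ)} (F φ : ℝ × ℝ → ℂ) :
    eLpNorm (fun z => (starRingEnd ℂ) (F z) - (starRingEnd ℂ) (φ z)) 2 μ =
      eLpNorm (fun z => F z - φ z) 2 μ :=
  eLpNorm_congr_norm_ae (Eventually.of_forall fun z => by
    rw [← map_sub, RCLike.norm_conj])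

lemma InEnergySpace.conj {bc : WallCondition} {Ω Γ : Set (ℝ × ℝ)} {F : Field}
    (h : InEnergySpace bc Ω Γ F) : InEnergySpace bc Ω Γ (conjField F) := by
  refine ⟨⟨h.1.1.star, h.1.2.1.star, h.1.2.2.1.star, fun φ hφ hs => ?_⟩, fun hbc ε hε => ?_⟩
  · have key := h.1.2.2.2 _ hφ.conj ((tsupport_conj_subset φ).trans hs)
    simp_rw [pdx_conj hφ, pdy_conj hφ] at key
    constructor
    · have := congrArg (starRingEnd ℂ) key.1
      rw [map_neg, ← integral_conj, ← integral_conj] at this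
      simpa [conjField] using this
    · have := congrArg (starRingEnd ℂ) key.2
      rw [map_neg, ← integral_conj, ← integral_conj] at this
      simpa [conjField] using this
  · obtain ⟨φ, h1, h2, h3, h4, h5⟩ := h.2 hbc ε hε
    refine ⟨_, h1.conj, h2.mono_left (tsupport_conj_subset φ), ?_, ?_, ?_⟩
    · simpa only [conjField, eLpNorm_conj_sub] using h3
    · simpa only [conjField, pdx_conj h1, eLpNorm_conj_sub] using h4
    · simpa only [conjField, pdy_conj h1, eLpNorm_conj_sub] using h5

lemma InLocalEnergySpace.conj {bc : WallCondition} {d : ℝ} {F : Field}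
    (h : InLocalEnergySpace bc d F) : InLocalEnergySpace bc d (conjField F) :=
  fun R hR => (h R hR).conj

lemma IsChannelTrace.conj {d : ℝ} {F : Field} {τ : ℝ → ℂ} (h : IsChannelTrace d F τ) :
    IsChannelTrace d (conjField F) (fun y => (starRingEnd ℂ) (τ y)) := by
  refine ⟨h.1.star, fun φ hφ hs => ?_⟩
  have key := congrArg (starRingEnd ℂ) (h.2 _ hφ.conj ((tsupport_conj_subset φ).trans hs))
  simp_rw [pdx_conj hφ] at key
  rw [map_neg, ← integral_conj, ← integral_conj] at key
  simpa [conjField] using key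

lemma tendsto_eLpNorm_bdd_mul {α : Type*} [MeasurableSpace α] {μ : Measure α} {w : α → ℂ} {C : ℝ}
    (hw : ∀ z, ‖w z‖ ≤ C) {f : ℕ → α → ℂ} (hf : Tendsto (fun n => eLpNorm (f n) 2 μ) atTop (𝓝 0)) :
    Tendsto (fun n => eLpNorm (fun z => w z * f n z) 2 μ) atTop (𝓝 0) := by
  have h2 : Tendsto (fun n => ENNReal.ofReal C * eLpNorm (f n) 2 μ) atTop (𝓝 0) := by
    have := ENNReal.Tendsto.const_mul (a := ENNReal.ofReal C) hf (Or.inr ENNReal.ofReal_ne_top)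
    simpa using this
  refine tendsto_of_tendsto_of_tendsto_of_le_of_le tendsto_const_nhds h2 (fun _ => zero_le)
    fun n => eLpNorm_le_mul_eLpNorm_of_ae_le_mul (Eventually.of_forall fun z => ?_) 2
  rw [norm_mul]
  exact mul_le_mul_of_nonneg_right (hw z) (norm_nonneg _)

section Cut

variable {bc : WallCondition} {d : ℝ} {u : Field} {χ : ℝ → ℂ}

lemma pdx_cut {φ : ℝ × ℝ → ℂ} (hχ : ContDiff ℝ ∞ χ) (hφ : IsTest φ) (z : ℝ × ℝ) :
    pdx (fun z => φ z * χ z.1) z = pdx φ z * χ z.1 + φ z * deriv χ z.1 := by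
  rw [pdx_mul (hφ.differentiable z) ((contDiff_comp_fst hχ).differentiable (by simp) z), pdx_fst hχ]

lemma pdy_cut {φ : ℝ × ℝ → ℂ} (hχ : ContDiff ℝ ∞ χ) (hφ : IsTest φ) (z : ℝ × ℝ) :
    pdy (fun z => φ z * χ z.1) z = pdy φ z * χ z.1 := by
  rw [pdy_mul (hφ.differentiable z) ((contDiff_comp_fst hχ).differentiable (by simp) z), pdy_fst hχ,
    mul_zero, add_zero]

lemma LocL2.cut {f : ℝ × ℝ → ℂ} (hf : LocL2 d f) (hχ : Continuous χ) (hχs : HasCompactSupport χ) :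
    LocL2 d (fun z => χ z.1 * f z) := by
  obtain ⟨C, hC⟩ := hχ.bounded_above_of_compact_support hχs
  simp_rw [mul_comm (χ _)]
  exact hf.mul_bound (hχ.comp continuous_fst).aestronglyMeasurable fun z _ => hC z.1

lemma LocL2.cutField (h : LocL2 d u.val ∧ LocL2 d u.dx ∧ LocL2 d u.dy) (hχ : ContDiff ℝ ∞ χ)
    (hχs : HasCompactSupport χ) : LocL2 d (cutField χ u).val ∧ LocL2 d (cutField χ u).dx ∧
      LocL2 d (cutField χ u).dy :=
  ⟨h.1.cut hχ.continuous hχs,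
    (h.1.cut (hχ.continuous_deriv (by simp)) hχs.deriv).add (h.2.1.cut hχ.continuous hχs),
    h.2.2.cut hχ.continuous hχs⟩

lemma cutField_zero {R : ℝ} (hR : ∀ x, R ≤ x → χ x = 0 ∧ deriv χ x = 0) (z : ℝ × ℝ)
    (hz : R ≤ z.1) :
    (cutField χ u).val z = 0 ∧ (cutField χ u).dx z = 0 ∧ (cutField χ u).dy z = 0 := by
  simp [cutField, hR _ hz]

/-- A field of locally finite energy becomes an admissible test field after a longitudinal
cutoff. -/
lemma InLocalEnergySpace.cutField_isChannelTest (hu : InLocalEnergySpace bc d u)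
    (hχ : ContDiff ℝ ∞ χ) (hχs : HasCompactSupport χ) :
    IsChannelTest bc d (cutField χ u) := by
  obtain ⟨R, hR0, hR⟩ := exists_zero_of_hasCompactSupport hχs
  have hχ' : Continuous (deriv χ) := hχ.continuous_deriv (by simp)
  obtain ⟨C, hC⟩ := hχ.continuous.bounded_above_of_compact_support hχs
  obtain ⟨D, hD⟩ := hχ'.bounded_above_of_compact_support hχs.deriv
  have hz := cutField_zero (u := u) hR
  obtain ⟨h0, hx, hy⟩ := hu.locL2
  obtain ⟨l0, lx, ly⟩ := LocL2.cutField hu.locL2 hχ hχs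
  refine ⟨⟨⟨(memLp_channel_iff fun z h => (hz z h).1).2 (l0.memLp R),
    (memLp_channel_iff fun z h => (hz z h).2.1).2 (lx.memLp R),
    (memLp_channel_iff fun z h => (hz z h).2.2).2 (ly.memLp R), fun φ hφ hs => ?_⟩, fun hbc => ?_⟩,
    R, hz⟩
  · have ht : IsTest (fun z => φ z * χ z.1) := hφ.mul (contDiff_comp_fst hχ)
    have key := hu.weak_deriv ht (tsupport_mul_subset_left.trans hs)
    simp_rw [pdx_cut hχ hφ, pdy_cut hχ hφ] at key
    have zR : ∀ (f : ℝ × ℝ → ℂ) (z : ℝ × ℝ), R ≤ z.1 → f z * χ z.1 = 0 := fun f z hz => by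
      rw [(hR _ hz).1, mul_zero]
    have zR' : ∀ (f : ℝ × ℝ → ℂ) (z : ℝ × ℝ), R ≤ z.1 → f z * deriv χ z.1 = 0 := fun f z hz => by
      rw [(hR _ hz).2, mul_zero]
    have lc : ∀ {f : ℝ × ℝ → ℂ}, IsTest f → LocL2 d (fun z => f z * χ z.1) := fun hf => by
      simpa only [mul_comm] using (hf.locL2 d).cut hχ.continuous hχs
    have lc' : ∀ {f : ℝ × ℝ → ℂ}, IsTest f → LocL2 d (fun z => f z * deriv χ z.1) := fun hf => by
      simpa only [mul_comm] using (hf.locL2 d).cut hχ' hχs.deriv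
    have i1 := h0.integrableOn_mul (lc hφ.pdx) (zR _)
    have i2 := h0.integrableOn_mul (lc' hφ) (zR' _)
    have i3 := hx.integrableOn_mul (lc hφ) (zR _)
    constructor
    · have k1 := key.1
      simp_rw [mul_add] at k1
      rw [integral_add i1 i2] at k1
      have e1 : ∫ z in channel d, (cutField χ u).val z * pdx φ z =
          ∫ z in channel d, u.val z * (pdx φ z * χ z.1) := by
        congr 1; ext z; simp only [cutField]; ring
      have e2 : ∫ z in channel d, (cutField χ u).dx z * φ z =
          (∫ z in channel d, u.val z * (φ z * deriv χ z.1)) +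
            ∫ z in channel d, u.dx z * (φ z * χ z.1) := by
        rw [← integral_add i2 i3]
        congr 1; ext z; simp only [cutField]; ring
      rw [e1, e2]
      linear_combination k1
    · refine Eq.trans ?_ (key.2.trans ?_)
      · congr 1; ext z; simp only [cutField]; ring
      · congr 2; ext z; simp only [cutField]; ring
  · obtain ⟨φ, h1, h2, h3, h4, h5⟩ := ((hu R hR0).2 hbc).exists_seq
    have ez : ∀ {f g : ℝ × ℝ → ℂ}, (∀ z : ℝ × ℝ, R ≤ z.1 → f z = 0) →
        (∀ z : ℝ × ℝ, R ≤ z.1 → g z = 0) →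
        eLpNorm (fun z => f z - g z) 2 (volume.restrict (channel d)) =
          eLpNorm (fun z => f z - g z) 2 (volume.restrict (channelTrunc d R)) :=
      fun hf hg => eLpNorm_channel_eq fun z hz => by rw [hf z hz, hg z hz, sub_zero]
    refine VanishesOn.of_seq (fun n z => φ n z * χ z.1)
      (fun n => (h1 n).mul (contDiff_comp_fst hχ))
      (fun n => (h2 n).mono_left tsupport_mul_subset_left) ?_ ?_ ?_
    · simp_rw [fun n => ez (g := fun z => φ n z * χ z.1) (fun z h => (hz z h).1)
        fun z hz => by rw [(hR _ hz).1, mul_zero]]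
      refine (tendsto_eLpNorm_bdd_mul (w := fun z => χ z.1) (fun z => hC z.1) h3).congr fun n => ?_
      congr 1; ext z; simp only [cutField]; ring
    · simp_rw [fun n z => pdx_cut hχ (h1 n) z]
      simp_rw [fun n => ez (g := fun z => pdx (φ n) z * χ z.1 + φ n z * deriv χ z.1)
        (fun z h => (hz z h).2.1) fun z hz => by rw [(hR _ hz).1, (hR _ hz).2]; simp]
      have t1 := tendsto_eLpNorm_bdd_mul (w := fun z => deriv χ z.1) (fun z => hD z.1) h3
      have t2 := tendsto_eLpNorm_bdd_mul (w := fun z => χ z.1) (fun z => hC z.1) h4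
      have t := t1.add t2
      rw [add_zero] at t
      refine tendsto_of_tendsto_of_tendsto_of_le_of_le tendsto_const_nhds t (fun _ => zero_le)
        fun n => ?_
      refine le_trans (le_of_eq ?_) (eLpNorm_add_le ?_ ?_ one_le_two)
      · congr 1; ext z; simp only [cutField, Pi.add_apply]; ring
      · exact (hχ'.comp continuous_fst).aestronglyMeasurable.mul
          ((h0.memLp R).1.sub (h1 n).continuous.aestronglyMeasurable)
      · exact (hχ.continuous.comp continuous_fst).aestronglyMeasurable.mul
          ((hx.memLp R).1.sub (h1 n).pdx.continuous.aestronglyMeasurable)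
    · simp_rw [fun n z => pdy_cut hχ (h1 n) z]
      simp_rw [fun n => ez (g := fun z => pdy (φ n) z * χ z.1) (fun z h => (hz z h).2.2)
        fun z hz => by rw [(hR _ hz).1, mul_zero]]
      refine (tendsto_eLpNorm_bdd_mul (w := fun z => χ z.1) (fun z => hC z.1) h5).congr fun n => ?_
      congr 1; ext z; simp only [cutField]; ring

lemma IsChannelTrace.cutField {τ : ℝ → ℂ} (h : IsChannelTrace d u τ) (hχ : ContDiff ℝ ∞ χ)
    (h0 : χ 0 = 1) : IsChannelTrace d (cutField χ u) τ := by
  refine ⟨h.1, fun φ hφ hs => ?_⟩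
  have key := h.2 _ (hφ.mul (contDiff_comp_fst hχ)) (tsupport_mul_subset_left.trans hs)
  simp_rw [pdx_cut hχ hφ, h0, mul_one] at key
  rw [← key]
  congr 1
  ext z
  simp only [Guide.cutField]
  ring

end Cut

/-! ### Energy flux of an outgoing solution -/

lemma LocL2.ae_memLp_slice {d : ℝ} {f : ℝ × ℝ → ℂ} (hf : LocL2 d f) (R : ℝ) :
    ∀ᵐ x, x ∈ Ioo 0 R → MemLp (fun y => f (x, y)) 2 (volume.restrict (Ioo (-d / 2) (d / 2))) := by
  have h := hf.memLp R
  rw [channelTrunc, Measure.volume_eq_prod, ← Measure.prod_restrict] at h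
  rw [← ae_restrict_iff' measurableSet_Ioo]
  have hi := ((memLp_two_iff_integrable_sq_norm h.1).1 h).prod_right_ae
  filter_upwards [h.1.prodMk_left, hi] with x h1 h2
  exact (memLp_two_iff_integrable_sq_norm h1).2 h2

lemma mul_mul_conj (a b : ℂ) : a * b * (starRingEnd ℂ) b = a * (Complex.normSq b : ℂ) := by
  rw [mul_assoc, Complex.mul_conj]

/-- The imaginary part of the form against `χ conj(u)` only sees the derivative of `χ`. -/
lemma im_form_cutField_conj {d k : ℝ} {u : Field}
    (hu : LocL2 d u.val ∧ LocL2 d u.dx ∧ LocL2 d u.dy) {χ : ℝ → ℝ} (hχ : ContDiff ℝ ∞ χ)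
    (hχs : HasCompactSupport χ) :
    IntegrableOn (fun x => deriv χ x *
        (∫ y in Ioo (-d / 2) (d / 2), u.dx (x, y) * (starRingEnd ℂ) (u.val (x, y))).im) (Ioi 0) ∧
    (helmholtzForm k (channel d) u (cutField (fun x => (χ x : ℂ)) (conjField u))).im =
      ∫ x in Ioi 0, deriv χ x *
        (∫ y in Ioo (-d / 2) (d / 2), u.dx (x, y) * (starRingEnd ℂ) (u.val (x, y))).im := by
  have hχc : ContDiff ℝ ∞ (fun x => (χ x : ℂ)) := Complex.ofRealCLM.contDiff.comp hχ
  have hχcs : HasCompactSupport (fun x => (χ x : ℂ)) :=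
    hχs.comp_left (g := ((↑) : ℝ → ℂ)) Complex.ofReal_zero
  have hd : ∀ x, deriv (fun x => (χ x : ℂ)) x = ((deriv χ x : ℝ) : ℂ) := fun x =>
    ((hχ.differentiable (by simp) x).hasDerivAt.ofReal_comp).deriv
  obtain ⟨R, hR0, hR⟩ := exists_zero_of_hasCompactSupport hχcs
  obtain ⟨h0, hx, hy⟩ := hu
  have hc : LocL2 d (conjField u).val ∧ LocL2 d (conjField u).dx ∧ LocL2 d (conjField u).dy :=
    ⟨h0.conj, hx.conj, hy.conj⟩
  obtain ⟨l0, lx, ly⟩ := LocL2.cutField hc hχc hχcs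
  have i := integrableOn_form (k := k) (R := R) h0 hx hy l0 lx ly (cutField_zero hR)
  have j : IntegrableOn (fun z => ((deriv χ z.1 : ℝ) : ℂ) * (u.dx z * (starRingEnd ℂ) (u.val z)))
      (channel d) := by
    have := hx.integrableOn_mul (R := R) (h0.conj.cut (hχc.continuous_deriv (by simp)) hχcs.deriv)
      fun z hz => by rw [(hR _ hz).2, zero_mul]
    refine this.congr_fun (fun z _ => ?_) (measurableSet_channel d)
    simp only [hd]
    ring
  have e : (helmholtzForm k (channel d) u (cutField (fun x => (χ x : ℂ)) (conjField u))).im =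
      ∫ z in channel d, (((deriv χ z.1 : ℝ) : ℂ) * (u.dx z * (starRingEnd ℂ) (u.val z))).im := by
    rw [helmholtzForm, ← Complex.imCLM_apply, ← Complex.imCLM.integral_comp_comm i]
    congr 1
    ext z
    simp only [cutField, conjField, hd, Complex.imCLM_apply]
    simp [pow_two]
    ring
  have hfub : ∫ z in channel d, (((deriv χ z.1 : ℝ) : ℂ) * (u.dx z * (starRingEnd ℂ) (u.val z))) =
      ∫ x in Ioi 0, ((deriv χ x : ℝ) : ℂ) *
        ∫ y in Ioo (-d / 2) (d / 2), u.dx (x, y) * (starRingEnd ℂ) (u.val (x, y)) := by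
    rw [channel, Measure.volume_eq_prod] at j ⊢
    rw [setIntegral_prod _ j]
    simp_rw [integral_const_mul]
  have j' : IntegrableOn (fun x => ((deriv χ x : ℝ) : ℂ) *
      ∫ y in Ioo (-d / 2) (d / 2), u.dx (x, y) * (starRingEnd ℂ) (u.val (x, y))) (Ioi 0) := by
    rw [channel, Measure.volume_eq_prod, IntegrableOn, ← Measure.prod_restrict] at j
    refine j.integral_prod_left.congr (Eventually.of_forall fun x => ?_)
    simp only [integral_const_mul]
  have him : ∀ x, (((deriv χ x : ℝ) : ℂ) * ∫ y in Ioo (-d / 2) (d / 2),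
      u.dx (x, y) * (starRingEnd ℂ) (u.val (x, y))).im = deriv χ x *
      (∫ y in Ioo (-d / 2) (d / 2), u.dx (x, y) * (starRingEnd ℂ) (u.val (x, y))).im :=
    fun x => Complex.im_ofReal_mul _ _
  refine ⟨?_, ?_⟩
  · have := Complex.imCLM.integrable_comp j'
    refine this.congr (Eventually.of_forall fun x => ?_)
    simp only [Complex.imCLM_apply, him]
  · rw [e]
    have e1 := Complex.imCLM.integral_comp_comm j
    have e2 := Complex.imCLM.integral_comp_comm j'
    simp only [Complex.imCLM_apply] at e1 e2
    rw [e1, hfub, ← e2]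
    simp_rw [him]

/-- Almost every slice of an outgoing solution carries a nonnegative energy flux, which vanishes
only if all propagating coefficients do. -/
lemma SolvesInPort.ae_flux_nonneg {bc : WallCondition} {k d : ℝ} (hk : 0 < k) (hd : 0 < d)
    {u : Field} (hu : SolvesInPort bc k d u) {τ : ℝ → ℂ} (hτ : IsChannelTrace d u τ)
    (hout : ∀ m, 1 ≤ m → projDx bc k d m u = Complex.I * beta bc k d m *
      ∫ y in Ioo (-d / 2) (d / 2), cmode bc d m y * τ y) (R : ℝ) :
    ∀ᵐ x, x ∈ Ioo 0 R →
      0 ≤ (∫ y in Ioo (-d / 2) (d / 2), u.dx (x, y) * (starRingEnd ℂ) (u.val (x, y))).im ∧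
      ((∫ y in Ioo (-d / 2) (d / 2), u.dx (x, y) * (starRingEnd ℂ) (u.val (x, y))).im = 0 →
        ∀ m, 1 ≤ m → 0 < (beta bc k d m).re →
          ∫ y in Ioo (-d / 2) (d / 2), cmode bc d m y * u.val (x, y) = 0 ∧
          ∫ y in Ioo (-d / 2) (d / 2), cmode bc d m y * u.dx (x, y) = 0) := by
  obtain ⟨h0, hx, -⟩ := hu.1.locL2
  have hall : ∀ᵐ x, ∀ m : ℕ, 1 ≤ m → x ∈ Ioi (0 : ℝ) →
      ∫ y in Ioo (-d / 2) (d / 2), cmode bc d m y *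
        (u.dx (x, y) - Complex.I * beta bc k d m * u.val (x, y)) = 0 := by
    rw [ae_all_iff]
    intro m
    by_cases hm : 1 ≤ m
    · filter_upwards [hu.ae_mode_coeff hk hd hm hτ (hout m hm)] with x hx _ using hx
    · exact Eventually.of_forall fun x h => absurd h hm
  filter_upwards [h0.ae_memLp_slice R, hx.ae_memLp_slice R, hall] with x s0 sx hm hxR
  replace s0 := s0 hxR
  replace sx := sx hxR
  have hint : ∀ m, ∀ {f : ℝ → ℂ}, MemLp f 2 (volume.restrict (Ioo (-d / 2) (d / 2))) →
      IntegrableOn (fun y => cmode bc d m y * f y) (Ioo (-d / 2) (d / 2)) := by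
    intro m f hf
    obtain ⟨C, hC⟩ := exists_bound_Ioo (contDiff_cmode bc d m).continuous d
    refine Integrable.bdd_mul (hf.integrable one_le_two) (c := C)
      (contDiff_cmode bc d m).continuous.aestronglyMeasurable ?_
    filter_upwards [ae_restrict_mem measurableSet_Ioo] with y hy using hC y hy
  have hcoef : ∀ m, 1 ≤ m → ∫ y in Ioo (-d / 2) (d / 2), cmode bc d m y * u.dx (x, y) =
      Complex.I * beta bc k d m * ∫ y in Ioo (-d / 2) (d / 2), cmode bc d m y * u.val (x, y) := by
    intro m h1
    have h2 := hm m h1 hxR.1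
    rw [← sub_eq_zero, ← h2, ← integral_const_mul,
      ← integral_sub (hint m sx) ((hint m s0).const_mul _)]
    congr 1
    ext y
    ring
  have him : ∀ m, 1 ≤ m → ((∫ y in Ioo (-d / 2) (d / 2), cmode bc d m y * u.dx (x, y)) *
      (starRingEnd ℂ) (∫ y in Ioo (-d / 2) (d / 2), cmode bc d m y * u.val (x, y))).im =
      (beta bc k d m).re *
        Complex.normSq (∫ y in Ioo (-d / 2) (d / 2), cmode bc d m y * u.val (x, y)) := by
    intro m h1
    rw [hcoef m h1, mul_mul_conj, Complex.im_mul_ofReal, Complex.I_mul_im]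
  obtain ⟨p1, p2⟩ := im_integral_mul_conj_nonneg (bc := bc) hd sx s0 fun m h1 => by
    rw [him m h1]
    exact mul_nonneg (beta_re_nonneg _ _ _ _) (Complex.normSq_nonneg _)
  refine ⟨p1, fun hJ m h1 hb => ?_⟩
  have h2 := p2 hJ m h1
  rw [him m h1] at h2
  have h3 := Complex.normSq_eq_zero.1 ((mul_eq_zero.1 h2).resolve_left hb.ne')
  exact ⟨h3, by rw [hcoef m h1, h3, mul_zero]⟩

/-- The energy radiated by an outgoing solution is nonnegative, and it is zero only if no
propagating mode is present. -/
lemma SolvesInPort.im_flux_nonneg {bc : WallCondition} {k d : ℝ} (hk : 0 < k) (hd : 0 < d)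
    {u : Field} (hu : SolvesInPort bc k d u) {τ : ℝ → ℂ} (hτ : IsChannelTrace d u τ)
    (hout : ∀ m, 1 ≤ m → projDx bc k d m u = Complex.I * beta bc k d m *
      ∫ y in Ioo (-d / 2) (d / 2), cmode bc d m y * τ y)
    {χ : ℝ → ℝ} (hχ : ContDiff ℝ ∞ χ) (hχs : HasCompactSupport χ) (hχ0 : χ 0 = 1)
    (hχ1 : ∀ x, 1 ≤ x → χ x = 0 ∧ deriv χ x = 0) (hχd : ∀ x ∈ Ioo (0 : ℝ) 1, deriv χ x < 0) :
    0 ≤ (channelFlux k d u (cutField (fun x => (χ x : ℂ)) (conjField u))).im ∧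
    ((channelFlux k d u (cutField (fun x => (χ x : ℂ)) (conjField u))).im = 0 →
      ∀ m, 1 ≤ m → 0 < (beta bc k d m).re → projDx bc k d m u = 0) := by
  obtain ⟨hi, he⟩ := im_form_cutField_conj (k := k) hu.1.locL2 hχ hχs
  have hae := hu.ae_flux_nonneg hk hd hτ hout 1
  have hnn : 0 ≤ᵐ[volume.restrict (Ioi 0)] fun x => -(deriv χ x *
      (∫ y in Ioo (-d / 2) (d / 2), u.dx (x, y) * (starRingEnd ℂ) (u.val (x, y))).im) := by
    filter_upwards [ae_restrict_mem measurableSet_Ioi, ae_restrict_of_ae hae] with x hx h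
    rcases lt_or_ge x 1 with h1 | h1
    · simp only [Pi.zero_apply]
      nlinarith [hχd x ⟨hx, h1⟩, (h ⟨hx, h1⟩).1]
    · simp [(hχ1 x h1).2]
  have hflux : (channelFlux k d u (cutField (fun x => (χ x : ℂ)) (conjField u))).im =
      ∫ x in Ioi 0, -(deriv χ x *
        (∫ y in Ioo (-d / 2) (d / 2), u.dx (x, y) * (starRingEnd ℂ) (u.val (x, y))).im) := by
    rw [channelFlux, Complex.neg_im, he, integral_neg]
  rw [hflux]
  refine ⟨integral_nonneg_of_ae hnn, fun h0 m hm hb => ?_⟩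
  have hz := (integral_eq_zero_iff_of_nonneg_ae hnn hi.neg).1 h0
  have hcoef : ∀ᵐ x, x ∈ Ioi (0 : ℝ) → x < 1 →
      ∫ y in Ioo (-d / 2) (d / 2), cmode bc d m y * u.val (x, y) = 0 ∧
      ∫ y in Ioo (-d / 2) (d / 2), cmode bc d m y * u.dx (x, y) = 0 := by
    rw [Filter.EventuallyEq, ae_restrict_iff' measurableSet_Ioi] at hz
    filter_upwards [hz, hae] with x h1 h2 hx hx1
    have h3 := h1 hx
    simp only [Pi.zero_apply, neg_eq_zero, mul_eq_zero] at h3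
    exact (h2 ⟨hx, hx1⟩).2 (h3.resolve_left (hχd x ⟨hx, hx1⟩).ne) m hm hb
  have hχc : ContDiff ℝ ∞ (fun x => (χ x : ℂ)) := Complex.ofRealCLM.contDiff.comp hχ
  have hχcs : HasCompactSupport (fun x => (χ x : ℂ)) :=
    hχs.comp_left (g := ((↑) : ℝ → ℂ)) Complex.ofReal_zero
  have hd' : ∀ x, deriv (fun x => (χ x : ℂ)) x = ((deriv χ x : ℝ) : ℂ) := fun x =>
    ((hχ.differentiable (by simp) x).hasDerivAt.ofReal_comp).deriv
  have hb' := (contDiff_cmode bc d m).continuous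
  obtain ⟨l0, lx, -⟩ := hu.1.locL2
  have key := hu.integral_mode hk hd hm hχc hχcs
  have z1 : ∫ x in Ioi 0, (χ x : ℂ) * ∫ y in Ioo (-d / 2) (d / 2), cmode bc d m y * u.val (x, y) =
      0 := by
    refine integral_eq_zero_of_ae ((ae_restrict_iff' measurableSet_Ioi).2 ?_)
    filter_upwards [hcoef] with x h hx
    rcases lt_or_ge x 1 with h1 | h1
    · rw [(h hx h1).1, mul_zero, Pi.zero_apply]
    · rw [(hχ1 x h1).1, Complex.ofReal_zero, zero_mul, Pi.zero_apply]
  have z2 : ∫ x in Ioi 0, deriv (fun x => (χ x : ℂ)) x *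
      ∫ y in Ioo (-d / 2) (d / 2), cmode bc d m y * u.dx (x, y) = 0 := by
    refine integral_eq_zero_of_ae ((ae_restrict_iff' measurableSet_Ioi).2 ?_)
    filter_upwards [hcoef] with x h hx
    rcases lt_or_ge x 1 with h1 | h1
    · rw [(h hx h1).2, mul_zero, Pi.zero_apply]
    · rw [hd', (hχ1 x h1).2, Complex.ofReal_zero, zero_mul, Pi.zero_apply]
  rw [lx.integral_sep (R := 1) (locL2_sep (hχc.continuous_deriv (by simp)) hχcs.deriv hb')
      (fun x hx => by rw [hd', (hχ1 x hx).2, Complex.ofReal_zero]),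
    l0.integral_sep (R := 1) (g := fun x => (χ x : ℂ)) (locL2_sep hχc.continuous hχcs hb')
      (fun x hx => by rw [(hχ1 x hx).1, Complex.ofReal_zero]), z1, z2] at key
  simpa [hχ0] using key

/-! ### Uniqueness of traces -/

/-- The trace on the end of the channel is unique up to a null set. -/
lemma IsChannelTrace.ae_eq {d : ℝ} {F : Field} {τ σ : ℝ → ℂ} (hτ : IsChannelTrace d F τ)
    (hσ : IsChannelTrace d F σ) : τ =ᵐ[volume.restrict (Ioo (-d / 2) (d / 2))] σ := by
  have iτ : IntegrableOn τ (Ioo (-d / 2) (d / 2)) := hτ.1.integrable one_le_two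
  have iσ : IntegrableOn σ (Ioo (-d / 2) (d / 2)) := hσ.1.integrable one_le_two
  have key := isOpen_Ioo.ae_eq_zero_of_integral_contDiff_smul_eq_zero (μ := volume)
    (U := Ioo (-d / 2) (d / 2)) (f := fun y => τ y - σ y)
    (iτ.sub iσ).locallyIntegrableOn ?_
  · rw [Filter.EventuallyEq, ae_restrict_iff' measurableSet_Ioo]
    filter_upwards [key] with y hy hyI
    exact sub_eq_zero.1 (hy hyI)
  · intro ψ hψ hψs hsub
    obtain ⟨κ, hκ, hκs, hκ1⟩ := exists_plateau 0
    have hψc : ContDiff ℝ ∞ (fun y => (ψ y : ℂ)) := Complex.ofRealCLM.contDiff.comp hψ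
    have hψcs : HasCompactSupport (fun y => (ψ y : ℂ)) :=
      hψs.comp_left (g := ((↑) : ℝ → ℂ)) Complex.ofReal_zero
    have ht := IsTest.sep hκ hκs hψc hψcs
    have hts : tsupport (fun z : ℝ × ℝ => κ z.1 * (ψ z.2 : ℂ)) ⊆
        univ ×ˢ Ioo (-d / 2) (d / 2) :=
      (tsupport_sep_subset κ (fun y => (ψ y : ℂ))).trans (prod_mono (subset_univ _)
        ((closure_mono (Function.support_comp_subset Complex.ofReal_zero ψ)).trans hsub))
    have e := (hτ.2 _ ht hts).symm.trans (hσ.2 _ ht hts)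
    simp only [hκ1 0 (by simp), one_mul, neg_inj] at e
    obtain ⟨C, hC⟩ := hψc.continuous.bounded_above_of_compact_support hψcs
    have j : ∀ {f : ℝ → ℂ}, IntegrableOn f (Ioo (-d / 2) (d / 2)) →
        IntegrableOn (fun y => f y * (ψ y : ℂ)) (Ioo (-d / 2) (d / 2)) := fun hf =>
      hf.mul_bdd (c := C) hψc.continuous.aestronglyMeasurable (Eventually.of_forall hC)
    rw [← setIntegral_eq_integral_of_forall_compl_eq_zero (s := Ioo (-d / 2) (d / 2))]
    · rw [← sub_eq_zero, ← integral_sub (j iτ) (j iσ)] at e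
      rw [← e]
      congr 1
      ext y
      rw [Complex.real_smul]
      ring
    · intro y hy
      rw [image_eq_zero_of_notMem_tsupport fun h => hy (hsub h), zero_smul]

lemma IsChannelTrace.proj_eq {bc : WallCondition} {d : ℝ} {F : Field} {τ : ℝ → ℂ}
    (hτ : IsChannelTrace d F τ) (m : ℕ) :
    proj bc d m F = ∫ y in Ioo (-d / 2) (d / 2), cmode bc d m y * τ y := by
  have h : ∃ τ, IsChannelTrace d F τ := ⟨τ, hτ⟩
  have hc : IsChannelTrace d F (channelTrace d F) := by
    rw [channelTrace, dif_pos h]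
    exact h.choose_spec
  refine integral_congr_ae ?_
  filter_upwards [hc.ae_eq hτ] with y hy
  rw [hy, cmode]

/-! ### Differences of solutions -/

/-- The difference of two fields. -/
noncomputable def subField (F G : Field) : Field where
  val := fun z => F.val z - G.val z
  dx := fun z => F.dx z - G.dx z
  dy := fun z => F.dy z - G.dy z

lemma VanishesOn.sub {Ω Γ : Set (ℝ × ℝ)} {F G : Field} (hF : IsH1On Ω F) (hG : IsH1On Ω G)
    (h : VanishesOn Ω Γ F) (h' : VanishesOn Ω Γ G) : VanishesOn Ω Γ (subField F G) := by
  obtain ⟨φ, a1, a2, a3, a4, a5⟩ := h.exists_seq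
  obtain ⟨ψ, b1, b2, b3, b4, b5⟩ := h'.exists_seq
  have key : ∀ {f g : ℝ × ℝ → ℂ} {v w : ℕ → ℝ × ℝ → ℂ}, MemLp f 2 (volume.restrict Ω) →
      MemLp g 2 (volume.restrict Ω) → (∀ n, Continuous (v n)) → (∀ n, Continuous (w n)) →
      Tendsto (fun n => eLpNorm (fun z => f z - v n z) 2 (volume.restrict Ω)) atTop (𝓝 0) →
      Tendsto (fun n => eLpNorm (fun z => g z - w n z) 2 (volume.restrict Ω)) atTop (𝓝 0) →
      Tendsto (fun n => eLpNorm (fun z => (f z - g z) - (v n z - w n z)) 2 (volume.restrict Ω))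
        atTop (𝓝 0) := by
    intro f g v w hf hg hv hw t1 t2
    have t := t1.add t2
    rw [add_zero] at t
    refine tendsto_of_tendsto_of_tendsto_of_le_of_le tendsto_const_nhds t (fun _ => zero_le)
      fun n => ?_
    refine le_trans (le_of_eq ?_) (eLpNorm_sub_le (hf.1.sub (hv n).aestronglyMeasurable)
      (hg.1.sub (hw n).aestronglyMeasurable) one_le_two)
    congr 1
    ext z
    simp only [Pi.sub_apply]
    ring
  have ht : ∀ n, IsTest (fun z => φ n z - ψ n z) := fun n =>
    ⟨(a1 n).1.sub (b1 n).1, (a1 n).2.sub (b1 n).2⟩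
  refine VanishesOn.of_seq (fun n z => φ n z - ψ n z) ht (fun n => ?_) ?_ ?_ ?_
  · exact (Disjoint.union_left (a2 n) (b2 n)).mono_left
      ((closure_mono (Function.support_sub _ _)).trans closure_union.subset)
  · exact key hF.1 hG.1 (fun n => (a1 n).continuous) (fun n => (b1 n).continuous) a3 b3
  · have e : ∀ n, pdx (fun z => φ n z - ψ n z) = fun z => pdx (φ n) z - pdx (ψ n) z := fun n => by
      ext z
      exact (pdx_eq_deriv ((ht n).differentiable z)).unique
        ((pdx_eq_deriv ((a1 n).differentiable z)).sub (pdx_eq_deriv ((b1 n).differentiable z)))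
    simp_rw [e]
    exact key hF.2.1 hG.2.1 (fun n => (a1 n).pdx.continuous) (fun n => (b1 n).pdx.continuous) a4 b4
  · have e : ∀ n, pdy (fun z => φ n z - ψ n z) = fun z => pdy (φ n) z - pdy (ψ n) z := fun n => by
      ext z
      exact (pdy_eq_deriv ((ht n).differentiable z)).unique
        ((pdy_eq_deriv ((a1 n).differentiable z)).sub (pdy_eq_deriv ((b1 n).differentiable z)))
    simp_rw [e]
    exact key hF.2.2.1 hG.2.2.1 (fun n => (a1 n).pdy.continuous) (fun n => (b1 n).pdy.continuous)
      a5 b5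

lemma setIntegral_sub_mul {Ω : Set (ℝ × ℝ)} {f g w : ℝ × ℝ → ℂ}
    (hf : MemLp f 2 (volume.restrict Ω)) (hg : MemLp g 2 (volume.restrict Ω))
    (hw : MemLp w 2 (volume.restrict Ω)) : ∫ z in Ω, (f z - g z) * w z =
      (∫ z in Ω, f z * w z) - ∫ z in Ω, g z * w z := by
  have i1 : IntegrableOn (fun z => f z * w z) Ω := hf.integrable_mul hw
  have i2 : IntegrableOn (fun z => g z * w z) Ω := hg.integrable_mul hw
  rw [← integral_sub i1 i2]
  simp_rw [sub_mul]

lemma InEnergySpace.sub {bc : WallCondition} {Ω Γ : Set (ℝ × ℝ)} {F G : Field}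
    (hF : InEnergySpace bc Ω Γ F) (hG : InEnergySpace bc Ω Γ G) :
    InEnergySpace bc Ω Γ (subField F G) := by
  obtain ⟨⟨f0, fx, fy, hFw⟩, hF2⟩ := hF
  obtain ⟨⟨g0, gx, gy, hGw⟩, hG2⟩ := hG
  refine ⟨⟨f0.sub g0, fx.sub gx, fy.sub gy, fun φ hφ hs => ?_⟩, fun hbc =>
    VanishesOn.sub ⟨f0, fx, fy, hFw⟩ ⟨g0, gx, gy, hGw⟩ (hF2 hbc) (hG2 hbc)⟩
  simp only [subField]
  rw [setIntegral_sub_mul f0 g0 (hφ.pdx.memLp _), setIntegral_sub_mul fx gx (hφ.memLp _),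
    setIntegral_sub_mul f0 g0 (hφ.pdy.memLp _), setIntegral_sub_mul fy gy (hφ.memLp _),
    (hFw φ hφ hs).1, (hFw φ hφ hs).2, (hGw φ hφ hs).1, (hGw φ hφ hs).2]
  constructor <;> ring

lemma helmholtzForm_sub {k : ℝ} {Ω : Set (ℝ × ℝ)} {F F' G : Field}
    (h : IntegrableOn (fun z => F.dx z * G.dx z + F.dy z * G.dy z -
      (k : ℂ) ^ 2 * (F.val z * G.val z)) Ω)
    (h' : IntegrableOn (fun z => F'.dx z * G.dx z + F'.dy z * G.dy z -
      (k : ℂ) ^ 2 * (F'.val z * G.val z)) Ω) :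
    helmholtzForm k Ω (subField F F') G = helmholtzForm k Ω F G - helmholtzForm k Ω F' G := by
  unfold helmholtzForm
  rw [← integral_sub h h']
  congr 1
  ext z
  simp only [subField]
  ring

lemma InEnergySpace.integrableOn_form {bc : WallCondition} {k : ℝ} {Ω Γ : Set (ℝ × ℝ)} {F G : Field}
    (hF : InEnergySpace bc Ω Γ F) (hG : InEnergySpace bc Ω Γ G) :
    IntegrableOn (fun z => F.dx z * G.dx z + F.dy z * G.dy z - (k : ℂ) ^ 2 * (F.val z * G.val z))
      Ω :=
  ((hF.1.2.1.integrable_mul hG.1.2.1).add (hF.1.2.2.1.integrable_mul hG.1.2.2.1)).sub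
    ((hF.1.1.integrable_mul hG.1.1).const_mul _)

lemma InLocalEnergySpace.integrableOn_form {bc : WallCondition} {k d : ℝ} {F G : Field}
    (hF : InLocalEnergySpace bc d F) (hG : IsChannelTest bc d G) :
    IntegrableOn (fun z => F.dx z * G.dx z + F.dy z * G.dy z - (k : ℂ) ^ 2 * (F.val z * G.val z))
      (channel d) := by
  obtain ⟨h, R, hR⟩ := hG
  exact Guide.integrableOn_form hF.locL2.1 hF.locL2.2.1 hF.locL2.2.2 (LocL2.of_memLp h.1.1)
    (LocL2.of_memLp h.1.2.1) (LocL2.of_memLp h.1.2.2.1) hR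

lemma channelFlux_sub {bc : WallCondition} {k d : ℝ} {F F' G : Field}
    (hF : InLocalEnergySpace bc d F) (hF' : InLocalEnergySpace bc d F')
    (hG : IsChannelTest bc d G) :
    channelFlux k d (subField F F') G = channelFlux k d F G - channelFlux k d F' G := by
  rw [channelFlux, helmholtzForm_sub (hF.integrableOn_form hG) (hF'.integrableOn_form hG),
    channelFlux, channelFlux]
  ring

lemma projDx_sub {bc : WallCondition} {k d : ℝ} {F F' : Field} (m : ℕ)
    (hF : InLocalEnergySpace bc d F) (hF' : InLocalEnergySpace bc d F') :
    projDx bc k d m (subField F F') = projDx bc k d m F - projDx bc k d m F' := by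
  obtain ⟨l0, lx, ly⟩ := locL2_modeLift bc d m
  have hi : ∀ {F : Field}, InLocalEnergySpace bc d F → _ := fun hF =>
    integrableOn_form (k := k) (R := 1) hF.locL2.1 hF.locL2.2.1 hF.locL2.2.2 l0 lx ly
      fun z hz => modeLift_zero bc d m hz
  rw [projDx, channelFlux, helmholtzForm_sub (hi hF) (hi hF'), projDx, projDx, channelFlux,
    channelFlux]
  ring

lemma IsChannelTrace.sub {bc : WallCondition} {d : ℝ} {F G : Field} {τ σ : ℝ → ℂ}
    (hF : InLocalEnergySpace bc d F) (hG : InLocalEnergySpace bc d G)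
    (hτ : IsChannelTrace d F τ) (hσ : IsChannelTrace d G σ) :
    IsChannelTrace d (subField F G) (fun y => τ y - σ y) := by
  refine ⟨hτ.1.sub hσ.1, fun φ hφ hs => ?_⟩
  obtain ⟨R, hR, hz⟩ := hφ.exists_zero
  have z0 : ∀ z : ℝ × ℝ, R ≤ z.1 → φ z = 0 := fun z h =>
    image_eq_zero_of_notMem_tsupport fun h' => (hz z h').not_ge h
  have z1 : ∀ z : ℝ × ℝ, R ≤ z.1 → pdx φ z = 0 := fun z h =>
    image_eq_zero_of_notMem_tsupport fun h' => (hz z (tsupport_pdx_subset φ h')).not_ge h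
  have hi : ∀ {F : Field}, InLocalEnergySpace bc d F →
      IntegrableOn (fun z => F.val z * pdx φ z + F.dx z * φ z) (channel d) := fun hF =>
    (hF.locL2.1.integrableOn_mul (hφ.pdx.locL2 d) z1).add
      (hF.locL2.2.1.integrableOn_mul (hφ.locL2 d) z0)
  have hφ0 : Continuous fun y => φ (0, y) := hφ.continuous.comp (Continuous.prodMk_right 0)
  obtain ⟨C, hC⟩ := exists_bound_Ioo hφ0 d
  have hj : ∀ {f : ℝ → ℂ}, MemLp f 2 (volume.restrict (Ioo (-d / 2) (d / 2))) →
      IntegrableOn (fun y => f y * φ (0, y)) (Ioo (-d / 2) (d / 2)) := fun hf =>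
    (hf.integrable one_le_two).mul_bdd (c := C) hφ0.aestronglyMeasurable
      (by filter_upwards [ae_restrict_mem measurableSet_Ioo] with y hy using hC y hy)
  have e : ∫ z in channel d, (subField F G).val z * pdx φ z + (subField F G).dx z * φ z =
      (∫ z in channel d, F.val z * pdx φ z + F.dx z * φ z) -
        ∫ z in channel d, G.val z * pdx φ z + G.dx z * φ z := by
    rw [← integral_sub (hi hF) (hi hG)]
    congr 1
    ext z
    simp only [subField]
    ring
  rw [e, hτ.2 φ hφ hs, hσ.2 φ hφ hs]
  simp_rw [sub_mul]
  rw [integral_sub (hj hτ.1) (hj hσ.1)]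
  ring

lemma SolvesInPort.sub {bc : WallCondition} {k d : ℝ} {F G : Field} (hF : SolvesInPort bc k d F)
    (hG : SolvesInPort bc k d G) : SolvesInPort bc k d (subField F G) := by
  refine ⟨fun R hR => (hF.1 R hR).sub (hG.1 R hR), fun H hH hH0 => ?_⟩
  rw [helmholtzForm_sub (hF.1.integrableOn_form hH) (hG.1.integrableOn_form hH),
    hF.2 H hH hH0, hG.2 H hH hH0, sub_zero]

/-- A rigid motion preserves area; the rotation is multiplication by a unit complex number. -/
lemma measurePreserving_place (o : ℝ × ℝ) (θ : ℝ) : MeasurePreserving (place o θ) := by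
  have h1 := Complex.volume_preserving_equiv_real_prod
  have h2 := (rotation (Circle.exp θ)).measurePreserving
  have h3 : MeasurePreserving (fun z : ℝ × ℝ => o + z) :=
    measurePreserving_add_left (volume : Measure (ℝ × ℝ)) o
  have h := h3.comp (h1.comp (h2.comp h1.symm))
  convert h using 1
  ext z
  · simp [place, Complex.measurableEquivRealProd, Complex.exp_ofReal_mul_I_re,
      Complex.exp_ofReal_mul_I_im]
    ring
  · simp [place, Complex.measurableEquivRealProd, Complex.exp_ofReal_mul_I_re,
      Complex.exp_ofReal_mul_I_im]
    ring

namespace Circuit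

variable {P : ℕ} {W : Circuit P}

lemma memLp_comp_place (p : Fin P) {f : ℝ × ℝ → ℂ} (hf : MemLp f 2 (volume.restrict W.core)) :
    MemLp (fun z => f (place (W.origin p) (W.angle p) z)) 2
      (volume.restrict (Ioo (-W.len) 0 ×ˢ Ioo (-W.width p / 2) (W.width p / 2))) := by
  have h := hf.comp_measurePreserving ((measurePreserving_place (W.origin p)
    (W.angle p)).restrict_preimage W.isOpen_core.measurableSet)
  exact h.mono_measure (Measure.restrict_mono_set _ fun z hz => W.strip_subset p z hz)

lemma IsCoreTrace.conj {p : Fin P} {F : Field} {τ : ℝ → ℂ} (h : W.IsCoreTrace p F τ) :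
    W.IsCoreTrace p (conjField F) (fun y => (starRingEnd ℂ) (τ y)) := by
  refine ⟨h.1.star, fun φ hφ hs => ?_⟩
  have key := congrArg (starRingEnd ℂ) (h.2 _ hφ.conj ((tsupport_conj_subset φ).trans hs))
  simp_rw [pdx_conj hφ] at key
  rw [← integral_conj, ← integral_conj] at key
  simp only [map_add, map_mul, Complex.conj_conj, Complex.conj_ofReal] at key
  exact key

lemma IsCoreTrace.sub {p : Fin P} {F G : Field} {τ σ : ℝ → ℂ}
    (hF : IsH1On W.core F) (hG : IsH1On W.core G)
    (hτ : W.IsCoreTrace p F τ) (hσ : W.IsCoreTrace p G σ) :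
    W.IsCoreTrace p (subField F G) (fun y => τ y - σ y) := by
  refine ⟨hτ.1.sub hσ.1, fun φ hφ hs => ?_⟩
  have hi : ∀ {F : Field}, IsH1On W.core F →
      IntegrableOn (fun z => F.val (place (W.origin p) (W.angle p) z) * pdx φ z +
        ((Real.cos (W.angle p) : ℂ) * F.dx (place (W.origin p) (W.angle p) z) +
          (Real.sin (W.angle p) : ℂ) * F.dy (place (W.origin p) (W.angle p) z)) * φ z)
        (Ioo (-W.len) 0 ×ˢ Ioo (-W.width p / 2) (W.width p / 2)) := fun hF =>
    ((memLp_comp_place p hF.1).integrable_mul (hφ.pdx.memLp _)).add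
      ((((memLp_comp_place p hF.2.1).const_mul _).add
        ((memLp_comp_place p hF.2.2.1).const_mul _)).integrable_mul (hφ.memLp _))
  have hφ0 : Continuous fun y => φ (0, y) := hφ.continuous.comp (Continuous.prodMk_right 0)
  obtain ⟨C, hC⟩ := exists_bound_Ioo hφ0 (W.width p)
  have hj : ∀ {f : ℝ → ℂ}, MemLp f 2 (volume.restrict (Ioo (-W.width p / 2) (W.width p / 2))) →
      IntegrableOn (fun y => f y * φ (0, y)) (Ioo (-W.width p / 2) (W.width p / 2)) := fun hf =>
    (hf.integrable one_le_two).mul_bdd (c := C) hφ0.aestronglyMeasurable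
      (by filter_upwards [ae_restrict_mem measurableSet_Ioo] with y hy using hC y hy)
  simp_rw [sub_mul]
  rw [integral_sub (hj hτ.1) (hj hσ.1), ← hτ.2 φ hφ hs, ← hσ.2 φ hφ hs,
    ← integral_sub (hi hF) (hi hG)]
  congr 1
  ext z
  simp only [subField]
  ring

lemma incoming_zero (bc : WallCondition) (k d x y : ℝ) :
    incoming bc k d (fun _ => 0) x y = 0 := by
  simp [incoming]

/-- The outgoing condition in terms of a given trace. -/
lemma IsSolution.projDx_eq {bc : WallCondition} {k : ℝ} {c : Fin P → ℕ → ℂ} {u₀ : Field}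
    {u : Fin P → Field} (h : W.IsSolution bc k c u₀ u) (p : Fin P) {m : ℕ} (hm : 1 ≤ m) :
    projDx bc k (W.width p) m (u p) =
      Complex.I * beta bc k (W.width p) m * proj bc (W.width p) m (u p) :=
  sub_eq_zero.1 (h.outgoing p m hm)

/-- The difference of two solutions with the same incoming field solves the homogeneous system. -/
lemma IsSolution.sub {bc : WallCondition} {k : ℝ} {c : Fin P → ℕ → ℂ} {u₀ v₀ : Field}
    {u v : Fin P → Field} (hu : W.IsSolution bc k c u₀ u) (hv : W.IsSolution bc k c v₀ v) :
    W.IsSolution bc k (fun _ _ => 0) (subField u₀ v₀) (fun p => subField (u p) (v p)) where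
  core := by
    refine ⟨hu.core.1.sub hv.core.1, fun G hG hG0 => ?_⟩
    rw [helmholtzForm_sub (hu.core.1.integrableOn_form hG) (hv.core.1.integrableOn_form hG),
      hu.core.2 G hG hG0, hv.core.2 G hG hG0, sub_zero]
  port p := (hu.port p).sub (hv.port p)
  trace_eq p := by
    obtain ⟨τ, h1, h2⟩ := hu.trace_eq p
    obtain ⟨σ, h3, h4⟩ := hv.trace_eq p
    refine ⟨_, h1.sub (hu.port p).1 (hv.port p).1 h3, ?_⟩
    convert h2.sub hu.core.1.1 hv.core.1.1 h4 using 2 with y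
    rw [incoming_zero]
    ring
  flux_eq G₀ G τ h0 h1 h2 h3 := by
    rw [helmholtzForm_sub (hu.core.1.integrableOn_form h0) (hv.core.1.integrableOn_form h0),
      hu.flux_eq G₀ G τ h0 h1 h2 h3, hv.flux_eq G₀ G τ h0 h1 h2 h3, ← Finset.sum_sub_distrib]
    refine Finset.sum_congr rfl fun p _ => ?_
    rw [channelFlux_sub (hu.port p).1 (hv.port p).1 (h1 p)]
    simp only [incoming_zero, deriv_const, zero_mul, integral_zero]
    ring
  outgoing p m hm := by
    obtain ⟨τ, h1, -⟩ := hu.trace_eq p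
    obtain ⟨σ, h3, -⟩ := hv.trace_eq p
    have e : proj bc (W.width p) m (subField (u p) (v p)) =
        proj bc (W.width p) m (u p) - proj bc (W.width p) m (v p) := by
      rw [(h1.sub (hu.port p).1 (hv.port p).1 h3).proj_eq, h1.proj_eq, h3.proj_eq]
      have hj : ∀ {f : ℝ → ℂ}, MemLp f 2 (volume.restrict (Ioo (-W.width p / 2) (W.width p / 2))) →
          IntegrableOn (fun y => cmode bc (W.width p) m y * f y)
            (Ioo (-W.width p / 2) (W.width p / 2)) := fun hf => by
        obtain ⟨C, hC⟩ := exists_bound_Ioo (contDiff_cmode bc (W.width p) m).continuous (W.width p)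
        exact (hf.integrable one_le_two).bdd_mul (c := C)
          (contDiff_cmode bc (W.width p) m).continuous.aestronglyMeasurable
          (by filter_upwards [ae_restrict_mem measurableSet_Ioo] with y hy using hC y hy)
      rw [← integral_sub (hj h1.1) (hj h3.1)]
      simp_rw [mul_sub]
    rw [projDx_sub m (hu.port p).1 (hv.port p).1, e, hu.projDx_eq p hm, hv.projDx_eq p hm]
    ring

/-- The form on the core is real on the diagonal. -/
lemma im_form_conj (k : ℝ) {Ω : Set (ℝ × ℝ)} (F : Field) :
    (helmholtzForm k Ω F (conjField F)).im = 0 := by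
  rw [← Complex.conj_eq_iff_im, helmholtzForm, ← integral_conj]
  congr 1
  ext z
  simp only [conjField, map_sub, map_add, map_mul, map_pow, Complex.conj_conj, Complex.conj_ofReal]
  ring

/-- Energy balance: without incoming field no energy leaves through any channel, so no propagating
mode is present. -/
lemma IsSolution.projDx_eq_zero {bc : WallCondition} {k : ℝ} (hk : 0 < k) {u₀ : Field}
    {u : Fin P → Field} (h : W.IsSolution bc k (fun _ _ => 0) u₀ u) (p : Fin P) {m : ℕ}
    (hm : 1 ≤ m) (hb : 0 < (beta bc k (W.width p) m).re) :
    projDx bc k (W.width p) m (u p) = 0 := by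
  obtain ⟨χ, hχ, hχs, hχ0, hχ1, hχd⟩ := exists_decreasing_cutoff
  have hχc : ContDiff ℝ ∞ (fun x => (χ x : ℂ)) := Complex.ofRealCLM.contDiff.comp hχ
  have hχcs : HasCompactSupport (fun x => (χ x : ℂ)) :=
    hχs.comp_left (g := ((↑) : ℝ → ℂ)) Complex.ofReal_zero
  choose τ h1 h2 using h.trace_eq
  simp only [incoming_zero, add_zero] at h2
  have hflux := fun p => (h.port p).im_flux_nonneg hk (W.width_pos p) (h1 p)
    (fun m hm => by rw [h.projDx_eq p hm, (h1 p).proj_eq]) hχ hχs hχ0 hχ1 hχd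
  -- Test with the conjugate of the solution, cut off in the channels.
  have bal := h.flux_eq (conjField u₀)
    (fun p => cutField (fun x => (χ x : ℂ)) (conjField (u p))) _ h.core.1.conj
    (fun p => (h.port p).1.conj.cutField_isChannelTest hχc hχcs) (fun p => (h2 p).conj)
    (fun p => (h1 p).conj.cutField hχc (by rw [hχ0, Complex.ofReal_one]))
  simp only [incoming_zero, deriv_const, zero_mul, integral_zero, add_zero] at bal
  have bal' := congrArg Complex.im bal
  rw [im_form_conj, Complex.im_sum] at bal'
  exact (hflux p).2 ((Finset.sum_eq_zero_iff_of_nonneg fun q _ => (hflux q).1).1 bal'.symm p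
    (Finset.mem_univ p)) m hm hb

end Circuit

end Guide

/-- If all incoming fields vanish, then all outgoing propagating coefficients vanish; hence the
outgoing propagating coefficients are determined by the incoming ones. -/
theorem theorem2p2 (bc : Guide.WallCondition) {P : ℕ} (W : Guide.Circuit P) (k : ℝ) (hk : 0 < k) :
    (∀ (u₀ : Guide.Field) (u : Fin P → Guide.Field),
      W.IsSolution bc k (fun _ _ => 0) u₀ u →
      ∀ (p : Fin P) (m : ℕ), 1 ≤ m → m ≤ Guide.numModes bc k (W.width p) →
        Guide.projDx bc k (W.width p) m (u p) +
          Complex.I * Guide.beta bc k (W.width p) m * Guide.proj bc (W.width p) m (u p) = 0) ∧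
    (∀ (c : Fin P → ℕ → ℂ) (u₀ v₀ : Guide.Field) (u v : Fin P → Guide.Field),
      W.IsSolution bc k c u₀ u → W.IsSolution bc k c v₀ v →
      ∀ (p : Fin P) (m : ℕ), 1 ≤ m → m ≤ Guide.numModes bc k (W.width p) →
        Guide.outCoeff bc k (W.width p) m (u p) = Guide.outCoeff bc k (W.width p) m (v p)) := by
  refine ⟨fun u₀ u h p m hm hmM => ?_, fun c u₀ v₀ u v hu hv p m hm hmM => ?_⟩
  · have h0 := h.projDx_eq_zero hk p hm (Guide.beta_re_pos (W.width_pos p) hm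
      (Guide.transverse_lt_of_le_numModes (W.width_pos p) hm hmM))
    rw [← h.projDx_eq p hm, h0, add_zero]
  · have h0 := (hu.sub hv).projDx_eq_zero hk p hm (Guide.beta_re_pos (W.width_pos p) hm
      (Guide.transverse_lt_of_le_numModes (W.width_pos p) hm hmM))
    rw [Guide.projDx_sub m (hu.port p).1 (hv.port p).1, sub_eq_zero] at h0
    rw [Guide.outCoeff, Guide.outCoeff, ← hu.projDx_eq p hm, ← hv.projDx_eq p hm, h0]
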